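/- **Setting.** For $n\ge 1$, $h:\mathbb{R}\to\mathbb{R}$ belongs to $C_b^n(\mathbb{R})$ if $h^{(n-1)}$ exists and is absolutely continuous and the derivatives of $h$ of orders $1,\dots,n$ are bounded (the $n$-th where it exists); $h$ itself need not be bounded. Put $h_n=\sum_{k=1}^n {n\brace k}\|h^{(k)}\|$, where ${n\brace k}$ are the Stirling numbers of the second kind and $\|\cdot\|$ is the supremum norm (for $k=n$ over the points where $h^{(n)}$ exists). For $P:\mathbb{R}^d\to[0,\infty)$, $g:\mathbb{R}^d\to\mathbb{R}$ belongs to $C_P^n(\mathbb{R}^d)$ if all partial derivatives of $g$ up to order $n$ exist everywhere and $$\Big|\frac{\partial^k g(\mathbf w)}{\partial w_{i_1}\cdots\partial w_{i_k}}\Big|^{n/k}\le P(\mathbf w)\qquad\text{for all }\mathbf w\in\mathbb{R}^d,\ 1\le i_1,\dots,i_k\le d,\ k=1,\dots,n.$$ Let $p\ge 2$ be even, let $A,B,r_1,\dots,r_d\ge 0$ and $P(\mathbf w)=A+B\sum_{i=1}^d|w_i|^{r_i}$. Let $n_1,\dots,n_d\ge 1$ and let $X_{ij}$ ($1\le i\le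 n_j$, $1\le j\le d$) be independent real random variables with $\mathbb{E}X_{ij}^k=\mathbb{E}Z^k$ for all $i,j$ and all $1\le k\le p$, where $Z\sim N(0,1)$, and with $\mathbb{E}|X_{ij}|^{r_l+p+2}<\infty$ for all $i,j,l$. Let $W_j=n_j^{-1/2}\sum_{i=1}^{n_j}X_{ij}$, $\mathbf W=(W_1,\dots,W_d)$, and let $\mathbf Z$ be a standard $d$-dimensional normal vector. **Theorem.** (a) If $g\in C_P^{p+2}(\mathbb{R}^d)$ is even ($g(-\mathbf w)=g(\mathbf w)$ for all $\mathbf w$) and $h\in C_b^{p+2}(\mathbb{R})$, then $h(g(\mathbf W))$ and $h(g(\mathbf Z))$ are integrable and $|\mathbb{E}h(g(\mathbf W))-\mathbb{E}h(g(\mathbf Z))|\le\mathcal{B}$, where $$\mathcal{B}=\frac{h_{p+2}}{p!}\Bigg\{\frac{1}{p+2}\sum_{j=1}^d\sum_{i=1}^{n_j}\frac{1}{n_j^{p/2+1}}\Big(\frac{p+2}{p+1}+|\mathbb{E}X_{ij}^{p+1}|\Big)\,T_{ij}+\frac32\sum_{j=1}^d\sum_{i=1}^{n_j}\frac{|\mathbb{E}X_{ij}^{p+1}|}{n_j^{(p+1)/2}}\sum_{k=1}^d\sum_{l=1}^{n_k}\frac{1}{n_k^{3/2}}\,U_{lk}\Bigg\},$$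 $$T_{ij}=A\,\mathbb{E}|X_{ij}|^{p+2}+B\sum_{m=1}^d2^{r_m}\Big(2^{r_m}\mathbb{E}|X_{ij}|^{p+2}\,\mathbb{E}|W_m|^{r_m}+\frac{2^{r_m}}{n_j^{r_m/2}}\mathbb{E}|X_{ij}|^{r_m+p+2}+\mathbb{E}|Z|^{r_m}\,\mathbb{E}|X_{ij}|^{p+2}\Big),$$ $$U_{lk}=A\,\mathbb{E}|X_{lk}|^{3}+B\sum_{m=1}^d3^{r_m}\Big(2^{r_m}\mathbb{E}|X_{lk}|^{3}\,\mathbb{E}|W_m|^{r_m}+\frac{2^{r_m}}{n_k^{r_m/2}}\mathbb{E}|X_{lk}|^{r_m+3}+2\,\mathbb{E}|Z|^{r_m+1}\,\mathbb{E}|X_{lk}|^{3}\Big).$$ (b) The bound is of order $n^{-p/2}$ with $n=\min_jn_j$: for every $M$ there is a constant $C$, depending only on $d,p,A,B,r_1,\dots,r_d$ and $M$, such that if moreover $\mathbb{E}|X_{ij}|^{r_l+p+2}\le M$ for all $i,j,l$, then $\mathcal{B}\le C\,h_{p+2}\,n^{-p/2}$ for every $h\in C_b^{p+2}(\mathbb{R})$.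 In particular ($p=2$) the rate is $n^{-1}$, even when the third moments of the $X_{ij}$ are non-zero. -/

import Mathlib

open MeasureTheory ProbabilityTheory

universe u

noncomputable section

/-- The class `C_b^n(ℝ)`, for `n ≥ 1`: `h^{(n-1)}` exists and is absolutely continuous, and the
derivatives of orders `1, …, n` are bounded.  The function `h` itself need not be bounded.  The
`n`-th derivative of such an `h` may fail to exist on a null set, where `iteratedDeriv n h` is
zero, so the last clause bounds it exactly at the points where it exists. -/
structure ClassCb (n : ℕ) (h : ℝ → ℝ) : Prop where
  contDiff : ContDiff ℝ ((n - 1 : ℕ) : ℕ∞) h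
  absCont : ∀ a b : ℝ, AbsolutelyContinuousOnInterval (iteratedDeriv (n - 1) h) a b
  bdd : ∀ k : ℕ, 1 ≤ k → k ≤ n → BddAbove (Set.range fun x : ℝ => |iteratedDeriv k h x|)

/-- The supremum norm of a real function. -/
def supNorm (f : ℝ → ℝ) : ℝ := ⨆ x : ℝ, |f x|

/-- `h_n = ∑_{k=1}^n S(n,k) ‖h^{(k)}‖`, with `S(n,k)` the Stirling numbers of the second kind. -/
def hConst (n : ℕ) (h : ℝ → ℝ) : ℝ :=
  ∑ k ∈ Finset.Icc 1 n, (Nat.stirlingSecond n k : ℝ) * supNorm (iteratedDeriv k h)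

/-- Iterated partial derivatives; `iterPartial [i₁, …, iₖ] g = ∂_{i₁} ⋯ ∂_{iₖ} g`. -/
def iterPartial {d : ℕ} : List (Fin d) → ((Fin d → ℝ) → ℝ) → (Fin d → ℝ) → ℝ
  | [], g => g
  | i :: l, g => fun w => lineDeriv ℝ (iterPartial l g) w (Pi.single i 1)

/-- The class `C_P^n(ℝ^d)`: all partial derivatives of `g` up to order `n` exist everywhere, and
those of order `k = 1, …, n` satisfy `|∂^k g(w)|^{n/k} ≤ P(w)`, where `P ≥ 0`. -/
structure ClassCP {d : ℕ} (n : ℕ) (P : (Fin d → ℝ) → ℝ) (g : (Fin d → ℝ) → ℝ) : Prop where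
  dom_nonneg : ∀ w, 0 ≤ P w
  exists_partial : ∀ l : List (Fin d), l.length < n → ∀ (i : Fin d) (w : Fin d → ℝ),
    LineDifferentiableAt ℝ (iterPartial l g) w (Pi.single i 1)
  bound : ∀ l : List (Fin d), 1 ≤ l.length → l.length ≤ n → ∀ w : Fin d → ℝ,
    |iterPartial l g w| ^ ((n : ℝ) / (l.length : ℝ)) ≤ P w

/-- The dominating function `P(w) = A + B ∑ i, |w i|^{r i}`. -/
def polyDom {d : ℕ} (A B : ℝ) (r : Fin d → ℝ) (w : Fin d → ℝ) : ℝ :=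
  A + B * ∑ i, |w i| ^ r i

/-- The absolute moment `E|Y|^s`. -/
def absMoment {Ω : Type u} [MeasurableSpace Ω] (μ : Measure Ω) (Y : Ω → ℝ) (s : ℝ) : ℝ :=
  ∫ ω, |Y ω| ^ s ∂μ

/-- The absolute moment `E|Z|^s` of a standard normal random variable `Z`. -/
def normalAbsMoment (s : ℝ) : ℝ := absMoment (gaussianReal 0 1) (fun x : ℝ => x) s

/-- The law of a standard `d`-dimensional normal random vector. -/
def stdNormal (d : ℕ) : Measure (Fin d → ℝ) := Measure.pi fun _ => gaussianReal 0 1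

/-- The vector of standardised sums, `W j = n_j^{-1/2} ∑ i, X_{ij}`; here `X j i` is `X_{ij}`. -/
def sumVec {Ω : Type u} {d : ℕ} {n : Fin d → ℕ} (X : (j : Fin d) → Fin (n j) → Ω → ℝ) (ω : Ω) :
    Fin d → ℝ :=
  fun j => (1 / Real.sqrt (n j)) * ∑ i, X j i ω

/-- The standing assumptions on the array `X_{ij}`, `1 ≤ i ≤ n_j`, `1 ≤ j ≤ d`: the entries are
independent random variables, their moments of orders `1, …, p` are those of the standard normal
distribution, and `E|X_{ij}|^{r_l + p + 2} < ∞` for all `i`, `j`, `l`. -/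
structure MatchingArray {Ω : Type u} [MeasurableSpace Ω] (μ : Measure Ω) {d : ℕ} (p : ℕ)
    (r : Fin d → ℝ) (n : Fin d → ℕ) (X : (j : Fin d) → Fin (n j) → Ω → ℝ) : Prop where
  pos : ∀ j, 0 < n j
  meas : ∀ j i, Measurable (X j i)
  indep : iIndepFun (fun s : (Σ j : Fin d, Fin (n j)) => X s.1 s.2) μ
  moments : ∀ j i, ∀ k : ℕ, 1 ≤ k → k ≤ p →
    ∫ ω, X j i ω ^ k ∂μ = ∫ x : ℝ, x ^ k ∂(gaussianReal 0 1)
  integrable : ∀ j i l, Integrable (fun ω => |X j i ω| ^ (r l + p + 2)) μ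

/-- The first bracket of the bound, attached to the variable `X_{ij}`. -/
def bracketOne {Ω : Type u} [MeasurableSpace Ω] (μ : Measure Ω) {d : ℕ} (p : ℕ) (A B : ℝ)
    (r : Fin d → ℝ) {n : Fin d → ℕ} (X : (j : Fin d) → Fin (n j) → Ω → ℝ)
    (j : Fin d) (i : Fin (n j)) : ℝ :=
  A * absMoment μ (X j i) (p + 2) +
    B * ∑ m, (2 : ℝ) ^ r m *
      ((2 : ℝ) ^ r m * absMoment μ (X j i) (p + 2) * absMoment μ (fun ω => sumVec X ω m) (r m)
        + (2 : ℝ) ^ r m / (n j : ℝ) ^ (r m / 2) * absMoment μ (X j i) (r m + p + 2)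
        + normalAbsMoment (r m) * absMoment μ (X j i) (p + 2))

/-- The second bracket of the bound, attached to the variable `X_{lk}`. -/
def bracketTwo {Ω : Type u} [MeasurableSpace Ω] (μ : Measure Ω) {d : ℕ} (A B : ℝ)
    (r : Fin d → ℝ) {n : Fin d → ℕ} (X : (j : Fin d) → Fin (n j) → Ω → ℝ)
    (k : Fin d) (l : Fin (n k)) : ℝ :=
  A * absMoment μ (X k l) 3 +
    B * ∑ m, (3 : ℝ) ^ r m *
      ((2 : ℝ) ^ r m * absMoment μ (X k l) 3 * absMoment μ (fun ω => sumVec X ω m) (r m)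
        + (2 : ℝ) ^ r m / (n k : ℝ) ^ (r m / 2) * absMoment μ (X k l) (r m + 3)
        + 2 * normalAbsMoment (r m + 1) * absMoment μ (X k l) 3)

/-- The explicit bound, with `H` in the place of `h_{p+2}`. -/
def evenBound {Ω : Type u} [MeasurableSpace Ω] (μ : Measure Ω) {d : ℕ} (p : ℕ) (A B : ℝ)
    (r : Fin d → ℝ) {n : Fin d → ℕ} (X : (j : Fin d) → Fin (n j) → Ω → ℝ) (H : ℝ) : ℝ :=
  1 / (p.factorial : ℝ) * H *
    (1 / ((p : ℝ) + 2) *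
        ∑ j, ∑ i, 1 / (n j : ℝ) ^ ((p : ℝ) / 2 + 1) *
          (((p : ℝ) + 2) / ((p : ℝ) + 1) + |∫ ω, X j i ω ^ (p + 1) ∂μ|) *
          bracketOne μ p A B r X j i
      + 3 / 2 *
        ∑ j, ∑ i, |∫ ω, X j i ω ^ (p + 1) ∂μ| / (n j : ℝ) ^ (((p : ℝ) + 1) / 2) *
          ∑ k, ∑ l, 1 / (n k : ℝ) ^ ((3 : ℝ) / 2) * bracketTwo μ A B r X k l)

end

set_option linter.unusedSectionVars false

noncomputable section

/-! ### Coordinate partial derivatives and polynomial growth -/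

section

/-! Take first a smooth even `F` of polynomial growth in the role of `h ∘ g`. Along the path `cos a
• W + sin a • Z`, `0 ≤ a ≤ π/2`, differentiation in `a` and Gaussian integration by parts in `Z`
write `E F(W) - E F(Z)` as the integral of `sin a` times a sum of Stein defects `E[W_j v(W)] - E[∂_j
v(W)]`, where `v` is the Gaussian smoothing of `∂_j F` (`integral_sub_integral_stdNormal`). Each
defect is expanded by Taylor's formula in one summand at a time, the rest of `W` being independent
of that summand. As the moments up to order `p` obey the Gaussian recursion, all terms cancel except
a remainder of total order `n^{-p/2}` and one term with the factor `n_j^{-(p+1)/2} E X^{p+1}` in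
front of `E ∂_j^p v(W)` (`stein_expansion`, `MatchingArray.abs_steinDefect_le`). Summed over the
`n_j` summands, that factor alone gives only `n^{-(p-1)/2}`.

Evenness supplies the missing `n^{-1/2}`. Since `p + 1` is odd, `∂_j^{p+1} F` is odd, so its
smoothing is odd and has mean zero under the normal law. A second interpolation, now with the
low-order expansion of the defects, shows that its mean at `W` is of order `n^{-1/2}`
(`MatchingArray.abs_integral_gsmooth_odd_le`). Done directly this would need `p + 4` derivatives of
`F`. Two of them are removed by one integration by parts in each of the two independent Gaussian
vectors, at the price `1 / (sin a sin a')` (`abs_iterPartial_gsmooth_gsmooth_le`), which is exactly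
cancelled by the factors `sin a` and `sin a'` of the two interpolation formulas.

The brackets of the bound are moments of the dominating function at shifted points. For exponents at
least one, leaving out a centred summand lowers moments by convexity. For exponents below one this
fails; there the unit second moment is used, and the resulting constants are absorbed by Gaussian
moments.

The general case follows by two mollifications. A composite with only finitely many partial
derivatives is convolved with an even bump, which barely changes the dominating function. The
function `h` is mollified without increasing the norms of its derivatives, and Faà di Bruno's
formula bounds the derivatives of order `p + 2` of `h ∘ g` by `h_{p+2} P`; the Stirling numbers
count set partitions by their number of blocks. For (b), moments of the standardised sums are
bounded by induction and powers of `n_j` are counted. -/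

/-- The partial derivative in the `i`-th coordinate direction. -/
def pd {d : ℕ} (i : Fin d) (G : (Fin d → ℝ) → ℝ) : (Fin d → ℝ) → ℝ :=
  fun w => lineDeriv ℝ G w (Pi.single i 1)

lemma iterPartial_cons {d : ℕ} (i : Fin d) (l : List (Fin d)) (G : (Fin d → ℝ) → ℝ) :
    iterPartial (i :: l) G = pd i (iterPartial l G) := rfl

lemma iterPartial_append {d : ℕ} (l l' : List (Fin d)) (G : (Fin d → ℝ) → ℝ) :
    iterPartial (l ++ l') G = iterPartial l (iterPartial l' G) := by
  induction l with
  | nil => rfl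
  | cons i l ih => simp [iterPartial_cons, ih]

/-- Functions all of whose iterated partial derivatives are differentiable and grow at most like
`(1 + ‖w‖) ^ Q`. -/
structure Tame {d : ℕ} (Q : ℝ) (G : (Fin d → ℝ) → ℝ) : Prop where
  diff : ∀ l, Differentiable ℝ (iterPartial l G)
  growth : ∀ l, ∃ C, 0 ≤ C ∧ ∀ w, |iterPartial l G w| ≤ C * (1 + ‖w‖) ^ Q

variable {d : ℕ} {Q : ℝ} {G : (Fin d → ℝ) → ℝ}

lemma Tame.differentiable (hG : Tame Q G) : Differentiable ℝ G := hG.diff []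

lemma Tame.continuous (hG : Tame Q G) : Continuous G := hG.differentiable.continuous

lemma Tame.bound (hG : Tame Q G) : ∃ C, 0 ≤ C ∧ ∀ w, |G w| ≤ C * (1 + ‖w‖) ^ Q := hG.growth []

lemma Tame.iterPartial (hG : Tame Q G) (l : List (Fin d)) : Tame Q (iterPartial l G) :=
  ⟨fun l' => by rw [← iterPartial_append]; exact hG.diff _,
   fun l' => by rw [← iterPartial_append]; exact hG.growth _⟩

lemma Tame.pd (hG : Tame Q G) (i : Fin d) : Tame Q (pd i G) := hG.iterPartial [i]

lemma fderiv_apply_single (hG : Differentiable ℝ G) (i : Fin d) (w : Fin d → ℝ) :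
    fderiv ℝ G w (Pi.single i 1) = pd i G w := (hG w).lineDeriv_eq_fderiv.symm

lemma fderiv_apply_eq_sum (hG : Differentiable ℝ G) (w v : Fin d → ℝ) :
    fderiv ℝ G w v = ∑ i, v i * pd i G w := by
  conv_lhs => rw [pi_eq_sum_univ' v]
  simp only [map_sum, map_smul, smul_eq_mul]
  refine Finset.sum_congr rfl fun i _ => ?_
  rw [← fderiv_apply_single hG]

lemma norm_fderiv_le_sum (hG : Differentiable ℝ G) (w : Fin d → ℝ) :
    ‖fderiv ℝ G w‖ ≤ ∑ i, |pd i G w| := by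
  refine ContinuousLinearMap.opNorm_le_bound _ (Finset.sum_nonneg fun _ _ => abs_nonneg _) ?_
  intro v
  rw [fderiv_apply_eq_sum hG, Finset.sum_mul]
  refine (norm_sum_le _ _).trans (Finset.sum_le_sum fun i _ => ?_)
  rw [norm_mul, mul_comm, Real.norm_eq_abs (pd i G w)]
  exact mul_le_mul_of_nonneg_left (norm_le_pi_norm v i) (abs_nonneg _)

/-- Chain rule along a line in a coordinate direction. -/
lemma hasDerivAt_line (hG : Differentiable ℝ G) (i : Fin d) (w : Fin d → ℝ) (y t : ℝ) :
    HasDerivAt (fun t : ℝ => G (w + (t * y) • Pi.single i (1 : ℝ)))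
      (y * pd i G (w + (t * y) • Pi.single i (1 : ℝ))) t := by
  have h1 : HasDerivAt (fun t : ℝ => w + (t * y) • (Pi.single i (1 : ℝ) : Fin d → ℝ))
      (y • (Pi.single i (1 : ℝ) : Fin d → ℝ)) t := by
    have := (((hasDerivAt_id t).mul_const y).smul_const
      (Pi.single i (1 : ℝ) : Fin d → ℝ)).const_add w
    simpa using this
  have := (hG (w + (t * y) • Pi.single i (1 : ℝ))).hasFDerivAt.comp_hasDerivAt t h1
  rw [map_smul, fderiv_apply_single hG, smul_eq_mul] at this
  exact this

/-- From `1 + ‖w‖ + ‖z‖ ≤ (1 + ‖w‖)(1 + ‖z‖)`. It separates the two variables, so that growth bounds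
can be integrated in each of them independently. -/
lemma one_add_norm_rpow_le (hQ : 0 ≤ Q) {c s : ℝ} (hc : |c| ≤ 1) (hs : |s| ≤ 1)
    (w z : Fin d → ℝ) :
    (1 + ‖c • w + s • z‖) ^ Q ≤ (1 + ‖w‖) ^ Q * (1 + ‖z‖) ^ Q := by
  rw [← Real.mul_rpow (by positivity) (by positivity)]
  gcongr
  have h1 : ‖c • w + s • z‖ ≤ ‖w‖ + ‖z‖ := by
    refine (norm_add_le _ _).trans ?_
    rw [norm_smul, norm_smul]
    have := mul_le_of_le_one_left (norm_nonneg w) hc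
    have := mul_le_of_le_one_left (norm_nonneg z) hs
    exact add_le_add ‹_› ‹_›
  nlinarith [norm_nonneg w, norm_nonneg z, mul_nonneg (norm_nonneg w) (norm_nonneg z)]

/-! ### The standard normal law -/

instance : IsProbabilityMeasure (stdNormal d) := by unfold stdNormal; infer_instance

lemma integrable_one_add_abs_rpow_gaussian (hQ : 0 ≤ Q) :
    Integrable (fun x : ℝ => (1 + |x|) ^ Q) (gaussianReal 0 1) := by
  rcases hQ.eq_or_lt with rfl | hQ
  · simp
  have h0 : MemLp (fun x : ℝ => |x|) (ENNReal.ofReal Q) (gaussianReal 0 1) :=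
    (memLp_id_gaussianReal' _ ENNReal.ofReal_ne_top).norm
  have h : MemLp (fun x : ℝ => 1 + |x|) (ENNReal.ofReal Q) (gaussianReal 0 1) :=
    (memLp_const (1 : ℝ)).add h0
  have := h.integrable_norm_rpow (by simpa using hQ) ENNReal.ofReal_ne_top
  rw [ENNReal.toReal_ofReal hQ.le] at this
  refine this.congr (Filter.Eventually.of_forall fun x => ?_)
  simp only [Real.norm_eq_abs]
  rw [abs_of_nonneg (a := 1 + |x|) (by positivity)]

lemma one_le_prod_one_add {ι : Type*} (s : Finset ι) {f : ι → ℝ} (hf : ∀ i, 0 ≤ f i) :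
    1 ≤ ∏ i ∈ s, (1 + f i) := by
  calc (1 : ℝ) = ∏ i ∈ s, 1 := by simp
    _ ≤ _ := Finset.prod_le_prod (fun _ _ => zero_le_one) fun i _ => by linarith [hf i]

/-- The maximum norm satisfies `1 + ‖z‖ ≤ ∏ (1 + |z i|)`, and the product factorises under the
product measure. -/
lemma integrable_one_add_norm_rpow (hQ : 0 ≤ Q) :
    Integrable (fun z : Fin d → ℝ => (1 + ‖z‖) ^ Q) (stdNormal d) := by
  have h := Integrable.fintype_prod (ι := Fin d) (μ := fun _ => gaussianReal 0 1)
    (f := fun _ x => (1 + |x|) ^ Q) (fun _ => integrable_one_add_abs_rpow_gaussian hQ)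
  refine Integrable.mono' h ?_ (Filter.Eventually.of_forall fun z => ?_)
  · exact (by fun_prop : Measurable fun z : Fin d → ℝ => (1 + ‖z‖) ^ Q).aestronglyMeasurable
  · rw [Real.norm_of_nonneg (by positivity), Real.finsetProd_rpow _ _ (fun i _ => by positivity)]
    gcongr
    have h1 : ∀ i, |z i| ≤ ∏ j, (1 + |z j|) - 1 := fun i => by
      have h2 : (1 + |z i|) ≤ ∏ j, (1 + |z j|) := by
        rw [← Finset.mul_prod_erase _ _ (Finset.mem_univ i)]
        refine le_mul_of_one_le_right (by positivity) ?_
        exact one_le_prod_one_add _ fun j => abs_nonneg (z j)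
      linarith
    have h0 : (1 : ℝ) ≤ ∏ j, (1 + |z j|) :=
      one_le_prod_one_add _ fun j => abs_nonneg (z j)
    have := (pi_norm_le_iff_of_nonneg (x := z) (sub_nonneg.2 h0)).2 h1
    linarith

end

section

variable {d : ℕ} {Q : ℝ} {G : (Fin d → ℝ) → ℝ}

/-! ### Gaussian integration by parts -/

lemma integrable_gaussian_iff (ψ : ℝ → ℝ) :
    Integrable ψ (gaussianReal 0 1) ↔ Integrable (fun x => ψ x * gaussianPDFReal 0 1 x) := by
  rw [gaussianReal_of_var_ne_zero 0 one_ne_zero,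
    integrable_withDensity_iff (measurable_gaussianPDF 0 1)
      (Filter.Eventually.of_forall fun x => gaussianPDF_lt_top)]
  simp [toReal_gaussianPDF]

lemma hasDerivAt_gaussianPDFReal (x : ℝ) :
    HasDerivAt (gaussianPDFReal 0 1) (-x * gaussianPDFReal 0 1 x) x := by
  have h1 : HasDerivAt (fun x : ℝ => -(x - 0) ^ 2 / (2 * ((1 : NNReal) : ℝ))) (-x) x := by
    have := ((((hasDerivAt_id x).sub_const 0).pow 2).neg).div_const (2 * ((1 : NNReal) : ℝ))
    convert! this using 1
    simp
    ring
  have := h1.exp.const_mul ((Real.sqrt (2 * Real.pi * ((1 : NNReal) : ℝ)))⁻¹)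
  rw [gaussianPDFReal_def]
  convert! this using 1
  simp only; ring

/-- The density satisfies `ρ' = -x ρ`. Integrability of all products makes the boundary terms
vanish. -/
lemma gaussian_integral_mul_eq_deriv {ψ ψ' : ℝ → ℝ} (hd : ∀ t, HasDerivAt ψ (ψ' t) t)
    (h0 : Integrable ψ (gaussianReal 0 1)) (h1 : Integrable (fun t => t * ψ t) (gaussianReal 0 1))
    (h2 : Integrable ψ' (gaussianReal 0 1)) :
    ∫ t, t * ψ t ∂gaussianReal 0 1 = ∫ t, ψ' t ∂gaussianReal 0 1 := by
  rw [integrable_gaussian_iff] at h0 h1 h2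
  have := integral_mul_deriv_eq_deriv_mul_of_integrable (u := ψ) (u' := ψ')
    (v := gaussianPDFReal 0 1) (v' := fun x => -x * gaussianPDFReal 0 1 x) (fun x _ => hd x)
    (fun x _ => hasDerivAt_gaussianPDFReal x) (h1.neg.congr (Filter.Eventually.of_forall fun x => by
      simp; ring)) h2 h0
  rw [integral_gaussianReal_eq_integral_smul one_ne_zero,
    integral_gaussianReal_eq_integral_smul one_ne_zero]
  have e1 : ∫ x, gaussianPDFReal 0 1 x • (x * ψ x) =
      - ∫ x, ψ x * (-x * gaussianPDFReal 0 1 x) := by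
    rw [← integral_neg]; congr 1; ext x; simp; ring
  rw [e1, this, neg_neg]
  congr 1; ext x; simp [mul_comm]

lemma stdNormal_integral_insertNth {m : ℕ} (k : Fin (m + 1)) {f : (Fin (m + 1) → ℝ) → ℝ}
    (hf : Integrable f (stdNormal (m + 1))) :
    ∫ z, f z ∂stdNormal (m + 1) =
      ∫ y, ∫ t, f (k.insertNth t y) ∂gaussianReal 0 1 ∂stdNormal m := by
  have mp := (measurePreserving_piFinSuccAbove (fun _ : Fin (m + 1) => gaussianReal 0 1) k).symm
  have h1 : Integrable (fun p : ℝ × (Fin m → ℝ) => f (k.insertNth p.1 p.2))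
      ((gaussianReal 0 1).prod (stdNormal m)) :=
    (mp.integrable_comp_emb (MeasurableEquiv.measurableEmbedding _)).2 hf
  have h2 := mp.integral_comp' (g := f)
  rw [stdNormal, ← h2]
  exact integral_prod_symm _ h1

lemma integrable_of_growth {f : (Fin d → ℝ) → ℝ} (hQ : 0 ≤ Q)
    (hm : AEStronglyMeasurable f (stdNormal d)) {C : ℝ} (h : ∀ z, |f z| ≤ C * (1 + ‖z‖) ^ Q) :
    Integrable f (stdNormal d) :=
  ((integrable_one_add_norm_rpow hQ).const_mul C).mono' hm (Filter.Eventually.of_forall h)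

lemma abs_coord_mul_growth {f : (Fin d → ℝ) → ℝ} (k : Fin d) {C : ℝ} 
    (h : ∀ z, |f z| ≤ C * (1 + ‖z‖) ^ Q) (z : Fin d → ℝ) :
    |z k * f z| ≤ C * (1 + ‖z‖) ^ (Q + 1) := by
  rw [abs_mul, Real.rpow_add_one (by positivity), mul_comm, ← mul_assoc]
  have := norm_le_pi_norm z k
  rw [Real.norm_eq_abs] at this
  exact mul_le_mul (h z) (by linarith) (abs_nonneg _) ((abs_nonneg _).trans (h z))

lemma stdNormal_integral_coord_mul (hQ : 0 ≤ Q) (k : Fin d) {φ φ' : (Fin d → ℝ) → ℝ}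
    (hd : ∀ z, HasLineDerivAt ℝ φ (φ' z) z (Pi.single k 1)) (hc : Continuous φ)
    (hc' : Continuous φ') {C C' : ℝ} (h : ∀ z, |φ z| ≤ C * (1 + ‖z‖) ^ Q)
    (h' : ∀ z, |φ' z| ≤ C' * (1 + ‖z‖) ^ Q) :
    ∫ z, z k * φ z ∂stdNormal d = ∫ z, φ' z ∂stdNormal d := by
  obtain _ | m := d
  · exact k.elim0
  have hm := abs_coord_mul_growth k h
  rw [stdNormal_integral_insertNth k
      (integrable_of_growth (by linarith : 0 ≤ Q + 1) (by fun_prop) hm),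
    stdNormal_integral_insertNth k (integrable_of_growth hQ (by fun_prop) h')]
  congr 1
  ext y
  have hlen : ∀ t : ℝ, 1 + ‖(k.insertNth t y : Fin (m + 1) → ℝ)‖ ≤ (1 + ‖y‖) * (1 + |t|) := by
    intro t
    have : ‖(k.insertNth t y : Fin (m + 1) → ℝ)‖ ≤ |t| + ‖y‖ := by
      rw [pi_norm_le_iff_of_nonneg (by positivity)]
      intro i
      refine Fin.succAboveCases k ?_ (fun j => ?_) i
      · simp
      · simp only [Fin.insertNth_apply_succAbove]
        exact (norm_le_pi_norm y j).trans (by linarith [abs_nonneg t])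
    nlinarith [norm_nonneg y, abs_nonneg t, mul_nonneg (norm_nonneg y) (abs_nonneg t)]
  -- With the other coordinates `y` frozen, the factor `(1 + ‖y‖) ^ R` joins the constant, so every
  -- one-dimensional section is integrable, not merely almost every one.
  have hi : ∀ {f : (Fin (m + 1) → ℝ) → ℝ} {K R : ℝ}, 0 ≤ R → Continuous f →
      (∀ z, |f z| ≤ K * (1 + ‖z‖) ^ R) →
      Integrable (fun t : ℝ => f (k.insertNth t y)) (gaussianReal 0 1) := by
    intro f K R hR hf hb
    have hK : 0 ≤ K := by
      have := (abs_nonneg _).trans (hb 0)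
      simpa using this
    refine ((integrable_one_add_abs_rpow_gaussian hR).const_mul (K * (1 + ‖y‖) ^ R)).mono' ?_
      (Filter.Eventually.of_forall fun t => (hb _).trans ?_)
    · exact (hf.comp (continuous_id.finInsertNth k continuous_const)).aestronglyMeasurable
    · rw [mul_assoc, ← Real.mul_rpow (by positivity) (by positivity)]
      gcongr
      exact hlen t
  have hi1 := hi (by linarith : 0 ≤ Q + 1) (by fun_prop) hm
  simp only [Fin.insertNth_apply_same] at hi1 ⊢
  refine gaussian_integral_mul_eq_deriv (ψ := fun t => φ (k.insertNth t y)) (fun t => ?_)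
    (hi hQ hc h) hi1 (hi hQ hc' h')
  have h2 := hd (k.insertNth t y)
  unfold HasLineDerivAt at h2
  have h3 : ∀ u : ℝ, (k.insertNth (t + u) y : Fin (m + 1) → ℝ) =
      k.insertNth t y + u • Pi.single k (1 : ℝ) := by
    intro u
    ext i
    refine Fin.succAboveCases k ?_ (fun j => ?_) i
    · simp
    · simp
  simp only [← h3] at h2
  have h4 : HasDerivAt (fun t => φ (k.insertNth t y)) (φ' (k.insertNth t y)) (t + 0) := by
    rw [hasDerivAt_iff_tendsto_slope_zero] at h2 ⊢
    simpa using h2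
  simpa using h4

lemma stdNormal_integral_odd {f : (Fin d → ℝ) → ℝ} (hf : ∀ z, f (-z) = -f z) :
    ∫ z, f z ∂stdNormal d = 0 := by
  have hmp : MeasurePreserving (fun x : ℝ => -x) (gaussianReal 0 1) (gaussianReal 0 1) :=
    ⟨measurable_neg, by rw [gaussianReal_map_neg, neg_zero]⟩
  have h := measurePreserving_pi (fun _ : Fin d => gaussianReal 0 1)
    (fun _ : Fin d => gaussianReal 0 1) (f := fun _ x => -x) (fun _ => hmp)
  have h2 := h.integral_comp (MeasurableEquiv.neg (Fin d → ℝ)).measurableEmbedding f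
  have h3 : ∫ z, f z ∂stdNormal d = - ∫ z, f z ∂stdNormal d := by
    conv_lhs => rw [stdNormal, ← h2]
    rw [← integral_neg]
    exact integral_congr_ae (Filter.Eventually.of_forall fun z => hf z)
  linarith

end

section

variable {d : ℕ} {Q : ℝ} {G : (Fin d → ℝ) → ℝ}

/-! ### Gaussian smoothing -/

/-- `gsmooth c s G w = E G(c w + s Z)` for a standard normal vector `Z`. -/
def gsmooth (c s : ℝ) (G : (Fin d → ℝ) → ℝ) (w : Fin d → ℝ) : ℝ :=
  ∫ z, G (c • w + s • z) ∂stdNormal d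

lemma growth_shift (hQ : 0 ≤ Q) {c s : ℝ} (hc : |c| ≤ 1) (hs : |s| ≤ 1) {C : ℝ} (hC : 0 ≤ C)
    (h : ∀ w, |G w| ≤ C * (1 + ‖w‖) ^ Q) (w z : Fin d → ℝ) :
    |G (c • w + s • z)| ≤ C * (1 + ‖w‖) ^ Q * (1 + ‖z‖) ^ Q := by
  refine (h _).trans ?_
  rw [mul_assoc]
  exact mul_le_mul_of_nonneg_left (one_add_norm_rpow_le hQ hc hs w z) hC

lemma integrable_shift (hQ : 0 ≤ Q) (hG : Tame Q G) {c s : ℝ} (hc : |c| ≤ 1) (hs : |s| ≤ 1)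
    (w : Fin d → ℝ) : Integrable (fun z => G (c • w + s • z)) (stdNormal d) := by
  obtain ⟨C, hC, h⟩ := hG.bound
  have := hG.continuous
  exact integrable_of_growth hQ (by fun_prop) fun z => growth_shift hQ hc hs hC h w z

lemma abs_gsmooth_le (hQ : 0 ≤ Q) {c s : ℝ} (hc : |c| ≤ 1) (hs : |s| ≤ 1) {C : ℝ} (hC : 0 ≤ C)
    (h : ∀ w, |G w| ≤ C * (1 + ‖w‖) ^ Q) (w : Fin d → ℝ) :
    |gsmooth c s G w| ≤ (C * ∫ z, (1 + ‖z‖) ^ Q ∂stdNormal d) * (1 + ‖w‖) ^ Q := by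
  have := norm_integral_le_of_norm_le (f := fun z => G (c • w + s • z)) (((integrable_one_add_norm_rpow (d := d) hQ)).const_mul
    (C * (1 + ‖w‖) ^ Q)) (Filter.Eventually.of_forall fun z => growth_shift hQ hc hs hC h w z)
  rw [integral_const_mul] at this
  rw [mul_right_comm]
  exact this

/-- On the unit ball around `w` the gradients are dominated by one integrable function of `z`. The
integrability is returned as well, being needed to evaluate the operator-valued integral at a basis
vector. -/
lemma hasFDerivAt_gsmooth (hQ : 0 ≤ Q) (hG : Tame Q G) {c s : ℝ} (hc : |c| ≤ 1) (hs : |s| ≤ 1)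
    (w : Fin d → ℝ) :
    HasFDerivAt (gsmooth c s G) (∫ z, c • fderiv ℝ G (c • w + s • z) ∂stdNormal d) w ∧
      Integrable (fun z => c • fderiv ℝ G (c • w + s • z)) (stdNormal d) := by
  choose C hC h using fun i => (hG.pd i).bound
  have hcont := hG.continuous
  have hb : ∀ x ∈ Metric.ball w 1, ∀ z, ‖c • fderiv ℝ G (c • x + s • z)‖ ≤
      (∑ i, C i) * (2 + ‖w‖) ^ Q * (1 + ‖z‖) ^ Q := by
    intro x hx z
    have hx' : ‖x‖ ≤ 1 + ‖w‖ := by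
      rw [mem_ball_iff_norm] at hx
      have := norm_le_norm_add_norm_sub' x w
      linarith
    calc ‖c • fderiv ℝ G (c • x + s • z)‖ ≤ ‖fderiv ℝ G (c • x + s • z)‖ := by
          rw [norm_smul]
          exact mul_le_of_le_one_left (norm_nonneg _) hc
      _ ≤ ∑ i, |pd i G (c • x + s • z)| := norm_fderiv_le_sum hG.differentiable _
      _ ≤ ∑ i, C i * (1 + ‖x‖) ^ Q * (1 + ‖z‖) ^ Q :=
          Finset.sum_le_sum fun i _ => growth_shift hQ hc hs (hC i) (h i) x z
      _ = (∑ i, C i) * (1 + ‖x‖) ^ Q * (1 + ‖z‖) ^ Q := by simp only [Finset.sum_mul]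
      _ ≤ _ := by
          have := Finset.sum_nonneg fun i (_ : i ∈ Finset.univ) => hC i
          exact mul_le_mul_of_nonneg_right (mul_le_mul_of_nonneg_left
            (Real.rpow_le_rpow (by positivity) (by linarith) hQ) this) (by positivity)
  have hm : AEStronglyMeasurable (fun z => c • fderiv ℝ G (c • w + s • z)) (stdNormal d) := by
    have h1 : Measurable (fun z => c • fderiv ℝ G (c • w + s • z)) :=
      ((measurable_fderiv ℝ G).comp (by fun_prop : Measurable fun z : Fin d → ℝ =>
        c • w + s • z)).const_smul c
    exact h1.aestronglyMeasurable
  have hbi : Integrable (fun z : Fin d → ℝ => (∑ i, C i) * (2 + ‖w‖) ^ Q * (1 + ‖z‖) ^ Q)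
      (stdNormal d) := (integrable_one_add_norm_rpow hQ).const_mul _
  refine ⟨?_, hbi.mono' hm (Filter.Eventually.of_forall fun z =>
    hb w (Metric.mem_ball_self one_pos) z)⟩
  refine hasFDerivAt_integral_of_dominated_of_fderiv_le (Metric.ball_mem_nhds w one_pos)
    (F := fun x z => G (c • x + s • z)) (F' := fun x z => c • fderiv ℝ G (c • x + s • z))
    (Filter.Eventually.of_forall fun x => ?_) (integrable_shift hQ hG hc hs w) hm
    (Filter.Eventually.of_forall fun z x hx => hb x hx z) hbi
    (Filter.Eventually.of_forall fun z x _ => ?_)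
  · exact (by fun_prop : Continuous fun z => G (c • x + s • z)).aestronglyMeasurable
  · have h1 : HasFDerivAt (fun x : Fin d → ℝ => c • x + s • z)
        (c • ContinuousLinearMap.id ℝ (Fin d → ℝ)) x :=
      ((hasFDerivAt_id x).const_smul c).add_const _
    have h2 := (hG.differentiable (c • x + s • z)).hasFDerivAt.comp x h1
    convert! h2 using 1
    ext v
    simp

lemma differentiable_gsmooth (hQ : 0 ≤ Q) (hG : Tame Q G) {c s : ℝ} (hc : |c| ≤ 1)
    (hs : |s| ≤ 1) : Differentiable ℝ (gsmooth c s G) := fun w =>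
  (hasFDerivAt_gsmooth hQ hG hc hs w).1.differentiableAt

/-- Every derivative produces a factor `c`. With `c = cos a`, the powers collected in this way are
integrated over `a` at the end and give the constants of the bound. -/
lemma pd_gsmooth (hQ : 0 ≤ Q) (hG : Tame Q G) {c s : ℝ} (hc : |c| ≤ 1) (hs : |s| ≤ 1)
    (i : Fin d) : pd i (gsmooth c s G) = fun w => c * gsmooth c s (pd i G) w := by
  ext w
  obtain ⟨h1, h2⟩ := hasFDerivAt_gsmooth hQ hG hc hs w
  rw [← fderiv_apply_single (differentiable_gsmooth hQ hG hc hs), h1.fderiv,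
    ContinuousLinearMap.integral_apply h2]
  simp only [smul_apply, smul_eq_mul,
    fderiv_apply_single hG.differentiable]
  rw [integral_const_mul, gsmooth]

lemma pd_const_mul (a : ℝ) (hG : Differentiable ℝ G) (i : Fin d) :
    pd i (fun w => a * G w) = fun w => a * pd i G w := by
  ext w
  rw [← fderiv_apply_single (hG.const_mul a), ← fderiv_apply_single hG, fderiv_const_mul (hG w)]
  simp

lemma iterPartial_gsmooth (hQ : 0 ≤ Q) (hG : Tame Q G) {c s : ℝ} (hc : |c| ≤ 1) (hs : |s| ≤ 1)
    (l : List (Fin d)) :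
    iterPartial l (gsmooth c s G) = fun w => c ^ l.length * gsmooth c s (iterPartial l G) w := by
  induction l with
  | nil => ext w; simp [iterPartial]
  | cons i l ih =>
    rw [iterPartial_cons, ih, pd_const_mul _ (differentiable_gsmooth hQ (hG.iterPartial l) hc hs),
      pd_gsmooth hQ (hG.iterPartial l) hc hs, ← iterPartial_cons]
    ext w
    rw [List.length_cons]
    ring

lemma Tame.gsmooth (hQ : 0 ≤ Q) (hG : Tame Q G) {c s : ℝ} (hc : |c| ≤ 1) (hs : |s| ≤ 1) :
    Tame Q (gsmooth c s G) where
  diff l := by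
    rw [iterPartial_gsmooth hQ hG hc hs]
    exact (differentiable_gsmooth hQ (hG.iterPartial l) hc hs).const_mul _
  growth l := by
    obtain ⟨C, hC, h⟩ := hG.growth l
    refine ⟨C * ∫ z, (1 + ‖z‖) ^ Q ∂stdNormal d, ?_, fun w => ?_⟩
    · exact mul_nonneg hC (integral_nonneg fun z => by positivity)
    · rw [iterPartial_gsmooth hQ hG hc hs, abs_mul]
      refine (mul_le_of_le_one_left (abs_nonneg _) ?_).trans (abs_gsmooth_le hQ hc hs hC h w)
      rw [abs_pow]
      exact pow_le_one₀ (abs_nonneg _) hc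

/-- Gaussian integration by parts: a derivative of a smoothed function costs one factor `z k`. -/
lemma integral_coord_mul_shift (hQ : 0 ≤ Q) (hG : Tame Q G) {c s : ℝ} (hc : |c| ≤ 1)
    (hs : |s| ≤ 1) (k : Fin d) (w : Fin d → ℝ) :
    ∫ z, z k * G (c • w + s • z) ∂stdNormal d = s * gsmooth c s (pd k G) w := by
  obtain ⟨C, hC, h⟩ := hG.bound
  obtain ⟨C', hC', h'⟩ := (hG.pd k).bound
  have h1 := hG.continuous
  have h2 := (hG.pd k).continuous
  rw [stdNormal_integral_coord_mul hQ k (φ := fun z => G (c • w + s • z))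
    (φ' := fun z => s * pd k G (c • w + s • z)) (fun z => ?_) (by fun_prop) (by fun_prop)
    (C := C * (1 + ‖w‖) ^ Q) (C' := C' * (1 + ‖w‖) ^ Q)
    (fun z => growth_shift hQ hc hs hC h w z) (fun z => ?_), integral_const_mul, gsmooth]
  · have := hasDerivAt_line hG.differentiable k (c • w + s • z) s 0
    simp only [zero_mul, zero_smul, add_zero] at this
    have e : (fun t : ℝ => G (c • w + s • (z + t • Pi.single k 1))) =
        fun t : ℝ => G (c • w + s • z + (t * s) • Pi.single k 1) := by
      ext t
      rw [smul_add, add_assoc, smul_smul, mul_comm s t]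
    unfold HasLineDerivAt
    rw [e]
    exact this
  · rw [abs_mul]
    exact (mul_le_of_le_one_left (abs_nonneg _) hs).trans (growth_shift hQ hc hs hC' h' w z)

end

section

variable {d : ℕ} {Q : ℝ} {G : (Fin d → ℝ) → ℝ}

/-! ### Interpolation between the law of `W` and the standard normal law -/

/-- The failure `E[W_j v(W)] - E[∂_j v(W)]` of the Stein identity for `W` in direction `j`. -/
def steinDefect {Ω : Type*} [MeasurableSpace Ω] (μ : Measure Ω) (W : Ω → Fin d → ℝ) (j : Fin d)
    (v : (Fin d → ℝ) → ℝ) : ℝ :=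
  ∫ ω, W ω j * v (W ω) ∂μ - ∫ ω, pd j v (W ω) ∂μ

section
variable {Ω : Type*} [MeasurableSpace Ω] {μ : Measure Ω}
  {W : Ω → Fin d → ℝ}

lemma one_add_norm_rpow_mono {Q' : ℝ} (h : Q ≤ Q') (w : Fin d → ℝ) :
    (1 + ‖w‖) ^ Q ≤ (1 + ‖w‖) ^ Q' :=
  Real.rpow_le_rpow_of_exponent_le (by linarith [norm_nonneg w]) h

lemma integrable_comp_of_growth (hW : Measurable W)
    (hWQ : Integrable (fun ω => (1 + ‖W ω‖) ^ Q) μ) {f : (Fin d → ℝ) → ℝ} (hf : Measurable f)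
    {C : ℝ} (h : ∀ w, |f w| ≤ C * (1 + ‖w‖) ^ Q) : Integrable (fun ω => f (W ω)) μ :=
  (hWQ.const_mul C).mono' (hf.comp hW).aestronglyMeasurable
    (Filter.Eventually.of_forall fun ω => h (W ω))

lemma integrable_one_add_norm_of_le (hW : Measurable W) {Q' : ℝ} (h : Q ≤ Q')
    (hWQ : Integrable (fun ω => (1 + ‖W ω‖) ^ Q') μ) :
    Integrable (fun ω => (1 + ‖W ω‖) ^ Q) μ :=
  integrable_comp_of_growth hW hWQ (f := fun w => (1 + ‖w‖) ^ Q) (C := 1) (by fun_prop) fun w => by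
    rw [one_mul, abs_of_nonneg (by positivity)]
    exact one_add_norm_rpow_mono h w

lemma Tame.integrable_comp (hG : Tame Q G) (hW : Measurable W)
    (hWQ : Integrable (fun ω => (1 + ‖W ω‖) ^ (Q + 1)) μ) :
    Integrable (fun ω => G (W ω)) μ := by
  obtain ⟨C, hC, h⟩ := hG.bound
  exact integrable_comp_of_growth hW (integrable_one_add_norm_of_le hW (by linarith) hWQ)
    hG.continuous.measurable h

lemma Tame.integrable_coord_mul (hG : Tame Q G) (hW : Measurable W)
    (hWQ : Integrable (fun ω => (1 + ‖W ω‖) ^ (Q + 1)) μ) (j : Fin d) :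
    Integrable (fun ω => W ω j * G (W ω)) μ := by
  obtain ⟨C, hC, h⟩ := hG.bound
  have := hG.continuous.measurable
  exact integrable_comp_of_growth (f := fun w => w j * G w) hW hWQ (by fun_prop)
    (abs_coord_mul_growth j h)

/-- The integrand `d/da G(cos a w + sin a z)` of the interpolation. -/
def interpDeriv (G : (Fin d → ℝ) → ℝ) (w z : Fin d → ℝ) (a : ℝ) : ℝ :=
  ∑ j, (-Real.sin a * w j + Real.cos a * z j) * pd j G (Real.cos a • w + Real.sin a • z)

lemma hasDerivAt_interp (hG : Differentiable ℝ G) (w z : Fin d → ℝ) (a : ℝ) :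
    HasDerivAt (fun a => G (Real.cos a • w + Real.sin a • z)) (interpDeriv G w z a) a := by
  have h1 : HasDerivAt (fun a => Real.cos a • w + Real.sin a • z)
      ((-Real.sin a) • w + Real.cos a • z) a :=
    ((Real.hasDerivAt_cos a).smul_const w).add ((Real.hasDerivAt_sin a).smul_const z)
  have h2 := (hG _).hasFDerivAt.comp_hasDerivAt a h1
  rw [fderiv_apply_eq_sum hG] at h2
  simpa [interpDeriv] using! h2

lemma continuous_interpDeriv (hG : Tame Q G) :
    Continuous fun x : ((Fin d → ℝ) × (Fin d → ℝ)) × ℝ => interpDeriv G x.1.1 x.1.2 x.2 := by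
  unfold interpDeriv
  have := fun j => (hG.pd j).continuous
  fun_prop

lemma abs_coord_comb_le {c s : ℝ} (hc : |c| ≤ 1) (hs : |s| ≤ 1) (w z : Fin d → ℝ) (j : Fin d) :
    |(-s * w j + c * z j)| ≤ (1 + ‖w‖) * (1 + ‖z‖) := by
  have h1 := norm_le_pi_norm w j
  have h2 := norm_le_pi_norm z j
  rw [Real.norm_eq_abs] at h1 h2
  have h3 : |-s * w j| ≤ ‖w‖ := by
    rw [abs_mul, abs_neg]
    exact (mul_le_of_le_one_left (abs_nonneg _) hs).trans h1
  have h4 : |c * z j| ≤ ‖z‖ := by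
    rw [abs_mul]
    exact (mul_le_of_le_one_left (abs_nonneg _) hc).trans h2
  have := abs_add_le (-s * w j) (c * z j)
  nlinarith [norm_nonneg w, norm_nonneg z, mul_nonneg (norm_nonneg w) (norm_nonneg z)]

lemma abs_coord_comb_mul_le (hQ : 0 ≤ Q) {c s : ℝ} (hc : |c| ≤ 1) (hs : |s| ≤ 1) {C : ℝ}
    (hC : 0 ≤ C) {f : (Fin d → ℝ) → ℝ} (h : ∀ w, |f w| ≤ C * (1 + ‖w‖) ^ Q) (w z : Fin d → ℝ)
    (j : Fin d) : |(-s * w j + c * z j) * f (c • w + s • z)| ≤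
      C * ((1 + ‖w‖) ^ (Q + 1) * (1 + ‖z‖) ^ (Q + 1)) := by
  rw [abs_mul]
  refine (mul_le_mul (abs_coord_comb_le hc hs w z j) (growth_shift hQ hc hs hC h w z)
    (abs_nonneg _) (by positivity)).trans (le_of_eq ?_)
  rw [Real.rpow_add_one (by positivity), Real.rpow_add_one (by positivity)]
  ring

lemma exists_abs_interpDeriv_le (hQ : 0 ≤ Q) (hG : Tame Q G) :
    ∃ C, 0 ≤ C ∧ ∀ w z a, |interpDeriv G w z a| ≤
      C * ((1 + ‖w‖) ^ (Q + 1) * (1 + ‖z‖) ^ (Q + 1)) := by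
  choose C hC h using fun i => (hG.pd i).bound
  refine ⟨∑ i, C i, Finset.sum_nonneg fun i _ => hC i, fun w z a => ?_⟩
  rw [Finset.sum_mul]
  exact (Finset.abs_sum_le_sum_abs _ _).trans (Finset.sum_le_sum fun i _ =>
    abs_coord_comb_mul_le hQ (Real.abs_cos_le_one a) (Real.abs_sin_le_one a) (hC i) (h i) w z i)

variable [IsProbabilityMeasure μ]

/-- Integration by parts turns the terms with `z j` into `cos a * sin a` times a smoothed second
derivative, and by `pd_gsmooth` the factor `cos a` makes this a derivative of the smoothed function
itself. Hence both parts share the factor `sin a`, which later absorbs a singularity `1 / sin a`. -/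
lemma integral_interpDeriv (hQ : 0 ≤ Q) (hG : Tame Q G) (hW : Measurable W)
    (hWQ : Integrable (fun ω => (1 + ‖W ω‖) ^ (Q + 1)) μ) (a : ℝ) :
    ∫ x, interpDeriv G (W x.1) x.2 a ∂μ.prod (stdNormal d) =
      -(Real.sin a * ∑ j, steinDefect μ W j (gsmooth (Real.cos a) (Real.sin a) (pd j G))) := by
  have hc := Real.abs_cos_le_one a
  have hs := Real.abs_sin_le_one a
  obtain ⟨C, hC, hb⟩ := exists_abs_interpDeriv_le hQ hG
  have hcont := continuous_interpDeriv hG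
  have hint : Integrable (fun x : Ω × (Fin d → ℝ) => interpDeriv G (W x.1) x.2 a)
      (μ.prod (stdNormal d)) := by
    refine ((hWQ.mul_prod (integrable_one_add_norm_rpow (by linarith : 0 ≤ Q + 1))).const_mul
      C).mono' ?_ (Filter.Eventually.of_forall fun x => hb (W x.1) x.2 a)
    exact (hcont.measurable.comp (((hW.comp measurable_fst).prodMk measurable_snd).prodMk
      measurable_const)).aestronglyMeasurable
  rw [integral_prod _ hint]
  have hz : ∀ w, ∫ z, interpDeriv G w z a ∂stdNormal d =
      ∑ j, -(Real.sin a * (w j * gsmooth (Real.cos a) (Real.sin a) (pd j G) w -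
        pd j (gsmooth (Real.cos a) (Real.sin a) (pd j G)) w)) := by
    intro w
    have hi1 := fun j => integrable_shift hQ (hG.pd j) hc hs w
    have hi2 : ∀ j, Integrable (fun z => z j * pd j G (Real.cos a • w + Real.sin a • z))
        (stdNormal d) := by
      intro j
      obtain ⟨C, hC, h⟩ := (hG.pd j).bound
      have := (hG.pd j).continuous
      exact integrable_of_growth (by linarith : 0 ≤ Q + 1) (by fun_prop)
        (abs_coord_mul_growth j fun z => growth_shift hQ hc hs hC h w z)
    unfold interpDeriv
    have e : ∀ j z, (-Real.sin a * w j + Real.cos a * z j) *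
        pd j G (Real.cos a • w + Real.sin a • z) =
        (-Real.sin a * w j) * pd j G (Real.cos a • w + Real.sin a • z) +
        Real.cos a * (z j * pd j G (Real.cos a • w + Real.sin a • z)) := fun j z => by ring
    simp only [e]
    rw [integral_finsetSum]
    swap
    · exact fun j _ => ((hi1 j).const_mul _).add ((hi2 j).const_mul _)
    refine Finset.sum_congr rfl fun j _ => ?_
    rw [integral_add ((hi1 j).const_mul _) ((hi2 j).const_mul _), integral_const_mul,
      integral_const_mul, integral_coord_mul_shift hQ (hG.pd j) hc hs, pd_gsmooth hQ (hG.pd j) hc hs]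
    simp only [gsmooth]
    ring
  simp only [hz]
  have hv := fun j => (hG.pd j).gsmooth hQ hc hs
  have hi3 := fun j => (hv j).integrable_coord_mul hW hWQ j
  have hi4 := fun j => ((hv j).pd j).integrable_comp hW hWQ
  rw [integral_finsetSum]
  swap
  · exact fun j _ => (((hi3 j).sub (hi4 j)).const_mul _).neg
  rw [Finset.mul_sum, ← Finset.sum_neg_distrib]
  refine Finset.sum_congr rfl fun j _ => ?_
  rw [integral_neg, integral_const_mul, integral_sub (hi3 j) (hi4 j), steinDefect]

/-- The path joins `W` at `a = 0` to `Z` at `a = π / 2`. The growth bound on `interpDeriv` is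
uniform in `a`, which justifies exchanging the integrals. -/
lemma integral_sub_integral_stdNormal (hQ : 0 ≤ Q) (hG : Tame Q G) (hW : Measurable W)
    (hWQ : Integrable (fun ω => (1 + ‖W ω‖) ^ (Q + 1)) μ) :
    ∫ ω, G (W ω) ∂μ - ∫ z, G z ∂stdNormal d =
      ∫ a in (0 : ℝ)..(Real.pi / 2), Real.sin a *
        ∑ j, steinDefect μ W j (gsmooth (Real.cos a) (Real.sin a) (pd j G)) := by
  obtain ⟨C, hC, hb⟩ := exists_abs_interpDeriv_le hQ hG
  have hcont := continuous_interpDeriv hG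
  have hpi : (0 : ℝ) ≤ Real.pi / 2 := by positivity
  have hftc : ∀ w z, ∫ a in (0 : ℝ)..(Real.pi / 2), interpDeriv G w z a = G z - G w := by
    intro w z
    rw [intervalIntegral.integral_eq_sub_of_hasDerivAt
      (fun a _ => hasDerivAt_interp hG.differentiable w z a)]
    · simp
    · exact (hcont.comp (by fun_prop : Continuous fun a : ℝ => ((w, z), a))).intervalIntegrable _ _
  have hGz : Integrable G (stdNormal d) := by
    obtain ⟨C, hC, h⟩ := hG.bound
    exact integrable_of_growth hQ hG.continuous.aestronglyMeasurable h
  have h1 : ∫ x, (G x.2 - G (W x.1)) ∂μ.prod (stdNormal d) =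
      ∫ z, G z ∂stdNormal d - ∫ ω, G (W ω) ∂μ := by
    rw [integral_sub (hGz.comp_snd μ) ((hG.integrable_comp hW hWQ).comp_fst _)]
    rw [integral_fun_snd (μ := μ), integral_fun_fst (μ := μ) fun ω => G (W ω)]
    simp
  have hint : Integrable (Function.uncurry fun (x : Ω × (Fin d → ℝ)) (a : ℝ) =>
      interpDeriv G (W x.1) x.2 a)
      ((μ.prod (stdNormal d)).prod (volume.restrict (Set.Ioc 0 (Real.pi / 2)))) := by
    have h2 := (hWQ.mul_prod (integrable_one_add_norm_rpow (d := d)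
      (by linarith : 0 ≤ Q + 1))).const_mul C
    refine (h2.comp_fst _).mono' ?_ (Filter.Eventually.of_forall fun x => hb (W x.1.1) x.1.2 x.2)
    exact (hcont.measurable.comp (((hW.comp (measurable_fst.comp measurable_fst)).prodMk
      (measurable_snd.comp measurable_fst)).prodMk measurable_snd)).aestronglyMeasurable
  have h3 := integral_integral_swap hint
  rw [← neg_sub, ← h1]
  simp only [← hftc, intervalIntegral.integral_of_le hpi]
  rw [h3, ← integral_neg]
  congr 1
  ext a
  rw [integral_interpDeriv hQ hG hW hWQ, neg_neg]

/-- A pointwise bound on the Stein defects along the interpolation bounds the distance from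
normality. -/
lemma abs_integral_sub_stdNormal_le (hQ : 0 ≤ Q) (hG : Tame Q G) (hW : Measurable W)
    (hWQ : Integrable (fun ω => (1 + ‖W ω‖) ^ (Q + 1)) μ) {b : ℝ → ℝ} (hb : Continuous b)
    (h : ∀ a ∈ Set.Ioo 0 (Real.pi / 2), |Real.sin a *
        ∑ j, steinDefect μ W j (gsmooth (Real.cos a) (Real.sin a) (pd j G))| ≤ b a) :
    |∫ ω, G (W ω) ∂μ - ∫ z, G z ∂stdNormal d| ≤ ∫ a in (0 : ℝ)..(Real.pi / 2), b a := by
  rw [integral_sub_integral_stdNormal hQ hG hW hWQ, ← Real.norm_eq_abs]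
  refine intervalIntegral.norm_integral_le_of_norm_le (by positivity) ?_ (hb.intervalIntegrable _ _)
  -- The interval integral includes the right end point, where no bound is assumed; it is a null
  -- set.
  have : ∀ᵐ a : ℝ, a ≠ Real.pi / 2 := by
    simp [ae_iff]
  filter_upwards [this] with a ha ha'
  exact h a ⟨ha'.1, lt_of_le_of_ne ha'.2 ha⟩

end

end

section

variable {d : ℕ} {Q : ℝ} {G : (Fin d → ℝ) → ℝ}

/-! ### Taylor expansion in one coordinate -/

/-- The derivative of the remainder of order `m + 1` is the remainder of order `m` for the shifted
sequence `f (k + 1)`. The induction compares derivatives and needs only a bound for the top function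
on `[0, 1]`. -/
lemma taylor_sum_remainder_le (m : ℕ) : ∀ {f : ℕ → ℝ → ℝ} {C : ℝ},
    (∀ k t, HasDerivAt (f k) (f (k + 1) t) t) → (∀ t ∈ Set.Icc (0 : ℝ) 1, |f m t| ≤ C) →
    ∀ t ∈ Set.Icc (0 : ℝ) 1,
      |f 0 t - ∑ k ∈ Finset.range m, f k 0 * t ^ k / k.factorial| ≤ C * t ^ m / m.factorial := by
  induction m with
  | zero => intro f C _ hC t ht; simpa using hC t ht
  | succ m ih =>
    intro f C hf hC
    have hder : ∀ t, HasDerivAt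
        (fun t => f 0 t - ∑ k ∈ Finset.range (m + 1), f k 0 * t ^ k / k.factorial)
        (f 1 t - ∑ k ∈ Finset.range m, f (k + 1) 0 * t ^ k / k.factorial) t := by
      intro t
      refine (hf 0 t).sub ?_
      have h1 : ∀ k ∈ Finset.range (m + 1), HasDerivAt
          (fun t : ℝ => f k 0 * t ^ k / k.factorial)
          (f k 0 * (k * t ^ (k - 1)) / k.factorial) t := fun k _ =>
        ((hasDerivAt_pow k t).const_mul _).div_const _
      have h2 := HasDerivAt.fun_sum h1
      rw [Finset.sum_range_succ'] at h2
      convert! h2 using 1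
      simp only [Nat.cast_zero, zero_mul, mul_zero, zero_div, add_zero]
      refine Finset.sum_congr rfl fun k _ => ?_
      rw [Nat.factorial_succ, Nat.add_sub_cancel]
      push_cast
      field_simp
    refine image_norm_le_of_norm_deriv_right_le_deriv_boundary
      (f := fun t => f 0 t - ∑ k ∈ Finset.range (m + 1), f k 0 * t ^ k / k.factorial)
      (fun t _ => (hder t).continuousAt.continuousWithinAt)
      (fun t _ => (hder t).hasDerivWithinAt)
      (B := fun t => C * t ^ (m + 1) / (m + 1).factorial)
      (B' := fun t => C * t ^ m / m.factorial) ?_ (fun t => ?_) fun t ht => ?_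
    · simp [Finset.sum_range_succ']
    · have := ((hasDerivAt_pow (m + 1) t).const_mul C).div_const ((m + 1).factorial : ℝ)
      convert! this using 1
      rw [Nat.factorial_succ, Nat.add_sub_cancel]
      push_cast
      field_simp
    · exact ih (f := fun k => f (k + 1)) (fun k t => hf (k + 1) t) hC t ⟨ht.1, ht.2.le⟩

lemma iterPartial_nil (G : (Fin d → ℝ) → ℝ) : iterPartial [] G = G := rfl

lemma Tame.taylor_coord_le (hG : Tame Q G) (j : Fin d) (w : Fin d → ℝ) (y : ℝ) (m : ℕ) {C : ℝ}
    (hC : ∀ t ∈ Set.Icc (0 : ℝ) 1,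
      |_root_.iterPartial (List.replicate m j) G (w + (t * y) • Pi.single j (1 : ℝ))| ≤ C) :
    |G (w + y • Pi.single j (1 : ℝ)) - ∑ k ∈ Finset.range m,
      y ^ k * _root_.iterPartial (List.replicate k j) G w / k.factorial| ≤
        |y| ^ m * C / m.factorial := by
  have := taylor_sum_remainder_le m (C := |y| ^ m * C)
    (f := fun k t => y ^ k * _root_.iterPartial (List.replicate k j) G
      (w + (t * y) • Pi.single j (1 : ℝ)))
    (fun k t => ?_) (fun t ht => ?_) 1 ⟨zero_le_one, le_rfl⟩
  · simpa [iterPartial_nil] using this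
  · have := (hasDerivAt_line (hG.diff (List.replicate k j)) j w y t).const_mul (y ^ k)
    convert! this using 1
    rw [List.replicate_succ, iterPartial_cons, pow_succ, mul_assoc]
  · rw [abs_mul, abs_pow]
    exact mul_le_mul_of_nonneg_left (hC t ht) (by positivity)

/-! ### Expansion of the Stein identity for one summand -/

lemma one_add_norm_add_single_rpow_le (hQ : 0 ≤ Q) (w : Fin d → ℝ) (y : ℝ) (j : Fin d) :
    (1 + ‖w + y • Pi.single j (1 : ℝ)‖) ^ Q ≤ (1 + ‖w‖) ^ Q * (1 + |y|) ^ Q := by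
  have h := one_add_norm_rpow_le hQ (c := 1) (s := 1) (by simp) (by simp) w
    (y • Pi.single j (1 : ℝ))
  rw [one_smul, one_smul] at h
  refine h.trans (le_of_eq ?_)
  rw [norm_smul, Pi.norm_single]
  simp

lemma growth_add_single (hQ : 0 ≤ Q) {C : ℝ} (hC : 0 ≤ C) (h : ∀ w, |G w| ≤ C * (1 + ‖w‖) ^ Q)
    (w : Fin d → ℝ) (y : ℝ) (j : Fin d) :
    |G (w + y • Pi.single j (1 : ℝ))| ≤ C * ((1 + ‖w‖) ^ Q * (1 + |y|) ^ Q) :=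
  (h _).trans (mul_le_mul_of_nonneg_left (one_add_norm_add_single_rpow_le hQ w y j) hC)

section
variable {Ω : Type*} [MeasurableSpace Ω] {μ : Measure Ω}
  {W' : Ω → Fin d → ℝ} {Y Ψ : Ω → ℝ}

lemma ProbabilityTheory.IndepFun.comp_mul {f : ℝ → ℝ} {g : (Fin d → ℝ) → ℝ}
    (hi : IndepFun Y W' μ) (hY : Measurable Y) (hW' : Measurable W') (hf : Measurable f)
    (hg : Measurable g) (h1 : Integrable (fun ω => f (Y ω)) μ)
    (h2 : Integrable (fun ω => g (W' ω)) μ) :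
    Integrable (fun ω => f (Y ω) * g (W' ω)) μ ∧
      ∫ ω, f (Y ω) * g (W' ω) ∂μ = (∫ ω, f (Y ω) ∂μ) * ∫ ω, g (W' ω) ∂μ := by
  have hi' := hi.comp hf hg
  exact ⟨hi'.integrable_mul h1 h2, hi'.integral_fun_mul_eq_mul_integral
    (hf.comp hY).aestronglyMeasurable (hg.comp hW').aestronglyMeasurable⟩



/-- The weight `f` serves as the identity and as the constant `1`, for the two expectations in the
Stein identity. -/
lemma Tame.integrable_mul_comp_add (hQ : 0 ≤ Q) (hG : Tame Q G) (hi : IndepFun Y W' μ)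
    (hY : Measurable Y) (hW' : Measurable W') (j : Fin d)
    (hW'Q : Integrable (fun ω => (1 + ‖W' ω‖) ^ Q) μ)
    (hYQ : Integrable (fun ω => (1 + |Y ω|) ^ (Q + 1)) μ) {f : ℝ → ℝ} (hf : Measurable f)
    (hf' : ∀ y, |f y| ≤ 1 + |y|) :
    Integrable (fun ω => f (Y ω) * G (W' ω + Y ω • Pi.single j (1 : ℝ))) μ := by
  obtain ⟨C, hC, h⟩ := hG.bound
  have := hG.continuous.measurable
  have h1 := (hi.comp_mul hY hW' (f := fun y => (1 + |y|) ^ (Q + 1)) (g := fun w => (1 + ‖w‖) ^ Q)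
    (by fun_prop) (by fun_prop) hYQ hW'Q).1
  have hm : Measurable fun ω => W' ω + Y ω • (Pi.single j (1 : ℝ) : Fin d → ℝ) :=
    hW'.add (hY.smul_const _)
  refine (h1.const_mul C).mono' ((hf.comp hY).mul (this.comp hm)).aestronglyMeasurable
    (Filter.Eventually.of_forall fun ω => ?_)
  have h3 : (1 + |Y ω|) ^ (Q + 1) = (1 + |Y ω|) ^ Q * (1 + |Y ω|) :=
    Real.rpow_add_one (add_pos_of_pos_of_nonneg one_pos (abs_nonneg _)).ne' Q
  rw [h3, Real.norm_eq_abs, abs_mul]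
  have h2 := growth_add_single hQ hC h (W' ω) (Y ω) j
  refine (mul_le_mul (hf' (Y ω)) h2 (abs_nonneg _) (by positivity)).trans (le_of_eq ?_)
  ring

/-- After shifting the index in the first sum, the recursion cancels it against the second term by
term. The term `k = 0` vanishes since `M 1 = 0`, so the truncated `k - 1` is harmless there; only
the top term, where the recursion is not assumed, survives. -/
lemma stein_moment_sum (m : ℕ) (κ : ℝ) (M e : ℕ → ℝ)
    (hM : ∀ k < m + 1, M (k + 1) = κ * k * M (k - 1)) :
    ∑ k ∈ Finset.range (m + 2), M (k + 1) * e k / k.factorial -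
      κ * ∑ k ∈ Finset.range (m + 1), M k * e (k + 1) / k.factorial =
    (M (m + 2) - κ * (m + 1) * M m) / (m + 1).factorial * e (m + 1) := by
  rw [Finset.sum_range_succ', hM 0 (by omega), Finset.mul_sum, add_sub_right_comm,
    ← Finset.sum_sub_distrib, Finset.sum_range_succ, Finset.sum_eq_zero]
  · simp only [Nat.factorial_succ]
    push_cast
    field_simp
    ring
  · intro k hk
    rw [Finset.mem_range] at hk
    rw [hM (k + 1) (by omega), Nat.factorial_succ, Nat.add_sub_cancel]
    push_cast
    field_simp
    ring


/-- Expansion of `E[Y v(W)] - κ E[∂_j v(W)]` for `W = W' + Y e_j` with `Y` and `W'` independent,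
when the moments of `Y` satisfy the Gaussian recursion up to order `m + 1`. -/
lemma stein_expansion (hQ : 0 ≤ Q) (hG : Tame Q G) (hi : IndepFun Y W' μ)
    (hY : Measurable Y) (hW' : Measurable W') (j : Fin d)
    (hW'Q : Integrable (fun ω => (1 + ‖W' ω‖) ^ Q) μ)
    (hYQ : Integrable (fun ω => (1 + |Y ω|) ^ (Q + 1)) μ) (m : ℕ) {κ : ℝ} (hκ : 0 ≤ κ)
    (hYm : ∀ k ≤ m + 2, Integrable (fun ω => Y ω ^ k) μ)
    (hM : ∀ k < m + 1, ∫ ω, Y ω ^ (k + 1) ∂μ = κ * k * ∫ ω, Y ω ^ (k - 1) ∂μ)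
    (hΨ : ∀ ω, ∀ t ∈ Set.Icc (0 : ℝ) 1, |_root_.iterPartial (List.replicate (m + 2) j) G
      (W' ω + (t * Y ω) • Pi.single j (1 : ℝ))| ≤ Ψ ω)
    (h1 : Integrable (fun ω => |Y ω| ^ (m + 3) * Ψ ω) μ)
    (h2 : Integrable (fun ω => |Y ω| ^ (m + 1) * Ψ ω) μ) :
    |∫ ω, Y ω * G (W' ω + Y ω • Pi.single j (1 : ℝ)) ∂μ -
      κ * ∫ ω, _root_.pd j G (W' ω + Y ω • Pi.single j (1 : ℝ)) ∂μ -
      (∫ ω, Y ω ^ (m + 2) ∂μ - κ * (m + 1) * ∫ ω, Y ω ^ m ∂μ) / (m + 1).factorial *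
        ∫ ω, _root_.iterPartial (List.replicate (m + 1) j) G (W' ω) ∂μ| ≤
      (∫ ω, |Y ω| ^ (m + 3) * Ψ ω ∂μ) / (m + 2).factorial +
        κ * ((∫ ω, |Y ω| ^ (m + 1) * Ψ ω ∂μ) / (m + 1).factorial) := by
  set a : ℕ → (Fin d → ℝ) → ℝ := fun k => _root_.iterPartial (List.replicate k j) G with ha
  have hat : ∀ k, Tame Q (a k) := fun k => hG.iterPartial _
  have hai : ∀ k, Integrable (fun ω => a k (W' ω)) μ := fun k => by
    obtain ⟨C, hC, h⟩ := (hat k).bound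
    exact integrable_comp_of_growth hW' hW'Q (hat k).continuous.measurable h
  have hprod : ∀ i k, i ≤ m + 2 → Integrable (fun ω => Y ω ^ i * a k (W' ω)) μ ∧
      ∫ ω, Y ω ^ i * a k (W' ω) ∂μ = (∫ ω, Y ω ^ i ∂μ) * ∫ ω, a k (W' ω) ∂μ := fun i k hk =>
    hi.comp_mul hY hW' (f := fun y => y ^ i) (by fun_prop) (hat k).continuous.measurable
      (hYm i hk) (hai k)
  have hI1 : Integrable (fun ω => Y ω * G (W' ω + Y ω • Pi.single j (1 : ℝ))) μ :=
    hG.integrable_mul_comp_add hQ hi hY hW' j hW'Q hYQ (f := fun y => y) measurable_id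
      fun y => by linarith
  have hI2 : Integrable (fun ω => _root_.pd j G (W' ω + Y ω • Pi.single j (1 : ℝ))) μ := by
    have := (hG.pd j).integrable_mul_comp_add hQ hi hY hW' j hW'Q hYQ (f := fun y => 1)
      measurable_const fun y => by simp
    simpa using this
  have hS1 : Integrable (fun ω => ∑ k ∈ Finset.range (m + 2),
      Y ω ^ (k + 1) * a k (W' ω) / k.factorial) μ :=
    integrable_finsetSum _ fun k hk =>
      (hprod (k + 1) k (by rw [Finset.mem_range] at hk; omega)).1.div_const _
  have hS2 : Integrable (fun ω => ∑ k ∈ Finset.range (m + 1),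
      Y ω ^ k * a (k + 1) (W' ω) / k.factorial) μ :=
    integrable_finsetSum _ fun k hk =>
      (hprod k (k + 1) (by rw [Finset.mem_range] at hk; omega)).1.div_const _
  have hE1 : ∫ ω, ∑ k ∈ Finset.range (m + 2), Y ω ^ (k + 1) * a k (W' ω) / k.factorial ∂μ =
      ∑ k ∈ Finset.range (m + 2),
        (∫ ω, Y ω ^ (k + 1) ∂μ) * (∫ ω, a k (W' ω) ∂μ) / k.factorial := by
    rw [integral_finsetSum _ fun k hk =>
      (hprod (k + 1) k (by rw [Finset.mem_range] at hk; omega)).1.div_const _]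
    refine Finset.sum_congr rfl fun k hk => ?_
    rw [integral_div, (hprod (k + 1) k (by rw [Finset.mem_range] at hk; omega)).2]
  have hE2 : ∫ ω, ∑ k ∈ Finset.range (m + 1), Y ω ^ k * a (k + 1) (W' ω) / k.factorial ∂μ =
      ∑ k ∈ Finset.range (m + 1),
        (∫ ω, Y ω ^ k ∂μ) * (∫ ω, a (k + 1) (W' ω) ∂μ) / k.factorial := by
    rw [integral_finsetSum _ fun k hk =>
      (hprod k (k + 1) (by rw [Finset.mem_range] at hk; omega)).1.div_const _]
    refine Finset.sum_congr rfl fun k hk => ?_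
    rw [integral_div, (hprod k (k + 1) (by rw [Finset.mem_range] at hk; omega)).2]
  -- By independence both Taylor polynomials integrate to sums of products of moments, in which the
  -- matched orders cancel. It remains to bound the two Taylor remainders `hR1` and `hR2`.
  have hmain := stein_moment_sum m κ (fun k => ∫ ω, Y ω ^ k ∂μ) (fun k => ∫ ω, a k (W' ω) ∂μ) hM
  rw [← hmain, ← hE1, ← hE2]
  have hR1 : |∫ ω, (Y ω * G (W' ω + Y ω • Pi.single j (1 : ℝ)) -
      ∑ k ∈ Finset.range (m + 2), Y ω ^ (k + 1) * a k (W' ω) / k.factorial) ∂μ| ≤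
      (∫ ω, |Y ω| ^ (m + 3) * Ψ ω ∂μ) / (m + 2).factorial := by
    rw [← integral_div, ← Real.norm_eq_abs]
    refine norm_integral_le_of_norm_le (h1.div_const _) (Filter.Eventually.of_forall fun ω => ?_)
    have h := hG.taylor_coord_le j (W' ω) (Y ω) (m + 2) (hΨ ω)
    have e : Y ω * G (W' ω + Y ω • Pi.single j (1 : ℝ)) -
        ∑ k ∈ Finset.range (m + 2), Y ω ^ (k + 1) * a k (W' ω) / k.factorial =
        Y ω * (G (W' ω + Y ω • Pi.single j (1 : ℝ)) -
        ∑ k ∈ Finset.range (m + 2), Y ω ^ k * a k (W' ω) / k.factorial) := by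
      rw [mul_sub, Finset.mul_sum]
      congr 1
      exact Finset.sum_congr rfl fun k _ => by ring
    rw [e, Real.norm_eq_abs, abs_mul]
    refine (mul_le_mul_of_nonneg_left h (abs_nonneg _)).trans (le_of_eq ?_)
    ring
  have hR2 : |∫ ω, (_root_.pd j G (W' ω + Y ω • Pi.single j (1 : ℝ)) -
      ∑ k ∈ Finset.range (m + 1), Y ω ^ k * a (k + 1) (W' ω) / k.factorial) ∂μ| ≤
      (∫ ω, |Y ω| ^ (m + 1) * Ψ ω ∂μ) / (m + 1).factorial := by
    rw [← integral_div, ← Real.norm_eq_abs]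
    refine norm_integral_le_of_norm_le (h2.div_const _) (Filter.Eventually.of_forall fun ω => ?_)
    -- Order `m + 1` for `pd j G` is order `m + 2` for `G`, so the same `Ψ` bounds both remainders.
    have hrep : ∀ k, _root_.iterPartial (List.replicate k j) (_root_.pd j G) = a (k + 1) := by
      intro k
      rw [ha]
      simp only
      rw [List.replicate_succ', iterPartial_append]
      rfl
    have h := (hG.pd j).taylor_coord_le j (W' ω) (Y ω) (m + 1) (C := Ψ ω)
      (by rw [hrep]; exact hΨ ω)
    simpa only [hrep, Real.norm_eq_abs] using h
  rw [integral_sub hI1 hS1] at hR1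
  rw [integral_sub hI2 hS2] at hR2
  have h3 := abs_le.1 hR1
  have h4 := abs_le.1 hR2
  rw [abs_le]
  constructor <;> nlinarith [mul_le_mul_of_nonneg_left h4.1 hκ, mul_le_mul_of_nonneg_left h4.2 hκ]

lemma abs_integral_comp_add_sub_le (hQ : 0 ≤ Q) (hG : Tame Q G) (hi : IndepFun Y W' μ)
    (hY : Measurable Y) (hW' : Measurable W') (j : Fin d)
    (hW'Q : Integrable (fun ω => (1 + ‖W' ω‖) ^ Q) μ)
    (hYQ : Integrable (fun ω => (1 + |Y ω|) ^ (Q + 1)) μ)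
    (hΨ : ∀ ω, ∀ t ∈ Set.Icc (0 : ℝ) 1, |_root_.pd j G
      (W' ω + (t * Y ω) • Pi.single j (1 : ℝ))| ≤ Ψ ω)
    (h1 : Integrable (fun ω => |Y ω| * Ψ ω) μ) :
    |∫ ω, G (W' ω + Y ω • Pi.single j (1 : ℝ)) ∂μ - ∫ ω, G (W' ω) ∂μ| ≤
      ∫ ω, |Y ω| * Ψ ω ∂μ := by
  have hI : Integrable (fun ω => G (W' ω + Y ω • Pi.single j (1 : ℝ))) μ := by
    have := hG.integrable_mul_comp_add hQ hi hY hW' j hW'Q hYQ (f := fun y => 1)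
      measurable_const fun y => by simp
    simpa using this
  have hI' : Integrable (fun ω => G (W' ω)) μ := by
    obtain ⟨C, hC, h⟩ := hG.bound
    exact integrable_comp_of_growth hW' hW'Q hG.continuous.measurable h
  rw [← integral_sub hI hI', ← Real.norm_eq_abs]
  refine norm_integral_le_of_norm_le h1 (Filter.Eventually.of_forall fun ω => ?_)
  have h := hG.taylor_coord_le j (W' ω) (Y ω) 1 (hΨ ω)
  simpa [iterPartial] using! h

end

end

/-! ### Elementary inequalities for real powers -/

lemma rpow_le_one_add_mul {t θ : ℝ} (ht : 0 ≤ t) (h0 : 0 ≤ θ) (h1 : θ ≤ 1) :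
    t ^ θ ≤ 1 + θ * (t - 1) := by
  have := rpow_one_add_le_one_add_mul_self (s := t - 1) (by linarith) h0 h1
  simpa using this

/-- The tangent line at `1` of the concave power `u ^ (r / 2)` at `u = x ^ 2`. When the second
moment is at most one, so is the mean of the right-hand side. -/
lemma abs_rpow_le_one_add {x r : ℝ} (h0 : 0 ≤ r) (h2 : r ≤ 2) :
    |x| ^ r ≤ 1 + r / 2 * (x ^ 2 - 1) := by
  have := rpow_le_one_add_mul (sq_nonneg x) (by linarith : 0 ≤ r / 2) (by linarith)
  rwa [← sq_abs, ← Real.rpow_natCast, ← Real.rpow_mul (abs_nonneg _), Nat.cast_ofNat,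
    mul_div_cancel₀ _ (two_ne_zero), Real.rpow_ofNat, sq_abs] at this

lemma add_rpow_le_two_rpow_mul {a b r : ℝ} (ha : 0 ≤ a) (hb : 0 ≤ b) (hr : 0 ≤ r) :
    (a + b) ^ r ≤ 2 ^ r * (a ^ r + b ^ r) := by
  have hm : (a + b) ^ r ≤ (2 * max a b) ^ r :=
    Real.rpow_le_rpow (by positivity) (by linarith [le_max_left a b, le_max_right a b]) hr
  rw [Real.mul_rpow (by norm_num) (by positivity)] at hm
  refine hm.trans (mul_le_mul_of_nonneg_left ?_ (by positivity))
  have h1 : 0 ≤ a ^ r := by positivity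
  have h2 : 0 ≤ b ^ r := by positivity
  rcases max_choice a b with h | h <;> rw [h] <;> linarith

lemma add_add_rpow_le_three_rpow_mul {a b c r : ℝ} (ha : 0 ≤ a) (hb : 0 ≤ b) (hc : 0 ≤ c)
    (hr : 0 ≤ r) : (a + b + c) ^ r ≤ 3 ^ r * (a ^ r + b ^ r + c ^ r) := by
  have hle : a + b + c ≤ 3 * max (max a b) c := by
    linarith [le_max_left a b, le_max_right a b, le_max_left (max a b) c,
      le_max_right (max a b) c]
  have hm : (a + b + c) ^ r ≤ (3 * max (max a b) c) ^ r :=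
    Real.rpow_le_rpow (by positivity) hle hr
  rw [Real.mul_rpow (by norm_num) (by positivity)] at hm
  refine hm.trans (mul_le_mul_of_nonneg_left ?_ (by positivity))
  have h1 : 0 ≤ a ^ r := by positivity
  have h2 : 0 ≤ b ^ r := by positivity
  have h3 : 0 ≤ c ^ r := by positivity
  rcases max_choice (max a b) c with h | h <;> rw [h]
  · rcases max_choice a b with h | h <;> rw [h] <;> linarith
  · linarith

lemma add_rpow_le_of_le_one {a b r : ℝ} (ha : 0 ≤ a) (hb : 0 ≤ b) (hr : 0 ≤ r) (hr1 : r ≤ 1) :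
    (a + b) ^ r ≤ a ^ r + b ^ r := Real.rpow_add_le_add_rpow ha hb hr hr1

/-! ### Moments of a standardised random variable -/

section
variable {Ω : Type*} [MeasurableSpace Ω] {μ : Measure Ω} [IsProbabilityMeasure μ] {X : Ω → ℝ}

lemma integrable_one_add_abs_rpow (hX : Measurable X) {R : ℝ} (hR : 0 ≤ R)
    (h : Integrable (fun ω => |X ω| ^ R) μ) : Integrable (fun ω => (1 + |X ω|) ^ R) μ := by
  refine (((integrable_const (1 : ℝ)).add h).const_mul (2 ^ R)).mono'
    (by fun_prop : Measurable fun ω => (1 + |X ω|) ^ R).aestronglyMeasurable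
    (Filter.Eventually.of_forall fun ω => ?_)
  rw [Real.norm_of_nonneg (by positivity)]
  have := add_rpow_le_two_rpow_mul (r := R) zero_le_one (abs_nonneg (X ω)) hR
  simpa using this

lemma integrable_abs_rpow_of_le (hX : Measurable X) {R s : ℝ} (hs : 0 ≤ s) (hsR : s ≤ R)
    (h : Integrable (fun ω => (1 + |X ω|) ^ R) μ) : Integrable (fun ω => |X ω| ^ s) μ := by
  refine h.mono' (by fun_prop : Measurable fun ω => |X ω| ^ s).aestronglyMeasurable
    (Filter.Eventually.of_forall fun ω => ?_)
  rw [Real.norm_of_nonneg (by positivity)]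
  exact (Real.rpow_le_rpow (abs_nonneg _) (by linarith [abs_nonneg (X ω)]) hs).trans
    (Real.rpow_le_rpow_of_exponent_le (by linarith [abs_nonneg (X ω)]) hsR)

lemma integrable_pow_of_le (hX : Measurable X) {R : ℝ} {k : ℕ} (hk : (k : ℝ) ≤ R)
    (h : Integrable (fun ω => (1 + |X ω|) ^ R) μ) : Integrable (fun ω => X ω ^ k) μ := by
  refine (integrable_abs_rpow_of_le hX (Nat.cast_nonneg k) hk h).mono'
    (hX.pow_const k).aestronglyMeasurable (Filter.Eventually.of_forall fun ω => ?_)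
  rw [norm_pow, Real.rpow_natCast, Real.norm_eq_abs]

lemma integrable_one_add_mul_sub {f : Ω → ℝ} (hf : Integrable f μ) (θ : ℝ) :
    Integrable (fun ω => 1 + θ * (f ω - 1)) μ ∧
      ∫ ω, (1 + θ * (f ω - 1)) ∂μ = 1 + θ * (∫ ω, f ω ∂μ - 1) := by
  have h1 : Integrable (fun ω => f ω - 1) μ := hf.sub (integrable_const 1)
  have h2 : Integrable (fun ω => θ * (f ω - 1)) μ := h1.const_mul θ
  refine ⟨(integrable_const 1).add h2, ?_⟩
  rw [integral_add (integrable_const 1) h2, integral_const_mul,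
    integral_sub hf (integrable_const 1)]
  simp

/-- The tangent line at `1` of the convex power `u ^ (b / 2)` at `u = X ^ 2`, integrated against a
unit second moment. -/
lemma one_le_absMoment {b : ℝ} (hb : 2 ≤ b) (h2 : ∫ ω, X ω ^ 2 ∂μ = 1)
    (h2i : Integrable (fun ω => X ω ^ 2) μ) (h : Integrable (fun ω => |X ω| ^ b) μ) :
    1 ≤ absMoment μ X b := by
  have h1 : ∀ ω, 1 + b / 2 * (X ω ^ 2 - 1) ≤ |X ω| ^ b := by
    intro ω
    have := one_add_mul_self_le_rpow_one_add (s := X ω ^ 2 - 1) (p := b / 2)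
      (by linarith [sq_nonneg (X ω)]) (by linarith)
    rwa [add_sub_cancel, ← sq_abs, ← Real.rpow_natCast, ← Real.rpow_mul (abs_nonneg _),
      Nat.cast_ofNat, mul_div_cancel₀ _ (two_ne_zero), Real.rpow_ofNat, sq_abs] at this
  obtain ⟨h3, h4⟩ := integrable_one_add_mul_sub h2i (b / 2)
  rw [h2, sub_self, mul_zero, add_zero] at h4
  rw [← h4]
  exact integral_mono h3 h h1

/-- Concavity gives the mean bound with slope `a / b`, and `one_le_absMoment` allows this slope to
be raised to `1`. Through this, every lower moment is replaced by the top one, which is why the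
brackets contain only top moments. -/
lemma absMoment_le_absMoment {a b : ℝ} (ha : 0 ≤ a) (hab : a ≤ b) (hb : 2 ≤ b)
    (h2 : ∫ ω, X ω ^ 2 ∂μ = 1) (h2i : Integrable (fun ω => X ω ^ 2) μ)
    (h : Integrable (fun ω => |X ω| ^ b) μ) (h' : Integrable (fun ω => |X ω| ^ a) μ) :
    absMoment μ X a ≤ absMoment μ X b := by
  have hm := one_le_absMoment hb h2 h2i h
  have hθ : a / b ≤ 1 := (div_le_one (by linarith)).2 hab
  have h1 : ∀ ω, |X ω| ^ a ≤ 1 + a / b * (|X ω| ^ b - 1) := by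
    intro ω
    have := rpow_le_one_add_mul (t := |X ω| ^ b) (by positivity)
      (div_nonneg ha (by linarith)) hθ
    rwa [← Real.rpow_mul (abs_nonneg _), mul_div_cancel₀ _ (by linarith : b ≠ 0)] at this
  obtain ⟨h3, h4⟩ := integrable_one_add_mul_sub h (a / b)
  calc absMoment μ X a ≤ 1 + a / b * (absMoment μ X b - 1) := (integral_mono h' h3 h1).trans_eq h4
    _ ≤ 1 + 1 * (absMoment μ X b - 1) := by gcongr
    _ = _ := by ring

lemma absMoment_nonneg (s : ℝ) : 0 ≤ absMoment μ X s := integral_nonneg fun ω => by positivity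

lemma convexOn_abs_rpow {r : ℝ} (hr : 1 ≤ r) : ConvexOn ℝ Set.univ fun x : ℝ => |x| ^ r := by
  refine ⟨convex_univ, fun x _ y _ a b ha hb hab => ?_⟩
  have h1 : |a • x + b • y| ≤ a • |x| + b • |y| := by
    simp only [smul_eq_mul]
    refine (abs_add_le _ _).trans ?_
    rw [abs_mul, abs_mul, abs_of_nonneg ha, abs_of_nonneg hb]
  exact (Real.rpow_le_rpow (abs_nonneg _) h1 (by linarith)).trans
    ((convexOn_rpow hr).2 (abs_nonneg x) (abs_nonneg y) ha hb hab)

/-- Adding an independent centred summand increases absolute moments of order at least one. -/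
lemma absMoment_le_absMoment_add {U Y : Ω → ℝ} (hU : Measurable U) (hY : Measurable Y)
    (hi : IndepFun U Y μ) (hYi : Integrable Y μ) (hY0 : ∫ ω, Y ω ∂μ = 0) {r : ℝ} (hr : 1 ≤ r)
    (hUr : Integrable (fun ω => |U ω| ^ r) μ)
    (hUYr : Integrable (fun ω => |U ω + Y ω| ^ r) μ) :
    absMoment μ U r ≤ absMoment μ (fun ω => U ω + Y ω) r := by
  have hlaw := (indepFun_iff_map_prod_eq_prod_map_map hU.aemeasurable hY.aemeasurable).1 hi
  have hmU : IsProbabilityMeasure (μ.map U) := Measure.isProbabilityMeasure_map hU.aemeasurable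
  have hmY : IsProbabilityMeasure (μ.map Y) := Measure.isProbabilityMeasure_map hY.aemeasurable
  have hmeas : Measurable fun x : ℝ × ℝ => |x.1 + x.2| ^ r := by fun_prop
  have e1 : absMoment μ (fun ω => U ω + Y ω) r =
      ∫ x, |x.1 + x.2| ^ r ∂(μ.map U).prod (μ.map Y) := by
    rw [← hlaw, integral_map (hU.prodMk hY).aemeasurable hmeas.aestronglyMeasurable]
    rfl
  have hint : Integrable (fun x : ℝ × ℝ => |x.1 + x.2| ^ r) ((μ.map U).prod (μ.map Y)) := by
    rw [← hlaw, integrable_map_measure hmeas.aestronglyMeasurable (hU.prodMk hY).aemeasurable]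
    exact hUYr
  have hm1 : Measurable fun x : ℝ => |x| ^ r := by fun_prop
  have e2 : absMoment μ U r = ∫ u, |u| ^ r ∂μ.map U := by
    rw [integral_map hU.aemeasurable hm1.aestronglyMeasurable]
    rfl
  have hYi' : Integrable (fun y : ℝ => y) (μ.map Y) := by
    rw [integrable_map_measure (by fun_prop) hY.aemeasurable]
    exact hYi
  have hY0' : ∫ y, y ∂μ.map Y = 0 := by
    rw [integral_map hY.aemeasurable (by fun_prop), hY0]
  have hUr' : Integrable (fun u : ℝ => |u| ^ r) (μ.map U) := by
    rw [integrable_map_measure hm1.aestronglyMeasurable hU.aemeasurable]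
    exact hUr
  rw [e1, e2, integral_prod _ hint]
  refine integral_mono_ae hUr' hint.integral_prod_left ?_
  -- Jensen's inequality in `y` alone, with `u` fixed: the mean of `u + Y` is `u`.
  filter_upwards [hint.prod_right_ae] with u hu
  have := (convexOn_abs_rpow hr).map_integral_le (μ := μ.map Y) (f := fun y => u + y)
    (Continuous.continuousOn (by fun_prop (disch := linarith))) isClosed_univ (by simp)
    ((integrable_const u).add hYi') hu
  rw [integral_add (integrable_const u) hYi', hY0'] at this
  simpa using this

end

/-! ### The array of summands -/

section
variable {Ω : Type*} {d p : ℕ} {r : Fin d → ℝ} {n : Fin d → ℕ} {X : (j : Fin d) → Fin (n j) → Ω → ℝ}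

/-- The vector of standardised sums with the summand `X j i` left out. -/
def sumOff (X : (j : Fin d) → Fin (n j) → Ω → ℝ) (j : Fin d) (i : Fin (n j)) (ω : Ω) :
    Fin d → ℝ :=
  fun m => (1 / Real.sqrt (n m)) *
    ∑ i', if (⟨m, i'⟩ : Σ m : Fin d, Fin (n m)) = ⟨j, i⟩ then 0 else X m i' ω

/-- The scaled summand `n_j^{-1/2} X_{ij}`. -/
def scaled (X : (j : Fin d) → Fin (n j) → Ω → ℝ) (j : Fin d) (i : Fin (n j)) (ω : Ω) : ℝ :=
  (1 / Real.sqrt (n j)) * X j i ω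

lemma sumOff_add_scaled (j : Fin d) (i : Fin (n j)) (ω : Ω) :
    sumOff X j i ω + scaled X j i ω • Pi.single j (1 : ℝ) = sumVec X ω := by
  ext m
  simp only [sumOff, scaled, sumVec, Pi.add_apply, Pi.smul_apply, smul_eq_mul]
  by_cases h : m = j
  · subst h
    rw [Pi.single_eq_same, mul_one, ← mul_add]
    congr 1
    rw [← Finset.add_sum_erase _ _ (Finset.mem_univ i),
      ← Finset.add_sum_erase Finset.univ (fun i' => X m i' ω) (Finset.mem_univ i), if_pos rfl,
      zero_add, add_comm]
    congr 1
    refine Finset.sum_congr rfl fun i' hi' => ?_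
    rw [if_neg]
    intro h
    rw [Finset.mem_erase] at hi'
    exact hi'.1 (by simpa using h)
  · rw [Pi.single_eq_of_ne h, mul_zero, add_zero]
    congr 1
    refine Finset.sum_congr rfl fun i' _ => ?_
    rw [if_neg]
    intro h'
    exact h (congrArg Sigma.fst h')

variable [MeasurableSpace Ω] {μ : Measure Ω}

lemma MatchingArray.measurable_scaled (hX : MatchingArray μ p r n X) (j : Fin d)
    (i : Fin (n j)) : Measurable (scaled X j i) := (hX.meas j i).const_mul _

lemma MatchingArray.measurable_sumOff (hX : MatchingArray μ p r n X) (j : Fin d)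
    (i : Fin (n j)) : Measurable (sumOff X j i) := by
  refine measurable_pi_lambda _ fun m => Measurable.const_mul ?_ _
  refine Finset.measurable_sum _ fun i' _ => ?_
  split_ifs
  · exact measurable_const
  · exact hX.meas m i'

lemma MatchingArray.measurable_sumVec (hX : MatchingArray μ p r n X) : Measurable (sumVec X) :=
  measurable_pi_lambda _ fun m =>
    (Finset.measurable_sum _ fun i' _ => hX.meas m i').const_mul _

/-- The two are functions of disjoint subfamilies of an independent family; the sums are rewritten
so that they only see coordinates outside `s`. -/
lemma MatchingArray.indepFun_scaled_sumOff (hX : MatchingArray μ p r n X) (j : Fin d)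
    (i : Fin (n j)) : IndepFun (scaled X j i) (sumOff X j i) μ := by
  classical
  set s : Σ m : Fin d, Fin (n m) := ⟨j, i⟩ with hs
  set T : Finset (Σ m : Fin d, Fin (n m)) := Finset.univ.erase s with hT
  have h := hX.indep.indepFun_finset {s} T (by simp [hT]) fun t => hX.meas t.1 t.2
  have h1 : Measurable fun x : ({s} : Finset (Σ m : Fin d, Fin (n m))) → ℝ =>
      (1 / Real.sqrt (n j)) * x ⟨s, Finset.mem_singleton_self s⟩ := by fun_prop
  have h2 : Measurable fun (x : T → ℝ)
      (m : Fin d) => (1 / Real.sqrt (n m)) * ∑ i' : Fin (n m),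
        if ht : (⟨m, i'⟩ : Σ m : Fin d, Fin (n m)) = s then 0 else
          x ⟨⟨m, i'⟩, Finset.mem_erase.2 ⟨ht, Finset.mem_univ _⟩⟩ := by
    refine measurable_pi_lambda _ fun m => Measurable.const_mul ?_ _
    refine Finset.measurable_sum _ fun i' _ => ?_
    split_ifs
    · exact measurable_const
    · exact measurable_pi_apply _
  have h3 := h.comp h1 h2
  convert! h3 using 1

lemma one_div_sqrt_nonneg (k : ℕ) : 0 ≤ 1 / Real.sqrt k := by positivity

lemma one_div_sqrt_le_one (k : ℕ) : 1 / Real.sqrt k ≤ 1 := by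
  rcases Nat.eq_zero_or_pos k with rfl | hk
  · simp
  · rw [div_le_one (by positivity), Real.one_le_sqrt]
    exact_mod_cast hk

lemma abs_scaled_le (j : Fin d) (i : Fin (n j)) (ω : Ω) : |scaled X j i ω| ≤ |X j i ω| := by
  rw [scaled, abs_mul, abs_of_nonneg (one_div_sqrt_nonneg _)]
  exact mul_le_of_le_one_left (abs_nonneg _) (one_div_sqrt_le_one _)

lemma norm_sumVec_le (ω : Ω) : ‖sumVec X ω‖ ≤ ∑ j, ∑ i, |X j i ω| := by
  rw [pi_norm_le_iff_of_nonneg (by positivity)]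
  intro m
  rw [sumVec, norm_mul, Real.norm_of_nonneg (one_div_sqrt_nonneg _)]
  refine (mul_le_of_le_one_left (norm_nonneg _) (one_div_sqrt_le_one _)).trans ?_
  refine (norm_sum_le _ _).trans ?_
  exact Finset.single_le_sum (f := fun m => ∑ i, |X m i ω|) (fun m _ => by positivity)
    (Finset.mem_univ m)

lemma norm_sumOff_le (j : Fin d) (i : Fin (n j)) (ω : Ω) :
    ‖sumOff X j i ω‖ ≤ ∑ j, ∑ i, |X j i ω| := by
  rw [pi_norm_le_iff_of_nonneg (by positivity)]
  intro m
  rw [sumOff, norm_mul, Real.norm_of_nonneg (one_div_sqrt_nonneg _)]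
  refine (mul_le_of_le_one_left (norm_nonneg _) (one_div_sqrt_le_one _)).trans ?_
  refine (norm_sum_le _ _).trans ((Finset.sum_le_sum fun i' _ => ?_).trans
    (Finset.single_le_sum (f := fun m => ∑ i, |X m i ω|) (fun m _ => by positivity)
    (Finset.mem_univ m)))
  split_ifs
  · simp
  · rw [Real.norm_eq_abs]

variable [IsProbabilityMeasure μ]

/-- `L^R` is closed under finite sums for every `R > 0`, so no independence is needed. -/
lemma MatchingArray.integrable_one_add_of_norm_le (hX : MatchingArray μ p r n X) {R : ℝ}
    (hR : 0 < R) (hXR : ∀ j i, Integrable (fun ω => |X j i ω| ^ R) μ) {V : Ω → Fin d → ℝ}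
    (hV : Measurable V) (hle : ∀ ω, ‖V ω‖ ≤ ∑ j, ∑ i, |X j i ω|) :
    Integrable (fun ω => (1 + ‖V ω‖) ^ R) μ := by
  have h1 : ∀ j i, MemLp (fun ω => |X j i ω|) (ENNReal.ofReal R) μ := by
    intro j i
    rw [← integrable_norm_rpow_iff (hX.meas j i).abs.aestronglyMeasurable (by simpa using hR)
      ENNReal.ofReal_ne_top, ENNReal.toReal_ofReal hR.le]
    simpa using hXR j i
  have h2 : MemLp (fun ω => ∑ j, ∑ i, |X j i ω|) (ENNReal.ofReal R) μ :=
    memLp_finsetSum _ fun j _ => memLp_finsetSum _ fun i _ => h1 j i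
  have h0 : MemLp (fun _ : Ω => (1 : ℝ)) (ENNReal.ofReal R) μ := memLp_const 1
  have h3 := (h0.add h2).integrable_norm_rpow (by simpa using hR) ENNReal.ofReal_ne_top
  rw [ENNReal.toReal_ofReal hR.le] at h3
  refine h3.mono' (by fun_prop : Measurable fun ω => (1 + ‖V ω‖) ^ R).aestronglyMeasurable
    (Filter.Eventually.of_forall fun ω => ?_)
  rw [Real.norm_of_nonneg (by positivity)]
  refine Real.rpow_le_rpow (by positivity) ?_ hR.le
  rw [Pi.add_apply, Real.norm_of_nonneg (by positivity)]
  linarith [hle ω]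

lemma MatchingArray.integrable_sumVec (hX : MatchingArray μ p r n X) {R : ℝ}
    (hR : 0 < R) (hXR : ∀ j i, Integrable (fun ω => |X j i ω| ^ R) μ) :
    Integrable (fun ω => (1 + ‖sumVec X ω‖) ^ R) μ :=
  hX.integrable_one_add_of_norm_le hR hXR hX.measurable_sumVec norm_sumVec_le

lemma MatchingArray.integrable_sumOff (hX : MatchingArray μ p r n X) {R : ℝ}
    (hR : 0 < R) (hXR : ∀ j i, Integrable (fun ω => |X j i ω| ^ R) μ) (j : Fin d)
    (i : Fin (n j)) : Integrable (fun ω => (1 + ‖sumOff X j i ω‖) ^ R) μ :=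
  hX.integrable_one_add_of_norm_le hR hXR (hX.measurable_sumOff j i) (norm_sumOff_le j i)

lemma integrable_gaussian_pow (k : ℕ) :
    Integrable (fun x : ℝ => x ^ k) (gaussianReal 0 1) :=
  integrable_pow_of_le measurable_id le_rfl
    (integrable_one_add_abs_rpow_gaussian (Nat.cast_nonneg k))

/-- Stein's identity for `x ^ k`. At `k = 0` the truncated exponent is multiplied by zero. -/
lemma gaussian_moment_succ (k : ℕ) :
    ∫ x : ℝ, x ^ (k + 1) ∂gaussianReal 0 1 = k * ∫ x : ℝ, x ^ (k - 1) ∂gaussianReal 0 1 := by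
  have h := gaussian_integral_mul_eq_deriv (ψ := fun x => x ^ k)
    (ψ' := fun x => k * x ^ (k - 1)) (fun t => hasDerivAt_pow k t) (integrable_gaussian_pow k)
    ((integrable_gaussian_pow (k + 1)).congr (Filter.Eventually.of_forall fun x => pow_succ' x k))
    ((integrable_gaussian_pow (k - 1)).const_mul _)
  rw [← integral_const_mul, ← h]
  simp only [pow_succ']

lemma gaussian_moment_odd {k : ℕ} (hk : Odd k) : ∫ x : ℝ, x ^ k ∂gaussianReal 0 1 = 0 := by
  obtain ⟨m, rfl⟩ := hk
  induction m with
  | zero => simp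
  | succ m ih =>
    have := gaussian_moment_succ (2 * (m + 1))
    rw [this]
    have e : 2 * (m + 1) - 1 = 2 * m + 1 := by omega
    rw [e, ih, mul_zero]

lemma MatchingArray.moment_succ (hX : MatchingArray μ p r n X) (j : Fin d) (i : Fin (n j))
    {k : ℕ} (hk : k < p) :
    ∫ ω, X j i ω ^ (k + 1) ∂μ = k * ∫ ω, X j i ω ^ (k - 1) ∂μ := by
  rw [hX.moments j i (k + 1) (by omega) (by omega), gaussian_moment_succ]
  -- For `k ≤ 1` the right-hand side involves the moment of order zero, which `moments` does not
  -- mention but which is `1` for both laws.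
  rcases Nat.lt_or_ge (k - 1) 1 with h | h
  · have : k - 1 = 0 := by omega
    simp [this]
  · rw [hX.moments j i (k - 1) h (by omega)]

lemma MatchingArray.moment_two (hX : MatchingArray μ p r n X) (hp : 2 ≤ p) (j : Fin d)
    (i : Fin (n j)) : ∫ ω, X j i ω ^ 2 ∂μ = 1 := by
  have := hX.moment_succ j i (k := 1) (by omega)
  simpa using this

lemma MatchingArray.moment_one (hX : MatchingArray μ p r n X) (hp : 2 ≤ p) (j : Fin d)
    (i : Fin (n j)) : ∫ ω, X j i ω ∂μ = 0 := by
  have := hX.moment_succ j i (k := 0) (by omega)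
  simpa using this

lemma MatchingArray.moment_odd (hX : MatchingArray μ p r n X) (j : Fin d)
    (i : Fin (n j)) {k : ℕ} (hk : Odd k) (hkp : k ≤ p) : ∫ ω, X j i ω ^ k ∂μ = 0 := by
  rw [hX.moments j i k hk.pos hkp, gaussian_moment_odd hk]

lemma scaled_pow (j : Fin d) (i : Fin (n j)) (k : ℕ) (ω : Ω) :
    scaled X j i ω ^ k = (1 / Real.sqrt (n j)) ^ k * X j i ω ^ k := by rw [scaled, mul_pow]

lemma MatchingArray.scaled_moment_succ (hX : MatchingArray μ p r n X) (j : Fin d)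
    (i : Fin (n j)) {k : ℕ} (hk : k < p) :
    ∫ ω, scaled X j i ω ^ (k + 1) ∂μ = 1 / n j * k * ∫ ω, scaled X j i ω ^ (k - 1) ∂μ := by
  simp only [scaled_pow, integral_const_mul, hX.moment_succ j i hk]
  rcases k with _ | k
  · simp
  · have : (1 / Real.sqrt (n j)) ^ (k + 1 + 1) = (1 / Real.sqrt (n j)) ^ k * (1 / (n j : ℝ)) := by
      rw [add_assoc, pow_add, div_pow 1 _ (1 + 1), Real.sq_sqrt (Nat.cast_nonneg _), one_pow]
    rw [this, Nat.add_sub_cancel]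
    ring

lemma MatchingArray.second_moment_sumVec (hX : MatchingArray μ p r n X) (hp : 2 ≤ p)
    (h2i : ∀ j i, Integrable (fun ω => X j i ω ^ 2) μ) (m : Fin d) :
    ∫ ω, sumVec X ω m ^ 2 ∂μ = 1 := by
  have hmem : ∀ i, MemLp (X m i) 2 μ := fun i =>
    (memLp_two_iff_integrable_sq (hX.meas m i).aestronglyMeasurable).2 (h2i m i)
  have hm1 := fun i => hX.moment_one hp m i
  have hi1 : ∀ i, Integrable (X m i) μ := fun i => (hmem i).integrable (by norm_num)
  have hvar : ∀ i, Var[X m i; μ] = 1 := fun i => by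
    rw [variance_of_integral_eq_zero (hX.meas m i).aemeasurable (hm1 i)]
    exact hX.moment_two hp m i
  have hpw : Set.Pairwise (Finset.univ : Finset (Fin (n m)))
      fun i i' => IndepFun (X m i) (X m i') μ := fun i _ i' _ hne =>
    hX.indep.indepFun (i := ⟨m, i⟩) (j := ⟨m, i'⟩) fun h => hne (by simpa using h)
  have hs := IndepFun.variance_sum (s := Finset.univ) (fun i _ => hmem i) hpw
  have hsum : ∫ ω, (∑ i, X m i) ω ∂μ = 0 := by
    simp only [Finset.sum_apply]
    rw [integral_finsetSum _ fun i _ => hi1 i]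
    exact Finset.sum_eq_zero fun i _ => hm1 i
  rw [variance_of_integral_eq_zero (Finset.aemeasurable_sum _ fun i _ =>
    (hX.meas m i).aemeasurable) hsum] at hs
  simp only [hvar, Finset.sum_const, Finset.card_univ, Fintype.card_fin, nsmul_eq_mul,
    mul_one, Finset.sum_apply] at hs
  simp only [sumVec, mul_pow]
  rw [integral_const_mul, hs, div_pow, Real.sq_sqrt (Nat.cast_nonneg _)]
  have := hX.pos m
  field_simp

/-- The omitted summand is centred and independent of the rest, so restoring it can only increase a
convex moment; this is where `1 ≤ s` enters. -/
lemma MatchingArray.absMoment_sumOff_le (hX : MatchingArray μ p r n X) (hp : 2 ≤ p) {R : ℝ}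
    (hR : 2 ≤ R) (hXR : ∀ j i, Integrable (fun ω => |X j i ω| ^ R) μ) (j : Fin d)
    (i : Fin (n j)) (m : Fin d) {s : ℝ} (hs : 1 ≤ s) (hsR : s ≤ R) :
    absMoment μ (fun ω => sumOff X j i ω m) s ≤ absMoment μ (fun ω => sumVec X ω m) s := by
  have hcoord : ∀ {V : Ω → Fin d → ℝ}, Measurable V → (∀ ω, ‖V ω‖ ≤ ∑ j, ∑ i, |X j i ω|) →
      Integrable (fun ω => |V ω m| ^ s) μ := by
    intro V hV hle
    refine (hX.integrable_one_add_of_norm_le (by linarith) hXR hV hle).mono'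
      (by fun_prop : Measurable fun ω => |V ω m| ^ s).aestronglyMeasurable
      (Filter.Eventually.of_forall fun ω => ?_)
    rw [Real.norm_of_nonneg (by positivity)]
    have h1 := norm_le_pi_norm (V ω) m
    rw [Real.norm_eq_abs] at h1
    exact (Real.rpow_le_rpow (abs_nonneg _) (by linarith) (by linarith)).trans
      (Real.rpow_le_rpow_of_exponent_le (by linarith [norm_nonneg (V ω)]) hsR)
  have hU := hcoord (hX.measurable_sumOff j i) (norm_sumOff_le j i)
  have hW := hcoord hX.measurable_sumVec norm_sumVec_le
  have hi1 : Integrable (X j i) μ := by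
    have := integrable_pow_of_le (k := 1) (hX.meas j i) (by norm_num; linarith)
      (integrable_one_add_abs_rpow (hX.meas j i) (by linarith) (hXR j i))
    simpa using this
  -- The factor `Pi.single j 1 m` treats all coordinates at once: for `m ≠ j` the added summand is
  -- zero.
  have hdec : ∀ ω, sumVec X ω m =
      sumOff X j i ω m + scaled X j i ω * (Pi.single j (1 : ℝ) : Fin d → ℝ) m := fun ω => by
    rw [← sumOff_add_scaled j i ω]
    simp
  simp only [hdec] at hW ⊢
  refine absMoment_le_absMoment_add ((measurable_pi_apply m).comp (hX.measurable_sumOff j i))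
    ((hX.measurable_scaled j i).mul_const _) ?_ ((hi1.const_mul _).mul_const _) ?_ hs hU hW
  · exact ((hX.indepFun_scaled_sumOff j i).comp (measurable_id.mul_const _)
      (measurable_pi_apply m)).symm
  · simp only [scaled]
    rw [integral_mul_const, integral_const_mul, hX.moment_one hp]
    simp

lemma MatchingArray.second_moment_sumOff_le (hX : MatchingArray μ p r n X) (hp : 2 ≤ p) {R : ℝ}
    (hR : 2 ≤ R) (hXR : ∀ j i, Integrable (fun ω => |X j i ω| ^ R) μ) (j : Fin d)
    (i : Fin (n j)) (m : Fin d) : ∫ ω, sumOff X j i ω m ^ 2 ∂μ ≤ 1 := by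
  have h := hX.absMoment_sumOff_le hp hR hXR j i m (s := 2) (by norm_num) hR
  simp only [absMoment, Real.rpow_ofNat, sq_abs] at h
  rwa [hX.second_moment_sumVec hp fun j i => integrable_pow_of_le (hX.meas j i)
    (by exact_mod_cast hR) (integrable_one_add_abs_rpow (hX.meas j i) (by linarith) (hXR j i))] at h

end

/-! ### Bounds for the Stein defects of the vector of sums -/

section
variable {Ω : Type*} {d p : ℕ} {r : Fin d → ℝ} {n : Fin d → ℕ}
  {X : (j : Fin d) → Fin (n j) → Ω → ℝ} [MeasurableSpace Ω] {μ : Measure Ω}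
  [IsProbabilityMeasure μ] {Q : ℝ} {v : (Fin d → ℝ) → ℝ}

lemma MatchingArray.integrable_scaled (hX : MatchingArray μ p r n X) {R : ℝ} (hR : 0 ≤ R)
    (hXR : ∀ j i, Integrable (fun ω => |X j i ω| ^ R) μ) (j : Fin d) (i : Fin (n j)) :
    Integrable (fun ω => (1 + |scaled X j i ω|) ^ R) μ := by
  refine (integrable_one_add_abs_rpow (hX.meas j i) hR (hXR j i)).mono'
    (by have := hX.measurable_scaled j i; fun_prop) (Filter.Eventually.of_forall fun ω => ?_)
  rw [Real.norm_of_nonneg (by positivity)]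
  exact Real.rpow_le_rpow (by positivity) (by linarith [abs_scaled_le (X := X) j i ω]) hR

/-- The derivative term is shared equally among the summands; the share `1 / n j` is the variance of
one scaled summand, hence the right `κ` for `stein_expansion`. -/
lemma MatchingArray.steinDefect_eq_sum (hX : MatchingArray μ p r n X) (hQ : 0 ≤ Q)
    (hXR : ∀ j i, Integrable (fun ω => |X j i ω| ^ (Q + 1)) μ) (hv : Tame Q v) (j : Fin d) :
    steinDefect μ (sumVec X) j v = ∑ i, (∫ ω, scaled X j i ω * v (sumVec X ω) ∂μ -
      1 / n j * ∫ ω, pd j v (sumVec X ω) ∂μ) := by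
  have hn : (n j : ℝ) ≠ 0 := by exact_mod_cast (hX.pos j).ne'
  have hint : ∀ i, Integrable (fun ω => scaled X j i ω * v (sumVec X ω)) μ := by
    intro i
    have := hv.integrable_mul_comp_add hQ (hX.indepFun_scaled_sumOff j i)
      (hX.measurable_scaled j i) (hX.measurable_sumOff j i) j
      (integrable_one_add_norm_of_le (hX.measurable_sumOff j i) (by linarith)
        (hX.integrable_sumOff (by linarith) hXR j i))
      (hX.integrable_scaled (by linarith) hXR j i) (f := fun y => y) measurable_id
      fun y => by linarith
    simpa only [sumOff_add_scaled] using this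
  rw [Finset.sum_sub_distrib, ← integral_finsetSum _ fun i _ => hint i, steinDefect]
  congr 1
  · congr 1
    ext ω
    rw [← Finset.sum_mul]
    congr 1
    simp only [sumVec, scaled, Finset.mul_sum]
  · simp
    field_simp

/-- Ingredients of the error term when the summand `X j i` is expanded. -/
structure RemainderBound (μ : Measure Ω) (X : (j : Fin d) → Fin (n j) → Ω → ℝ) (j : Fin d)
    (i : Fin (n j)) (v : (Fin d → ℝ) → ℝ) (m : ℕ) (Ψ : Ω → ℝ) (K : ℝ) : Prop where
  bound : ∀ ω, ∀ t ∈ Set.Icc (0 : ℝ) 1, |iterPartial (List.replicate m j) v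
      (sumOff X j i ω + (t * scaled X j i ω) • Pi.single j (1 : ℝ))| ≤ Ψ ω
  moment : ∀ k ≤ m + 1, 1 ≤ k → Integrable (fun ω => |X j i ω| ^ k * Ψ ω) μ ∧
    ∫ ω, |X j i ω| ^ k * Ψ ω ∂μ ≤ K

lemma RemainderBound.scaled_moment {j : Fin d} {i : Fin (n j)} {m : ℕ} {Ψ : Ω → ℝ} {K : ℝ}
    (h : RemainderBound μ X j i v m Ψ K) {k : ℕ} (hk : k ≤ m + 1) (hk1 : 1 ≤ k) :
    Integrable (fun ω => |scaled X j i ω| ^ k * Ψ ω) μ ∧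
      ∫ ω, |scaled X j i ω| ^ k * Ψ ω ∂μ ≤ (1 / Real.sqrt (n j)) ^ k * K := by
  have e : ∀ ω, |scaled X j i ω| ^ k * Ψ ω =
      (1 / Real.sqrt (n j)) ^ k * (|X j i ω| ^ k * Ψ ω) := fun ω => by
    rw [scaled, abs_mul, abs_of_nonneg (one_div_sqrt_nonneg _), mul_pow, mul_assoc]
  simp only [e]
  obtain ⟨h1, h2⟩ := h.moment k hk hk1
  refine ⟨h1.const_mul _, ?_⟩
  rw [integral_const_mul]
  exact mul_le_mul_of_nonneg_left h2 (by positivity)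

lemma MatchingArray.summand_expansion (hX : MatchingArray μ p r n X) (hQ : 0 ≤ Q)
    (hpQ : (p : ℝ) + 2 ≤ Q + 1) (hXR : ∀ j i, Integrable (fun ω => |X j i ω| ^ (Q + 1)) μ)
    (hv : Tame Q v) (j : Fin d) (i : Fin (n j)) {m : ℕ} (hm : m + 1 ≤ p) {Ψ : Ω → ℝ} {K : ℝ}
    (h : RemainderBound μ X j i v (m + 2) Ψ K) :
    |∫ ω, scaled X j i ω * v (sumVec X ω) ∂μ - 1 / n j * ∫ ω, pd j v (sumVec X ω) ∂μ -
      (∫ ω, scaled X j i ω ^ (m + 2) ∂μ - 1 / n j * (m + 1) * ∫ ω, scaled X j i ω ^ m ∂μ) /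
        (m + 1).factorial * ∫ ω, iterPartial (List.replicate (m + 1) j) v (sumOff X j i ω) ∂μ| ≤
      (1 / Real.sqrt (n j)) ^ (m + 3) * (1 / ((m : ℝ) + 2) + 1) / (m + 1).factorial * K := by
  have hR : 0 ≤ Q + 1 := by linarith
  have hYQ := hX.integrable_scaled hR hXR j i
  have hexp := stein_expansion hQ hv (hX.indepFun_scaled_sumOff j i)
      (hX.measurable_scaled j i) (hX.measurable_sumOff j i) j
      (integrable_one_add_norm_of_le (hX.measurable_sumOff j i) (by linarith)
        (hX.integrable_sumOff (by linarith) hXR j i)) hYQ m (κ := 1 / n j) (by positivity)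
      (fun k hk => integrable_pow_of_le (hX.measurable_scaled j i) (R := Q + 1) (by
        have : (k : ℝ) ≤ p + 2 := by exact_mod_cast (by omega : k ≤ p + 2)
        linarith) hYQ)
      (fun k hk => hX.scaled_moment_succ j i (by omega)) h.bound
      (h.scaled_moment (by omega) (by omega)).1 (h.scaled_moment (by omega) (by omega)).1
  simp only [sumOff_add_scaled] at hexp
  refine hexp.trans ?_
  have h1 := (h.scaled_moment (k := m + 3) (by omega) (by omega)).2
  have h2 := (h.scaled_moment (k := m + 1) (by omega) (by omega)).2
  have e : 1 / (n j : ℝ) = (1 / Real.sqrt (n j)) ^ 2 := by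
    rw [div_pow, Real.sq_sqrt (Nat.cast_nonneg _), one_pow]
  calc _ ≤ (1 / Real.sqrt (n j)) ^ (m + 3) * K / (m + 2).factorial +
        1 / n j * ((1 / Real.sqrt (n j)) ^ (m + 1) * K / (m + 1).factorial) := by gcongr
    _ = _ := by
      rw [e, Nat.factorial_succ (m + 1), Nat.cast_mul]
      have hf : ((m + 1).factorial : ℝ) ≠ 0 := by positivity
      generalize ((m + 1).factorial : ℝ) = f at hf ⊢
      generalize 1 / Real.sqrt (n j) = σ
      push_cast
      have : (m : ℝ) + 1 + 1 ≠ 0 := by positivity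
      have : (m : ℝ) + 2 ≠ 0 := by positivity
      field_simp
      ring

/-- Second-order bound: no moments beyond the matched ones enter. -/
lemma MatchingArray.abs_steinDefect_le_third (hX : MatchingArray μ p r n X) (hp : 2 ≤ p)
    (hQ : 0 ≤ Q)
    (hpQ : (p : ℝ) + 2 ≤ Q + 1) (hXR : ∀ j i, Integrable (fun ω => |X j i ω| ^ (Q + 1)) μ)
    (hv : Tame Q v) (j : Fin d) {Ψ : Fin (n j) → Ω → ℝ} {K : Fin (n j) → ℝ}
    (h : ∀ i, RemainderBound μ X j i v 2 (Ψ i) (K i)) :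
    |steinDefect μ (sumVec X) j v| ≤ ∑ i, (1 / Real.sqrt (n j)) ^ 3 * (3 / 2) * K i := by
  rw [hX.steinDefect_eq_sum hQ hXR hv]
  refine (Finset.abs_sum_le_sum_abs _ _).trans (Finset.sum_le_sum fun i _ => ?_)
  have h1 := hX.summand_expansion hQ hpQ hXR hv j i (m := 0) (by omega) (h i)
  have h2 := hX.scaled_moment_succ j i (k := 1) (by omega)
  simp only [Nat.cast_zero, zero_add, Nat.factorial_one, Nat.cast_one, div_one, mul_one,
    Nat.reduceAdd, Nat.sub_self] at h1 h2
  -- The variance of the scaled summand is `1 / n j`, so the coefficient of the first derivative is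
  -- zero.
  rw [h2, sub_self, zero_mul, sub_zero] at h1
  refine h1.trans (le_of_eq ?_)
  ring

/-- The expansion is carried one order past the matched moments, leaving the coefficient of `∂_j^p
v`. Its mean is then moved from the leave-one-out vector to the full vector, because only at the
full vector can it be compared with the normal mean. The move costs one more derivative and accounts
for the moment of order `p + 1` added to `(p + 2) / (p + 1)`. -/
lemma MatchingArray.abs_steinDefect_le (hX : MatchingArray μ p r n X) (hp : 2 ≤ p)
    (hpe : Even p) (hQ : 0 ≤ Q)
    (hpQ : (p : ℝ) + 2 ≤ Q + 1) (hXR : ∀ j i, Integrable (fun ω => |X j i ω| ^ (Q + 1)) μ)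
    (hv : Tame Q v) (j : Fin d) {Ψ : Fin (n j) → Ω → ℝ} {K : Fin (n j) → ℝ}
    (h : ∀ i, RemainderBound μ X j i v (p + 1) (Ψ i) (K i)) :
    |steinDefect μ (sumVec X) j v| ≤ 1 / (p.factorial : ℝ) * ∑ i,
      ((1 / Real.sqrt (n j)) ^ (p + 1) * |∫ ω, X j i ω ^ (p + 1) ∂μ| *
        |∫ ω, iterPartial (List.replicate p j) v (sumVec X ω) ∂μ| +
      (1 / Real.sqrt (n j)) ^ (p + 2) * (((p : ℝ) + 2) / ((p : ℝ) + 1) +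
        |∫ ω, X j i ω ^ (p + 1) ∂μ|) * K i) := by
  obtain ⟨m, rfl⟩ : ∃ m, p = m + 1 := ⟨p - 1, by omega⟩
  rw [hX.steinDefect_eq_sum hQ hXR hv, Finset.mul_sum]
  refine (Finset.abs_sum_le_sum_abs _ _).trans (Finset.sum_le_sum fun i _ => ?_)
  have hmo : Odd m := by
    rcases Nat.even_or_odd m with h | h
    · exact absurd hpe (by simpa [Nat.even_add_one] using h)
    · exact h
  have h1 := hX.summand_expansion hQ hpQ hXR hv j i le_rfl (h i)
  -- Here `m = p - 1` is odd, so the correction to the unmatched moment vanishes.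
  have e0 : ∫ ω, scaled X j i ω ^ m ∂μ = 0 := by
    simp only [scaled_pow, integral_const_mul]
    rw [hX.moment_odd j i hmo (by omega), mul_zero]
  have e1 : ∫ ω, scaled X j i ω ^ (m + 2) ∂μ =
      (1 / Real.sqrt (n j)) ^ (m + 2) * ∫ ω, X j i ω ^ (m + 2) ∂μ := by
    simp only [scaled_pow, integral_const_mul]
  rw [e0, mul_zero, sub_zero, e1] at h1
  have h2 := abs_integral_comp_add_sub_le hQ (hv.iterPartial (List.replicate (m + 1) j))
    (hX.indepFun_scaled_sumOff j i) (hX.measurable_scaled j i) (hX.measurable_sumOff j i) j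
    (integrable_one_add_norm_of_le (hX.measurable_sumOff j i) (by linarith)
      (hX.integrable_sumOff (by linarith) hXR j i)) (hX.integrable_scaled (by linarith) hXR j i)
    (Ψ := Ψ i) (h i).bound (by simpa using ((h i).scaled_moment (k := 1) (by omega) le_rfl).1)
  have h3 := ((h i).scaled_moment (k := 1) (by omega) le_rfl).2
  simp only [sumOff_add_scaled, pow_one] at h2 h3
  replace h2 := h2.trans h3
  set σ := 1 / Real.sqrt (n j) with hσ
  have hσ0 : 0 ≤ σ := one_div_sqrt_nonneg _
  set E := ∫ ω, X j i ω ^ (m + 2) ∂μ with hE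
  set a := ∫ ω, iterPartial (List.replicate (m + 1) j) v (sumVec X ω) ∂μ
  set a' := ∫ ω, iterPartial (List.replicate (m + 1) j) v (sumOff X j i ω) ∂μ
  set D := ∫ ω, scaled X j i ω * v (sumVec X ω) ∂μ - 1 / n j * ∫ ω, pd j v (sumVec X ω) ∂μ
  have hf : (0 : ℝ) < ((m + 1).factorial : ℝ) := by positivity
  have h4 : |σ ^ (m + 2) * E / (m + 1).factorial * a'| ≤
      σ ^ (m + 2) * |E| / (m + 1).factorial * (|a| + σ * K i) := by
    rw [abs_mul, abs_div, abs_mul, abs_of_nonneg (by positivity : 0 ≤ σ ^ (m + 2)),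
      abs_of_pos hf]
    refine mul_le_mul_of_nonneg_left ?_ (by positivity)
    have := abs_sub_abs_le_abs_sub a' a
    rw [abs_sub_comm] at this
    linarith
  have h5 : |D| ≤ σ ^ (m + 3) * (1 / ((m : ℝ) + 2) + 1) / (m + 1).factorial * K i +
      σ ^ (m + 2) * |E| / (m + 1).factorial * (|a| + σ * K i) := by
    have := abs_sub_abs_le_abs_sub D (σ ^ (m + 2) * E / (m + 1).factorial * a')
    linarith
  refine h5.trans (le_of_eq ?_)
  have : (m : ℝ) + 2 ≠ 0 := by positivity
  have : (m : ℝ) + 1 + 1 ≠ 0 := by positivity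
  push_cast
  field_simp
  ring

end

/-! ### Absolute moments of the normal law -/

lemma integrable_gaussian_abs_rpow {s : ℝ} (hs : 0 ≤ s) :
    Integrable (fun x : ℝ => |x| ^ s) (gaussianReal 0 1) :=
  integrable_abs_rpow_of_le (X := fun x : ℝ => x) measurable_id hs le_rfl
    (integrable_one_add_abs_rpow_gaussian hs)

lemma normalAbsMoment_nonneg (s : ℝ) : 0 ≤ normalAbsMoment s :=
  integral_nonneg fun x => by positivity

lemma normalAbsMoment_eq {s : ℝ} (hs : 0 ≤ s) :
    normalAbsMoment s = 2 ^ ((s + 1) / 2) * (Real.sqrt (2 * Real.pi))⁻¹ *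
      Real.Gamma ((s + 1) / 2) := by
  rw [normalAbsMoment, absMoment, integral_gaussianReal_eq_integral_smul one_ne_zero]
  have e : ∀ x : ℝ, gaussianPDFReal 0 1 x • |x| ^ s =
      (fun y : ℝ => (Real.sqrt (2 * Real.pi))⁻¹ * (y ^ s * Real.exp (-(1 / 2) * y ^ (2 : ℝ)))) |x| := by
    intro x
    simp only [gaussianPDFReal_def, NNReal.coe_one, mul_one, sub_zero, smul_eq_mul,
      Real.rpow_ofNat, sq_abs]
    ring_nf
  simp only [e]
  rw [integral_comp_abs (f := fun y : ℝ => (Real.sqrt (2 * Real.pi))⁻¹ *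
    (y ^ s * Real.exp (-(1 / 2) * y ^ (2 : ℝ)))), integral_const_mul,
    integral_rpow_mul_exp_neg_mul_rpow (by norm_num) (by linarith) (by norm_num)]
  have : ((1 : ℝ) / 2) ^ (-(s + 1) / 2) = 2 ^ ((s + 1) / 2) := by
    rw [one_div, Real.inv_rpow (by norm_num), neg_div, Real.rpow_neg (by norm_num), inv_inv]
  rw [this]
  ring

/-- `log Γ` is convex, hence lies above its tangent at `1 / 2`, where its derivative is `-(γ + 2 log
2)`. -/
lemma log_Gamma_tangent {s : ℝ} (hs : 0 < s) :
    Real.log (Real.sqrt Real.pi) - s / 2 * (Real.eulerMascheroniConstant + 2 * Real.log 2) ≤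
      Real.log (Real.Gamma ((s + 1) / 2)) := by
  have hd := Real.hasDerivAt_Gamma_one_half
  have hne : Real.Gamma (1 / 2) ≠ 0 := (Real.Gamma_pos_of_pos (by norm_num)).ne'
  have hd2 := hd.log hne
  rw [Real.Gamma_one_half_eq] at hd2
  have hx : (1 / 2 : ℝ) < (s + 1) / 2 := by linarith
  have h := Real.convexOn_log_Gamma.le_slope_of_hasDerivAt (x := 1 / 2) (y := (s + 1) / 2)
    (by norm_num [Set.mem_Ioi]) (by simp only [Set.mem_Ioi]; linarith) hx hd2
  rw [slope_def_field, le_div_iff₀ (by linarith)] at h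
  simp only [Function.comp_apply, Real.Gamma_one_half_eq] at h
  have hpi : Real.sqrt Real.pi ≠ 0 := by positivity
  have e : -Real.sqrt Real.pi * (Real.eulerMascheroniConstant + 2 * Real.log 2) /
      Real.sqrt Real.pi * ((s + 1) / 2 - 1 / 2) =
      - (s / 2 * (Real.eulerMascheroniConstant + 2 * Real.log 2)) := by
    field_simp
    ring
  rw [e] at h
  linarith

/-- `E|2Z|^s ≥ 1`, because `E log|2Z| = (log 2 - γ)/2 > 0`. -/
lemma one_le_two_rpow_mul_normalAbsMoment {s : ℝ} (hs : 0 ≤ s) :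
    1 ≤ 2 ^ s * normalAbsMoment s := by
  rcases hs.eq_or_lt with rfl | hs
  · simp [normalAbsMoment, absMoment]
  have hG : 0 < Real.Gamma ((s + 1) / 2) := Real.Gamma_pos_of_pos (by linarith)
  rw [normalAbsMoment_eq hs.le, ← Real.log_nonneg_iff (by positivity),
    Real.log_mul (by positivity) (by positivity), Real.log_mul (by positivity) hG.ne',
    Real.log_mul (by positivity) (by positivity), Real.log_rpow (by norm_num),
    Real.log_rpow (by norm_num), Real.log_inv, Real.sqrt_mul (by norm_num),
    Real.log_mul (by positivity) (by positivity), Real.log_sqrt (by norm_num : (0 : ℝ) ≤ 2)]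
  -- With this tangent bound the logarithm of the right-hand side is at least `s / 2 * (log 2 - γ)`,
  -- and `γ < 2 / 3 < log 2`.
  have h1 := log_Gamma_tangent hs
  have h2 := Real.eulerMascheroniConstant_lt_two_thirds
  have h3 := Real.log_two_gt_d9
  nlinarith

lemma normalAbsMoment_one_le : normalAbsMoment 1 ≤ 1 := by
  have h2 : ∫ x : ℝ, x ^ 2 ∂gaussianReal 0 1 = 1 := by
    simpa using gaussian_moment_succ 1
  have := absMoment_le_absMoment (μ := gaussianReal 0 1) (X := fun x => x) (a := 1) (b := 2)
    (by norm_num) (by norm_num) le_rfl h2 (integrable_gaussian_pow 2)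
    (integrable_gaussian_abs_rpow (by norm_num)) (integrable_gaussian_abs_rpow (by norm_num))
  refine this.trans (le_of_eq ?_)
  simp only [absMoment, Real.rpow_ofNat, sq_abs, h2]

lemma normalAbsMoment_one_rpow_le {s : ℝ} (hs : 1 ≤ s) :
    normalAbsMoment 1 ^ s ≤ normalAbsMoment s := by
  have h1 := integrable_gaussian_abs_rpow (s := 1) (by norm_num)
  have h := (convexOn_abs_rpow hs).map_integral_le (μ := gaussianReal 0 1)
    (f := fun x : ℝ => |x| ^ (1 : ℝ)) (Continuous.continuousOn (by fun_prop (disch := linarith)))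
    isClosed_univ (by simp) h1
    ((integrable_gaussian_abs_rpow (by linarith : 0 ≤ s)).congr
      (Filter.Eventually.of_forall fun x => by simp))
  simp only [Real.rpow_one, abs_abs] at h
  rw [abs_of_nonneg (integral_nonneg fun x => abs_nonneg x)] at h
  simpa [normalAbsMoment, absMoment] using h

/-- Since `E|Z| ≤ 1`, lowering the exponent from `2` to `s + 1` raises the power; Jensen's
inequality does the rest. -/
lemma normalAbsMoment_one_sq_le {s : ℝ} (hs : 0 ≤ s) (hs1 : s ≤ 1) :
    normalAbsMoment 1 ^ 2 ≤ normalAbsMoment (s + 1) := by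
  refine le_trans ?_ (normalAbsMoment_one_rpow_le (by linarith))
  rw [← Real.rpow_natCast]
  rcases (normalAbsMoment_nonneg 1).eq_or_lt with h | h
  · rw [← h, Real.zero_rpow (by norm_num), Real.zero_rpow (by linarith)]
  · exact Real.rpow_le_rpow_of_exponent_ge h normalAbsMoment_one_le (by push_cast; linarith)

/-! ### Integrals of coordinate functions of a standard normal vector -/

section
variable {d : ℕ}

lemma stdNormal_coord {f : ℝ → ℝ} (hf : Measurable f) (m : Fin d)
    (hi : Integrable f (gaussianReal 0 1)) :
    Integrable (fun z : Fin d → ℝ => f (z m)) (stdNormal d) ∧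
      ∫ z, f (z m) ∂stdNormal d = ∫ x, f x ∂gaussianReal 0 1 := by
  have h := measurePreserving_eval (fun _ : Fin d => gaussianReal 0 1) m
  refine ⟨h.integrable_comp_of_integrable hi, ?_⟩
  rw [← h.map_eq, integral_map (measurable_pi_apply m).aemeasurable hf.aestronglyMeasurable]
  rfl

lemma stdNormal_abs_rpow (m : Fin d) {s : ℝ} (hs : 0 ≤ s) :
    Integrable (fun z : Fin d → ℝ => |z m| ^ s) (stdNormal d) ∧
      ∫ z, |z m| ^ s ∂stdNormal d = normalAbsMoment s :=
  stdNormal_coord (f := fun x => |x| ^ s) (by fun_prop) m (integrable_gaussian_abs_rpow hs)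

lemma stdNormal_abs (m : Fin d) :
    Integrable (fun z : Fin d → ℝ => |z m|) (stdNormal d) ∧
      ∫ z, |z m| ∂stdNormal d = normalAbsMoment 1 := by
  simpa using stdNormal_abs_rpow m zero_le_one

lemma abs_mul_rpow_le_young (x y : ℝ) {s : ℝ} (hs : 0 ≤ s) :
    |x| * |y| ^ s ≤ 1 / (s + 1) * |x| ^ (s + 1) + s / (s + 1) * |y| ^ (s + 1) := by
  have h := Real.geom_mean_le_arith_mean2_weighted (w₁ := 1 / (s + 1)) (w₂ := s / (s + 1))
    (p₁ := |x| ^ (s + 1)) (p₂ := |y| ^ (s + 1)) (by positivity) (by positivity) (by positivity)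
    (by positivity) (by field_simp; ring)
  have h1 : s + 1 ≠ 0 := by positivity
  rwa [← Real.rpow_mul (abs_nonneg _), ← Real.rpow_mul (abs_nonneg _), mul_one_div_cancel h1,
    mul_div_cancel₀ _ h1, Real.rpow_one] at h

/-- Young's inequality treats equal and distinct coordinates alike, and its weights sum to one. -/
lemma stdNormal_abs_mul_rpow (k m : Fin d) {s : ℝ} (hs : 0 ≤ s) :
    Integrable (fun z : Fin d → ℝ => |z k| * |z m| ^ s) (stdNormal d) ∧
      ∫ z, |z k| * |z m| ^ s ∂stdNormal d ≤ normalAbsMoment (s + 1) := by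
  obtain ⟨h1, e1⟩ := stdNormal_abs_rpow k (by linarith : 0 ≤ s + 1)
  obtain ⟨h2, e2⟩ := stdNormal_abs_rpow m (by linarith : 0 ≤ s + 1)
  have h3 := (h1.const_mul (1 / (s + 1))).add (h2.const_mul (s / (s + 1)))
  have hi : Integrable (fun z : Fin d → ℝ => |z k| * |z m| ^ s) (stdNormal d) := by
    refine h3.mono' (by fun_prop : Measurable fun z : Fin d → ℝ =>
      |z k| * |z m| ^ s).aestronglyMeasurable (Filter.Eventually.of_forall fun z => ?_)
    rw [Real.norm_of_nonneg (by positivity)]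
    exact abs_mul_rpow_le_young _ _ hs
  refine ⟨hi, (integral_mono hi h3 fun z => abs_mul_rpow_le_young _ _ hs).trans (le_of_eq ?_)⟩
  simp only [Pi.add_apply]
  rw [integral_add (h1.const_mul _) (h2.const_mul _), integral_const_mul, integral_const_mul, e1,
    e2]
  field_simp
  ring

lemma stdNormal_sq (m : Fin d) (a s : ℝ) :
    Integrable (fun z : Fin d → ℝ => (a + s * z m) ^ 2) (stdNormal d) ∧
      ∫ z, (a + s * z m) ^ 2 ∂stdNormal d = a ^ 2 + s ^ 2 := by
  have h1 := integrable_gaussian_pow 1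
  have h2 := integrable_gaussian_pow 2
  have e : ∀ x : ℝ, (a + s * x) ^ 2 = a ^ 2 + 2 * a * s * x ^ 1 + s ^ 2 * x ^ 2 := fun x => by ring
  have hi : Integrable (fun x : ℝ => a ^ 2 + 2 * a * s * x ^ 1 + s ^ 2 * x ^ 2)
      (gaussianReal 0 1) :=
    ((integrable_const _).add (h1.const_mul _)).add (h2.const_mul _)
  have hi' : Integrable (fun x : ℝ => (a + s * x) ^ 2) (gaussianReal 0 1) := by
    simpa only [e] using hi
  obtain ⟨h3, h4⟩ := stdNormal_coord (f := fun x => (a + s * x) ^ 2) (by fun_prop) m hi'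
  refine ⟨h3, h4.trans ?_⟩
  have m1 : ∫ x : ℝ, x ^ 1 ∂gaussianReal 0 1 = 0 := gaussian_moment_odd odd_one
  have m2 : ∫ x : ℝ, x ^ 2 ∂gaussianReal 0 1 = 1 := by simpa using gaussian_moment_succ 1
  simp only [e]
  have i1 : Integrable (fun x : ℝ => a ^ 2 + 2 * a * s * x ^ 1) (gaussianReal 0 1) :=
    (integrable_const _).add (h1.const_mul _)
  rw [integral_add i1 (h2.const_mul _), integral_add (integrable_const _) (h1.const_mul _),
    integral_const_mul, integral_const_mul, m1, m2]
  simp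

end

/-! ### Integrated growth bounds -/

/-- A bound for `E|c (w + u) + s Z|^r`, where `|u| ≤ |y|` and `c² + s² = 1`. -/
def shiftMoment (r c w y : ℝ) : ℝ :=
  if 1 ≤ r then 2 ^ r * (2 ^ r * (|w| ^ r + |y| ^ r) + normalAbsMoment r)
  else |y| ^ r + (1 + r / 2 * c ^ 2 * (w ^ 2 - 1))

/-- A bound for `E|Z Z'||c (c' (w + u) + s' Z₁) + s Z₁'|^r`, where `|u| ≤ |y|`. -/
def doubleShiftMoment (r w y : ℝ) : ℝ :=
  3 ^ r * (normalAbsMoment 1 ^ 2 * (2 ^ r * (|w| ^ r + |y| ^ r)) +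
    2 * (normalAbsMoment 1 * normalAbsMoment (r + 1)))

lemma abs_rpow_le_of_abs_sub_le {r x w y : ℝ} (hr : 0 ≤ r) (h : |x - w| ≤ |y|) :
    |x| ^ r ≤ 2 ^ r * (|w| ^ r + |y| ^ r) := by
  refine le_trans (Real.rpow_le_rpow (abs_nonneg _) ?_ hr)
    (add_rpow_le_two_rpow_mul (abs_nonneg _) (abs_nonneg _) hr)
  have := abs_add_le w (x - w)
  rw [add_sub_cancel] at this
  linarith

section
variable {d : ℕ}

/-- For `r ≥ 1` crude splitting is enough. For `r < 1` subadditivity of the power removes the shift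
with constant one, and the tangent bound keeps the form `c ^ 2 * (w ^ 2 - 1)`, whose mean is
nonpositive once `w` has second moment at most one. -/
lemma shiftMoment_bound {r c s : ℝ} (hr : 0 ≤ r) (hcs : c ^ 2 + s ^ 2 = 1) (m : Fin d)
    {x w y : ℝ} (h : |x - w| ≤ |y|) :
    Integrable (fun z : Fin d → ℝ => |c * x + s * z m| ^ r) (stdNormal d) ∧
      ∫ z, |c * x + s * z m| ^ r ∂stdNormal d ≤ shiftMoment r c w y := by
  have hc : |c| ≤ 1 := by rw [← sq_le_one_iff_abs_le_one]; nlinarith [sq_nonneg s]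
  have hs : |s| ≤ 1 := by rw [← sq_le_one_iff_abs_le_one]; nlinarith [sq_nonneg c]
  have hm : AEStronglyMeasurable (fun z : Fin d → ℝ => |c * x + s * z m| ^ r) (stdNormal d) :=
    (by fun_prop : Measurable fun z : Fin d → ℝ => |c * x + s * z m| ^ r).aestronglyMeasurable
  suffices hφ : ∃ φ : (Fin d → ℝ) → ℝ, Integrable φ (stdNormal d) ∧
      ∫ z, φ z ∂stdNormal d = shiftMoment r c w y ∧ ∀ z, |c * x + s * z m| ^ r ≤ φ z by
    obtain ⟨φ, h1, h2, h3⟩ := hφ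
    have hi : Integrable (fun z : Fin d → ℝ => |c * x + s * z m| ^ r) (stdNormal d) :=
      h1.mono' hm (Filter.Eventually.of_forall fun z => by
        rw [Real.norm_of_nonneg (by positivity)]
        exact h3 z)
    exact ⟨hi, (integral_mono hi h1 h3).trans_eq h2⟩
  by_cases hr1 : 1 ≤ r
  · obtain ⟨hz, ez⟩ := stdNormal_abs_rpow m hr
    refine ⟨fun z => 2 ^ r * (2 ^ r * (|w| ^ r + |y| ^ r) + |z m| ^ r),
      ((integrable_const _).add hz).const_mul _, ?_, fun z => ?_⟩
    · rw [shiftMoment, if_pos hr1, integral_const_mul, integral_add (integrable_const _) hz, ez]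
      simp
    · have h1 : |c * x + s * z m| ≤ |x| + |z m| := by
        refine (abs_add_le _ _).trans (add_le_add ?_ ?_) <;> rw [abs_mul]
        · exact mul_le_of_le_one_left (abs_nonneg _) hc
        · exact mul_le_of_le_one_left (abs_nonneg _) hs
      refine ((Real.rpow_le_rpow (abs_nonneg _) h1 hr).trans
        (add_rpow_le_two_rpow_mul (abs_nonneg _) (abs_nonneg _) hr)).trans ?_
      have := abs_rpow_le_of_abs_sub_le hr h
      dsimp only
      gcongr
  · push Not at hr1
    obtain ⟨hz, ez⟩ := stdNormal_sq m (c * w) s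
    obtain ⟨h1, h2⟩ := integrable_one_add_mul_sub hz (r / 2)
    refine ⟨fun z => |y| ^ r + (1 + r / 2 * ((c * w + s * z m) ^ 2 - 1)),
      (integrable_const _).add h1, ?_, fun z => ?_⟩
    · rw [shiftMoment, if_neg (not_le.2 hr1), integral_add (integrable_const _) h1, h2, ez]
      have : (c * w) ^ 2 + s ^ 2 - 1 = c ^ 2 * (w ^ 2 - 1) := by linear_combination hcs
      rw [this]
      simp only [integral_const, probReal_univ, smul_eq_mul]
      ring
    · have h3 : |c * x + s * z m| ≤ |y| + |c * w + s * z m| := by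
        have e : c * x + s * z m = c * (x - w) + (c * w + s * z m) := by ring
        rw [e]
        refine (abs_add_le _ _).trans (add_le_add_left ?_ _)
        rw [abs_mul]
        exact (mul_le_of_le_one_left (abs_nonneg _) hc).trans h
      refine (Real.rpow_le_rpow (abs_nonneg _) h3 hr).trans
        ((add_rpow_le_of_le_one (abs_nonneg _) (abs_nonneg _) hr hr1.le).trans ?_)
      exact add_le_add_right (abs_rpow_le_one_add hr (by linarith)) _

lemma abs_gsmooth_le_shiftMoment {A B : ℝ} (hB : 0 ≤ B) {r : Fin d → ℝ}
    (hr : ∀ m, 0 ≤ r m) {H : ℝ} (hH : 0 ≤ H) {f : (Fin d → ℝ) → ℝ}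
    (hf : ∀ w, |f w| ≤ H * polyDom A B r w) {c s : ℝ} (hcs : c ^ 2 + s ^ 2 = 1)
    {x w : Fin d → ℝ} {y : ℝ} (h : ∀ m, |x m - w m| ≤ |y|) :
    |gsmooth c s f x| ≤ H * (A + B * ∑ m, shiftMoment (r m) c (w m) y) := by
  have hb := fun m => shiftMoment_bound (d := d) (hr m) hcs m (h m)
  have hi : Integrable (fun z => H * polyDom A B r (c • x + s • z)) (stdNormal d) := by
    refine Integrable.const_mul ((integrable_const _).add (Integrable.const_mul ?_ _)) _
    exact integrable_finsetSum _ fun m _ => (hb m).1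
  have h1 := norm_integral_le_of_norm_le (f := fun z => f (c • x + s • z)) hi
    (Filter.Eventually.of_forall fun z => hf _)
  refine h1.trans ?_
  have hi2 : Integrable (fun z => ∑ m, |(c • x + s • z) m| ^ r m) (stdNormal d) :=
    integrable_finsetSum _ fun m _ => (hb m).1
  simp only [polyDom]
  rw [integral_const_mul, integral_add (integrable_const _) (hi2.const_mul _), integral_const_mul,
    integral_finsetSum]; swap
  · exact fun m _ => (hb m).1
  simp only [integral_const, probReal_univ, one_smul]
  gcongr with m
  exact (hb m).2

/-- The power is split into three parts, each a product of a function of `q.1` and one of `q.2`. The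
two parts mixing a weight with a power are bounded by `stdNormal_abs_mul_rpow`. -/
lemma doubleShiftMoment_bound {r c s c' s' : ℝ} (hr : 0 ≤ r) (hc : |c| ≤ 1) (hs : |s| ≤ 1)
    (hc' : |c'| ≤ 1) (hs' : |s'| ≤ 1) (k m : Fin d) {x w y : ℝ} (h : |x - w| ≤ |y|) :
    Integrable (fun q : (Fin d → ℝ) × (Fin d → ℝ) =>
      |q.1 k| * |q.2 k| * |c * (c' * x + s' * q.1 m) + s * q.2 m| ^ r)
        ((stdNormal d).prod (stdNormal d)) ∧
      ∫ q : (Fin d → ℝ) × (Fin d → ℝ),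
        |q.1 k| * |q.2 k| * |c * (c' * x + s' * q.1 m) + s * q.2 m| ^ r
          ∂(stdNormal d).prod (stdNormal d) ≤ doubleShiftMoment r w y := by
  have hx := abs_rpow_le_of_abs_sub_le hr h
  obtain ⟨i1, e1⟩ := stdNormal_abs k
  obtain ⟨i2, e2⟩ := stdNormal_abs_mul_rpow k m hr
  set b := 2 ^ r * (|w| ^ r + |y| ^ r)
  have j1 := (i1.mul_prod i1).mul_const b
  have j2 := i2.mul_prod i1
  have j3 := i1.mul_prod i2
  have hle : ∀ q : (Fin d → ℝ) × (Fin d → ℝ),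
      |q.1 k| * |q.2 k| * |c * (c' * x + s' * q.1 m) + s * q.2 m| ^ r ≤
      3 ^ r * ((|q.1 k| * |q.2 k| * b + |q.1 k| * |q.1 m| ^ r * |q.2 k|) +
        |q.1 k| * (|q.2 k| * |q.2 m| ^ r)) := by
    intro q
    have h1 : |c * (c' * x + s' * q.1 m) + s * q.2 m| ≤ |x| + |q.1 m| + |q.2 m| := by
      refine (abs_add_le _ _).trans (add_le_add ?_ ?_) <;> rw [abs_mul]
      · refine (mul_le_of_le_one_left (abs_nonneg _) hc).trans
          ((abs_add_le _ _).trans (add_le_add ?_ ?_)) <;> rw [abs_mul]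
        · exact mul_le_of_le_one_left (abs_nonneg _) hc'
        · exact mul_le_of_le_one_left (abs_nonneg _) hs'
      · exact mul_le_of_le_one_left (abs_nonneg _) hs
    have h2 := (Real.rpow_le_rpow (abs_nonneg _) h1 hr).trans
      (add_add_rpow_le_three_rpow_mul (abs_nonneg _) (abs_nonneg _) (abs_nonneg _) hr)
    have h3 : |c * (c' * x + s' * q.1 m) + s * q.2 m| ^ r ≤
        3 ^ r * (b + |q.1 m| ^ r + |q.2 m| ^ r) := h2.trans (by gcongr)
    calc _ ≤ |q.1 k| * |q.2 k| * (3 ^ r * (b + |q.1 m| ^ r + |q.2 m| ^ r)) := by gcongr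
      _ = _ := by ring
  have hb := ((j1.add j2).add j3).const_mul (3 ^ r)
  have hi : Integrable (fun q : (Fin d → ℝ) × (Fin d → ℝ) =>
      |q.1 k| * |q.2 k| * |c * (c' * x + s' * q.1 m) + s * q.2 m| ^ r)
        ((stdNormal d).prod (stdNormal d)) :=
    hb.mono' (by fun_prop : Measurable fun q : (Fin d → ℝ) × (Fin d → ℝ) =>
      |q.1 k| * |q.2 k| * |c * (c' * x + s' * q.1 m) + s * q.2 m| ^ r).aestronglyMeasurable
      (Filter.Eventually.of_forall fun q => by
        rw [Real.norm_of_nonneg (by positivity)]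
        exact hle q)
  refine ⟨hi, (integral_mono hi hb hle).trans ?_⟩
  rw [integral_const_mul, doubleShiftMoment]
  refine mul_le_mul_of_nonneg_left ?_ (by positivity)
  have j12 : Integrable (fun q : (Fin d → ℝ) × (Fin d → ℝ) =>
      |q.1 k| * |q.2 k| * b + |q.1 k| * |q.1 m| ^ r * |q.2 k|)
        ((stdNormal d).prod (stdNormal d)) := j1.add j2
  simp only [Pi.add_apply]
  rw [integral_add j12 j3, integral_add j1 j2, integral_mul_const,
    integral_prod_mul (fun z : Fin d → ℝ => |z k|) (fun z : Fin d → ℝ => |z k|),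
    integral_prod_mul (fun z : Fin d → ℝ => |z k| * |z m| ^ r) (fun z : Fin d → ℝ => |z k|),
    integral_prod_mul (fun z : Fin d → ℝ => |z k|) (fun z : Fin d → ℝ => |z k| * |z m| ^ r), e1]
  have := mul_le_mul_of_nonneg_left e2 (normalAbsMoment_nonneg 1)
  nlinarith
end

/-! ### Moments of the growth bounds along the array -/

section
variable {Ω : Type*} {d p : ℕ} {r : Fin d → ℝ} {n : Fin d → ℕ}
  {X : (j : Fin d) → Fin (n j) → Ω → ℝ} [MeasurableSpace Ω] {μ : Measure Ω}
  [IsProbabilityMeasure μ] {R q : ℝ}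

lemma MatchingArray.abs_moment_le (hX : MatchingArray μ p r n X) (hp : 2 ≤ p) (hq : 2 ≤ q)
    (hqR : q ≤ R) (hXR : ∀ j i, Integrable (fun ω => |X j i ω| ^ R) μ) (j : Fin d)
    (i : Fin (n j)) {s : ℝ} (hs : 0 ≤ s) (hsq : s ≤ q) :
    Integrable (fun ω => |X j i ω| ^ s) μ ∧ absMoment μ (X j i) s ≤ absMoment μ (X j i) q := by
  have h := integrable_one_add_abs_rpow (hX.meas j i) (by linarith : 0 ≤ R) (hXR j i)
  have hI : ∀ t, 0 ≤ t → t ≤ R → Integrable (fun ω => |X j i ω| ^ t) μ := fun t h0 h1 =>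
    integrable_abs_rpow_of_le (hX.meas j i) h0 h1 h
  have h2 : Integrable (fun ω => X j i ω ^ 2) μ :=
    integrable_pow_of_le (hX.meas j i) (by push_cast; linarith) h
  exact ⟨hI s hs (hsq.trans hqR), absMoment_le_absMoment hs hsq hq (hX.moment_two hp j i) h2
    (hI q (by linarith) hqR) (hI s hs (hsq.trans hqR))⟩

lemma MatchingArray.pow_moment_le (hX : MatchingArray μ p r n X) (hp : 2 ≤ p) (hq : 2 ≤ q)
    (hqR : q ≤ R) (hXR : ∀ j i, Integrable (fun ω => |X j i ω| ^ R) μ) (j : Fin d)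
    (i : Fin (n j)) {k : ℕ} (hk : (k : ℝ) ≤ q) :
    Integrable (fun ω => |X j i ω| ^ k) μ ∧
      ∫ ω, |X j i ω| ^ k ∂μ ≤ absMoment μ (X j i) q := by
  have := hX.abs_moment_le hp hq hqR hXR j i (Nat.cast_nonneg k) hk
  simpa only [absMoment, Real.rpow_natCast] using this

lemma MatchingArray.pow_mul_scaled_rpow_le (hX : MatchingArray μ p r n X) (hp : 2 ≤ p)
    (hq : 2 ≤ q) {s : ℝ} (hs : 0 ≤ s) (hqR : s + q ≤ R)
    (hXR : ∀ j i, Integrable (fun ω => |X j i ω| ^ R) μ) (j : Fin d)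
    (i : Fin (n j)) {k : ℕ} (hk : (k : ℝ) ≤ q) :
    Integrable (fun ω => |X j i ω| ^ k * |scaled X j i ω| ^ s) μ ∧
      ∫ ω, |X j i ω| ^ k * |scaled X j i ω| ^ s ∂μ ≤
        1 / (n j : ℝ) ^ (s / 2) * absMoment μ (X j i) (s + q) := by
  have e : ∀ ω, |X j i ω| ^ k * |scaled X j i ω| ^ s =
      1 / (n j : ℝ) ^ (s / 2) * |X j i ω| ^ (s + k) := by
    intro ω
    rw [scaled, abs_mul, Real.mul_rpow (abs_nonneg _) (abs_nonneg _),
      Real.rpow_add_of_nonneg (abs_nonneg _) hs (Nat.cast_nonneg k), Real.rpow_natCast,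
      abs_of_nonneg (one_div_sqrt_nonneg _), Real.div_rpow zero_le_one (Real.sqrt_nonneg _),
      Real.one_rpow, Real.sqrt_eq_rpow, ← Real.rpow_mul (Nat.cast_nonneg _)]
    ring_nf
  simp only [e]
  obtain ⟨h1, h2⟩ := hX.abs_moment_le hp (by linarith : 2 ≤ s + q) hqR hXR j i
    (by positivity : 0 ≤ s + k) (by linarith)
  refine ⟨h1.const_mul _, ?_⟩
  rw [integral_const_mul]
  exact mul_le_mul_of_nonneg_left h2 (by positivity)

lemma MatchingArray.pow_mul_sumOff (hX : MatchingArray μ p r n X) (j : Fin d)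
    (i : Fin (n j)) {k : ℕ} (hk : Integrable (fun ω => |X j i ω| ^ k) μ)
    {g : (Fin d → ℝ) → ℝ} (hg : Measurable g) (hgi : Integrable (fun ω => g (sumOff X j i ω)) μ) :
    Integrable (fun ω => |X j i ω| ^ k * g (sumOff X j i ω)) μ ∧
      ∫ ω, |X j i ω| ^ k * g (sumOff X j i ω) ∂μ =
        (∫ ω, |X j i ω| ^ k ∂μ) * ∫ ω, g (sumOff X j i ω) ∂μ := by
  have hn : 0 < Real.sqrt (n j) := Real.sqrt_pos.2 (by exact_mod_cast hX.pos j)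
  have e : ∀ ω, |Real.sqrt (n j) * scaled X j i ω| ^ k = |X j i ω| ^ k := fun ω => by
    rw [scaled, ← mul_assoc, mul_one_div_cancel hn.ne', one_mul]
  have := (hX.indepFun_scaled_sumOff j i).comp_mul (hX.measurable_scaled j i)
    (hX.measurable_sumOff j i) (f := fun y => |Real.sqrt (n j) * y| ^ k) (g := g) (by fun_prop) hg
    (by simpa only [e] using hk) hgi
  simpa only [e] using this

lemma MatchingArray.integrable_sumOff_coord (hX : MatchingArray μ p r n X)
    (hR : 0 < R) (hXR : ∀ j i, Integrable (fun ω => |X j i ω| ^ R) μ) (j : Fin d)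
    (i : Fin (n j)) (m : Fin d) {s : ℝ} (hs : 0 ≤ s) (hsR : s ≤ R) :
    Integrable (fun ω => |sumOff X j i ω m| ^ s) μ := by
  refine integrable_comp_of_growth (f := fun w : Fin d → ℝ => |w m| ^ s) (C := 1)
    (hX.measurable_sumOff j i) (hX.integrable_sumOff hR hXR j i) (by fun_prop) fun w => ?_
  rw [one_mul, abs_of_nonneg (by positivity)]
  have := norm_le_pi_norm w m
  rw [Real.norm_eq_abs] at this
  exact (Real.rpow_le_rpow (abs_nonneg _) (by linarith) hs).trans
    (Real.rpow_le_rpow_of_exponent_le (by linarith [norm_nonneg w]) hsR)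

/-- For `s ≥ 1` the leave-one-out moment is compared with that of the full sum by convexity. For `s
< 1` the mean of the shifted power is at most one, and this constant is absorbed in the Gaussian
term by `one_le_two_rpow_mul_normalAbsMoment`. -/
lemma MatchingArray.pow_mul_shiftMoment_le (hX : MatchingArray μ p r n X) (hp : 2 ≤ p)
    (hq : 2 ≤ q) {s : ℝ} (hs : 0 ≤ s) (hqR : s + q ≤ R)
    (hXR : ∀ j i, Integrable (fun ω => |X j i ω| ^ R) μ) (j : Fin d)
    (i : Fin (n j)) (m : Fin d) {k : ℕ} (hk : (k : ℝ) ≤ q) (c : ℝ) :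
    Integrable (fun ω => |X j i ω| ^ k * shiftMoment s c (sumOff X j i ω m) (scaled X j i ω)) μ ∧
      ∫ ω, |X j i ω| ^ k * shiftMoment s c (sumOff X j i ω m) (scaled X j i ω) ∂μ ≤
        (2 : ℝ) ^ s *
      ((2 : ℝ) ^ s * absMoment μ (X j i) q * absMoment μ (fun ω => sumVec X ω m) s
        + (2 : ℝ) ^ s / (n j : ℝ) ^ (s / 2) * absMoment μ (X j i) (s + q)
        + normalAbsMoment s * absMoment μ (X j i) q) := by
  obtain ⟨h1, h1'⟩ := hX.pow_moment_le hp hq (by linarith) hXR j i hk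
  obtain ⟨h2, h2'⟩ := hX.pow_mul_scaled_rpow_le hp hq hs hqR hXR j i hk
  have hM := normalAbsMoment_nonneg s
  have ha : 0 ≤ absMoment μ (X j i) q := absMoment_nonneg q
  have hb : 0 ≤ absMoment μ (X j i) (s + q) := absMoment_nonneg _
  have hw : 0 ≤ absMoment μ (fun ω => sumVec X ω m) s := absMoment_nonneg _
  have h2s : (1 : ℝ) ≤ 2 ^ s := Real.one_le_rpow (by norm_num) hs
  have hnn : 0 ≤ 1 / (n j : ℝ) ^ (s / 2) := by positivity
  have h0 : 0 ≤ ∫ ω, |X j i ω| ^ k ∂μ := integral_nonneg fun ω => by positivity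
  by_cases hs1 : 1 ≤ s
  · simp only [shiftMoment, if_pos hs1]
    have hW := hX.absMoment_sumOff_le hp (by linarith) hXR j i m hs1 (by linarith)
    obtain ⟨h3, h3'⟩ := hX.pow_mul_sumOff j i h1 (g := fun w => |w m| ^ s) (by fun_prop)
      (hX.integrable_sumOff_coord (by linarith) hXR j i m hs (by linarith))
    have e : ∀ ω, |X j i ω| ^ k * (2 ^ s * (2 ^ s * (|sumOff X j i ω m| ^ s +
        |scaled X j i ω| ^ s) + normalAbsMoment s)) =
        2 ^ s * (2 ^ s * (|X j i ω| ^ k * |sumOff X j i ω m| ^ s +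
          |X j i ω| ^ k * |scaled X j i ω| ^ s) + |X j i ω| ^ k * normalAbsMoment s) :=
      fun ω => by ring
    simp only [e]
    have i1 := (h3.add h2).const_mul (2 ^ s)
    refine ⟨(i1.add (h1.mul_const _)).const_mul _, ?_⟩
    simp only [Pi.add_apply] at i1
    rw [integral_const_mul, integral_add i1 (h1.mul_const _), integral_const_mul,
      integral_add h3 h2, h3', integral_mul_const]
    refine mul_le_mul_of_nonneg_left ?_ (by positivity)
    have h4 : (∫ ω, |X j i ω| ^ k ∂μ) * ∫ ω, |sumOff X j i ω m| ^ s ∂μ ≤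
        absMoment μ (X j i) q * absMoment μ (fun ω => sumVec X ω m) s :=
      mul_le_mul h1' hW (integral_nonneg fun ω => by positivity) ha
    calc _ ≤ 2 ^ s * (absMoment μ (X j i) q * absMoment μ (fun ω => sumVec X ω m) s +
          1 / (n j : ℝ) ^ (s / 2) * absMoment μ (X j i) (s + q)) +
          absMoment μ (X j i) q * normalAbsMoment s := by gcongr
      _ = _ := by ring
  · simp only [shiftMoment, if_neg hs1]
    have hsq : Integrable (fun ω => sumOff X j i ω m ^ 2) μ := by
      have := hX.integrable_sumOff_coord (by linarith) hXR j i m (s := 2) (by norm_num)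
        (by linarith)
      simpa only [Real.rpow_ofNat, sq_abs] using this
    have hW := hX.second_moment_sumOff_le hp (by linarith) hXR j i m
    obtain ⟨h5, h5'⟩ := integrable_one_add_mul_sub hsq (s / 2 * c ^ 2)
    obtain ⟨h3, h3'⟩ := hX.pow_mul_sumOff j i h1
      (g := fun w => 1 + s / 2 * c ^ 2 * (w m ^ 2 - 1)) (by fun_prop) h5
    simp only [mul_add] at h3 h3' ⊢
    simp only [← mul_add] at h3 h3' ⊢
    have e : ∀ ω, |X j i ω| ^ k * (|scaled X j i ω| ^ s +
        (1 + s / 2 * c ^ 2 * (sumOff X j i ω m ^ 2 - 1))) =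
        |X j i ω| ^ k * |scaled X j i ω| ^ s +
        |X j i ω| ^ k * (1 + s / 2 * c ^ 2 * (sumOff X j i ω m ^ 2 - 1)) := fun ω => by ring
    simp only [e]
    refine ⟨h2.add h3, ?_⟩
    rw [integral_add h2 h3, h3', h5']
    have h6 : 1 + s / 2 * c ^ 2 * (∫ ω, sumOff X j i ω m ^ 2 ∂μ - 1) ≤ 1 := by
      have : 0 ≤ s / 2 * c ^ 2 := by positivity
      nlinarith
    have h7 := mul_le_mul_of_nonneg_left h6 h0
    have h8 := mul_le_mul_of_nonneg_right (one_le_two_rpow_mul_normalAbsMoment hs) ha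
    have h9 : 1 ≤ (2 : ℝ) ^ s * 2 ^ s := by nlinarith
    have h10 := mul_le_mul_of_nonneg_right h9 (mul_nonneg hnn hb)
    have h11 : 0 ≤ 2 ^ s * (2 ^ s * absMoment μ (X j i) q *
      absMoment μ (fun ω => sumVec X ω m) s) := by positivity
    calc _ ≤ 1 / (n j : ℝ) ^ (s / 2) * absMoment μ (X j i) (s + q) + absMoment μ (X j i) q := by
          linarith
      _ ≤ _ := by
          have e2 : (2 : ℝ) ^ s / (n j : ℝ) ^ (s / 2) = 2 ^ s * (1 / (n j : ℝ) ^ (s / 2)) := by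
            ring
          rw [e2]
          linarith

/-- The outer factor `2` makes room for exponents below one. There `2 ^ s * E|W'|^s ≤ 2` and
`(E|Z|)^2 ≤ E|Z|^{s+1}`, so the leave-one-out part costs two further Gaussian moments, on top of the
two from the mixed terms. -/
lemma MatchingArray.pow_mul_doubleShiftMoment_le (hX : MatchingArray μ p r n X) (hp : 2 ≤ p)
    (hq : 2 ≤ q) {s : ℝ} (hs : 0 ≤ s) (hqR : s + q ≤ R)
    (hXR : ∀ j i, Integrable (fun ω => |X j i ω| ^ R) μ) (j : Fin d)
    (i : Fin (n j)) (m : Fin d) {k : ℕ} (hk : (k : ℝ) ≤ q) :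
    Integrable (fun ω => |X j i ω| ^ k *
        doubleShiftMoment s (sumOff X j i ω m) (scaled X j i ω)) μ ∧
      ∫ ω, |X j i ω| ^ k * doubleShiftMoment s (sumOff X j i ω m) (scaled X j i ω) ∂μ ≤
        2 * ((3 : ℝ) ^ s *
      ((2 : ℝ) ^ s * absMoment μ (X j i) q * absMoment μ (fun ω => sumVec X ω m) s
        + (2 : ℝ) ^ s / (n j : ℝ) ^ (s / 2) * absMoment μ (X j i) (s + q)
        + 2 * normalAbsMoment (s + 1) * absMoment μ (X j i) q)) := by
  obtain ⟨h1, h1'⟩ := hX.pow_moment_le hp hq (by linarith) hXR j i hk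
  obtain ⟨h2, h2'⟩ := hX.pow_mul_scaled_rpow_le hp hq hs hqR hXR j i hk
  have hM := normalAbsMoment_nonneg (s + 1)
  have he0 := normalAbsMoment_nonneg 1
  have he1 := normalAbsMoment_one_le
  have ha : 0 ≤ absMoment μ (X j i) q := absMoment_nonneg q
  have hb : 0 ≤ absMoment μ (X j i) (s + q) := absMoment_nonneg _
  have hw : 0 ≤ absMoment μ (fun ω => sumVec X ω m) s := absMoment_nonneg _
  have h2s : (1 : ℝ) ≤ 2 ^ s := Real.one_le_rpow (by norm_num) hs
  have hnn : 0 ≤ 1 / (n j : ℝ) ^ (s / 2) := by positivity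
  have hsi := hX.integrable_sumOff_coord (by linarith) hXR j i m hs (by linarith)
  obtain ⟨h3, h3'⟩ := hX.pow_mul_sumOff j i h1 (g := fun w => |w m| ^ s) (by fun_prop) hsi
  have e : ∀ ω, |X j i ω| ^ k * doubleShiftMoment s (sumOff X j i ω m) (scaled X j i ω) =
      3 ^ s * (normalAbsMoment 1 ^ 2 * (2 ^ s * (|X j i ω| ^ k * |sumOff X j i ω m| ^ s +
          |X j i ω| ^ k * |scaled X j i ω| ^ s)) + |X j i ω| ^ k *
          (2 * (normalAbsMoment 1 * normalAbsMoment (s + 1)))) :=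
    fun ω => by rw [doubleShiftMoment]; ring
  simp only [e]
  have i1 := ((h3.add h2).const_mul (2 ^ s)).const_mul (normalAbsMoment 1 ^ 2)
  refine ⟨(i1.add (h1.mul_const _)).const_mul _, ?_⟩
  simp only [Pi.add_apply] at i1
  rw [integral_const_mul, integral_add i1 (h1.mul_const _), integral_const_mul,
    integral_const_mul, integral_add h3 h2, h3', integral_mul_const, mul_left_comm (2 : ℝ) (3 ^ s)]
  refine mul_le_mul_of_nonneg_left ?_ (by positivity)
  have hsq1 : normalAbsMoment 1 ^ 2 ≤ 1 := pow_le_one₀ he0 he1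
  have hW : normalAbsMoment 1 ^ 2 * (2 ^ s * ∫ ω, |sumOff X j i ω m| ^ s ∂μ) ≤
      2 * (2 ^ s * absMoment μ (fun ω => sumVec X ω m) s) + 2 * normalAbsMoment (s + 1) := by
    by_cases hs1 : 1 ≤ s
    · have h4 := hX.absMoment_sumOff_le hp (by linarith) hXR j i m hs1 (by linarith)
      have h5 : 0 ≤ ∫ ω, |sumOff X j i ω m| ^ s ∂μ := integral_nonneg fun ω => by positivity
      have h6 : 2 ^ s * ∫ ω, |sumOff X j i ω m| ^ s ∂μ ≤
          2 ^ s * absMoment μ (fun ω => sumVec X ω m) s :=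
        mul_le_mul_of_nonneg_left h4 (by positivity)
      have h7 := mul_le_of_le_one_left (by positivity : 0 ≤ 2 ^ s *
        ∫ ω, |sumOff X j i ω m| ^ s ∂μ) hsq1
      have h8 : 0 ≤ 2 ^ s * absMoment μ (fun ω => sumVec X ω m) s := by positivity
      linarith
    · push Not at hs1
      have hsq : Integrable (fun ω => sumOff X j i ω m ^ 2) μ := by
        have := hX.integrable_sumOff_coord (by linarith) hXR j i m (s := 2) (by norm_num)
          (by linarith)
        simpa only [Real.rpow_ofNat, sq_abs] using this
      have hW := hX.second_moment_sumOff_le hp (by linarith) hXR j i m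
      obtain ⟨h5, h5'⟩ := integrable_one_add_mul_sub hsq (s / 2)
      have h6 : ∫ ω, |sumOff X j i ω m| ^ s ∂μ ≤ 1 := by
        refine (integral_mono hsi h5 fun ω => abs_rpow_le_one_add hs (by linarith)).trans ?_
        rw [h5']
        nlinarith
      have h7 : (2 : ℝ) ^ s ≤ 2 := by
        simpa using Real.rpow_le_rpow_of_exponent_le (x := 2) (by norm_num) hs1.le
      have h8 := normalAbsMoment_one_sq_le hs hs1.le
      have h9 : 2 ^ s * ∫ ω, |sumOff X j i ω m| ^ s ∂μ ≤ 2 * 1 :=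
        mul_le_mul h7 h6 (integral_nonneg fun ω => by positivity) (by norm_num)
      have h10 := mul_le_mul h8 h9 (by positivity) hM
      have h11 : 0 ≤ 2 ^ s * absMoment μ (fun ω => sumVec X ω m) s := by positivity
      linarith
  set a := absMoment μ (X j i) q
  set ak := ∫ ω, |X j i ω| ^ k ∂μ
  have hak : 0 ≤ ak := integral_nonneg fun ω => by positivity
  set I := ∫ ω, |sumOff X j i ω m| ^ s ∂μ
  have hI0 : 0 ≤ I := integral_nonneg fun ω => by positivity
  have k1 : ak * (normalAbsMoment 1 ^ 2 * (2 ^ s * I)) ≤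
      a * (2 * (2 ^ s * absMoment μ (fun ω => sumVec X ω m) s) + 2 * normalAbsMoment (s + 1)) :=
    mul_le_mul h1' hW (by positivity) ha
  have k2 : ak * (2 * (normalAbsMoment 1 * normalAbsMoment (s + 1))) ≤
      a * (2 * normalAbsMoment (s + 1)) := by
    refine mul_le_mul h1' ?_ (by positivity) ha
    have := mul_le_of_le_one_left hM he1
    linarith
  have k3 : normalAbsMoment 1 ^ 2 * (2 ^ s * ∫ ω, |X j i ω| ^ k * |scaled X j i ω| ^ s ∂μ) ≤
      1 * (2 ^ s * (1 / (n j : ℝ) ^ (s / 2) * absMoment μ (X j i) (s + q))) := by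
    gcongr
  have k4 : 0 ≤ 2 ^ s * (1 / (n j : ℝ) ^ (s / 2) * absMoment μ (X j i) (s + q)) := by positivity
  have e2 : (2 : ℝ) ^ s / (n j : ℝ) ^ (s / 2) = 2 ^ s * (1 / (n j : ℝ) ^ (s / 2)) := by ring
  rw [e2]
  linarith

lemma MatchingArray.pow_mul_dom_le (hX : MatchingArray μ p r n X) (hp : 2 ≤ p) (hq : 2 ≤ q)
    (hqR : q ≤ R) (hXR : ∀ j i, Integrable (fun ω => |X j i ω| ^ R) μ) (j : Fin d)
    (i : Fin (n j)) {k : ℕ} (hk : (k : ℝ) ≤ q) {A B c : ℝ} (hA : 0 ≤ A) (hB : 0 ≤ B) (hc : 0 ≤ c)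
    {Φ : Fin d → Ω → ℝ} {T : Fin d → ℝ}
    (h : ∀ m, Integrable (fun ω => |X j i ω| ^ k * Φ m ω) μ ∧
      ∫ ω, |X j i ω| ^ k * Φ m ω ∂μ ≤ T m) :
    Integrable (fun ω => |X j i ω| ^ k * (c * (A + B * ∑ m, Φ m ω))) μ ∧
      ∫ ω, |X j i ω| ^ k * (c * (A + B * ∑ m, Φ m ω)) ∂μ ≤
        c * (A * absMoment μ (X j i) q + B * ∑ m, T m) := by
  obtain ⟨h1, h1'⟩ := hX.pow_moment_le hp hq hqR hXR j i hk
  have e : ∀ ω, |X j i ω| ^ k * (c * (A + B * ∑ m, Φ m ω)) =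
      c * (A * |X j i ω| ^ k + B * ∑ m, |X j i ω| ^ k * Φ m ω) := by
    intro ω
    rw [← Finset.mul_sum]
    ring
  simp only [e]
  have h2 : Integrable (fun ω => B * ∑ m, |X j i ω| ^ k * Φ m ω) μ :=
    (integrable_finsetSum _ fun m _ => (h m).1).const_mul B
  refine ⟨((h1.const_mul A).add h2).const_mul c, ?_⟩
  rw [integral_const_mul, integral_add (h1.const_mul A) h2, integral_const_mul,
    integral_const_mul, integral_finsetSum]; swap
  · exact fun m _ => (h m).1
  gcongr with m
  exact (h m).2

end

/-! ### The bound for smooth functions -/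

section
variable {d : ℕ} {Q : ℝ} {F χ : (Fin d → ℝ) → ℝ}

/-- Each partial derivative reverses parity, so derivatives of odd order of an even function are
odd: this is the only use made of evenness. -/
lemma iterPartial_neg (hF : ∀ w, F (-w) = F w) (l : List (Fin d)) (w : Fin d → ℝ) :
    iterPartial l F (-w) = (-1) ^ l.length * iterPartial l F w := by
  induction l generalizing w with
  | nil => simpa [iterPartial] using hF w
  | cons i l ih =>
    simp only [iterPartial, lineDeriv]
    have e : ∀ t : ℝ, iterPartial l F (-w + t • Pi.single i 1) =
        (-1) ^ l.length * iterPartial l F (w + (-t) • Pi.single i 1) := fun t => by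
      rw [← ih]
      congr 1
      simp [add_comm]
    have h := deriv_comp_neg (fun t : ℝ => iterPartial l F (w + t • Pi.single i 1)) 0
    rw [neg_zero] at h
    simp only [e]
    rw [deriv_const_mul_field, h, List.length_cons]
    ring

lemma gsmooth_odd {c s : ℝ} (hχ : ∀ w, χ (-w) = -χ w) (w : Fin d → ℝ) :
    gsmooth c s χ (-w) = -gsmooth c s χ w := by
  have hmp : MeasurePreserving (fun z : Fin d → ℝ => -z) (stdNormal d) (stdNormal d) := by
    refine measurePreserving_pi (fun _ => gaussianReal 0 1) (fun _ => gaussianReal 0 1)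
      fun _ => ⟨measurable_neg, ?_⟩
    have := gaussianReal_map_neg (μ := 0) (v := 1)
    rwa [neg_zero] at this
  have h := hmp.integral_comp (MeasurableEquiv.neg (Fin d → ℝ)).measurableEmbedding
    (fun z => χ (c • -w + s • z))
  rw [gsmooth, ← h, gsmooth, ← integral_neg]
  refine integral_congr_ae (Filter.Eventually.of_forall fun z => ?_)
  simp only [smul_neg, ← hχ]
  congr 1
  abel

lemma abs_integral_integral_le {A B : ℝ} (hA : 0 ≤ A) (hB : 0 ≤ B) {r : Fin d → ℝ}
    (hr : ∀ m, 0 ≤ r m) {H : ℝ} (hH : 0 ≤ H) {f : (Fin d → ℝ) → ℝ}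
    (hf : ∀ w, |f w| ≤ H * polyDom A B r w) {c s c' s' : ℝ} (hc : |c| ≤ 1) (hs : |s| ≤ 1)
    (hc' : |c'| ≤ 1) (hs' : |s'| ≤ 1) (k : Fin d) {x w : Fin d → ℝ} {y : ℝ}
    (h : ∀ m, |x m - w m| ≤ |y|) :
    |∫ z, z k * ∫ z', z' k * f (c • (c' • x + s' • z) + s • z') ∂stdNormal d ∂stdNormal d| ≤
      H * (A + B * ∑ m, doubleShiftMoment (r m) (w m) y) := by
  have hb := fun m => doubleShiftMoment_bound (d := d) (hr m) hc hs hc' hs' k m (h m)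
  obtain ⟨i1, e1⟩ := stdNormal_abs k
  set b : (Fin d → ℝ) × (Fin d → ℝ) → ℝ := fun q => H * (A * (|q.1 k| * |q.2 k|) + B * ∑ m,
    |q.1 k| * |q.2 k| * |c * (c' * x m + s' * q.1 m) + s * q.2 m| ^ r m) with hbdef
  have j1 : Integrable (fun q : (Fin d → ℝ) × (Fin d → ℝ) => A * (|q.1 k| * |q.2 k|))
    ((stdNormal d).prod (stdNormal d)) := (i1.mul_prod i1).const_mul A
  have j2 : Integrable (fun q : (Fin d → ℝ) × (Fin d → ℝ) => B * ∑ m,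
      |q.1 k| * |q.2 k| * |c * (c' * x m + s' * q.1 m) + s * q.2 m| ^ r m)
      ((stdNormal d).prod (stdNormal d)) :=
    (integrable_finsetSum _ fun m _ => (hb m).1).const_mul B
  have hbi : Integrable b ((stdNormal d).prod (stdNormal d)) := (j1.add j2).const_mul H
  have h1 : ∀ᵐ z ∂stdNormal d,
      ‖z k * ∫ z', z' k * f (c • (c' • x + s' • z) + s • z') ∂stdNormal d‖ ≤
        ∫ z', b (z, z') ∂stdNormal d := by
    filter_upwards [hbi.prod_right_ae] with z hz
    rw [← integral_const_mul]
    refine norm_integral_le_of_norm_le hz (Filter.Eventually.of_forall fun z' => ?_)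
    rw [norm_mul, norm_mul, Real.norm_eq_abs, Real.norm_eq_abs, Real.norm_eq_abs]
    calc _ ≤ |z k| * (|z' k| * (H * polyDom A B r (c • (c' • x + s' • z) + s • z'))) := by
          gcongr
          exact hf _
      _ = _ := by
          simp only [hbdef, polyDom, ← Finset.mul_sum, Pi.add_apply, Pi.smul_apply, smul_eq_mul]
          ring
  rw [← Real.norm_eq_abs]
  refine (norm_integral_le_of_norm_le hbi.integral_prod_left h1).trans ?_
  rw [integral_integral (f := fun z z' => b (z, z')) hbi]
  simp only [hbdef]
  rw [integral_const_mul, integral_add j1 j2, integral_const_mul, integral_const_mul,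
    integral_prod_mul (fun z : Fin d → ℝ => |z k|) (fun z : Fin d → ℝ => |z k|), e1,
    integral_finsetSum]; swap
  · exact fun m _ => (hb m).1
  have h2 : A * (normalAbsMoment 1 * normalAbsMoment 1) ≤ A := by
    refine mul_le_of_le_one_right hA ?_
    have := normalAbsMoment_nonneg 1
    have := normalAbsMoment_one_le
    nlinarith
  gcongr with m
  exact (hb m).2

/-- Two integrations by parts trade two derivatives for the factor `1 / (s s')`. -/
lemma abs_iterPartial_gsmooth_gsmooth_le (hQ : 0 ≤ Q) (hχ : Tame Q χ) {A B : ℝ} (hA : 0 ≤ A)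
    (hB : 0 ≤ B) {r : Fin d → ℝ}
    (hr : ∀ m, 0 ≤ r m) {H : ℝ} (hH : 0 ≤ H) (k : Fin d)
    (hf : ∀ w, |pd k χ w| ≤ H * polyDom A B r w) {c s c' s' : ℝ} (hc : |c| ≤ 1) (hs : |s| ≤ 1)
    (hc' : |c'| ≤ 1) (hs' : |s'| ≤ 1) (hs0 : 0 < s) (hs0' : 0 < s') {x w : Fin d → ℝ} {y : ℝ}
    (h : ∀ m, |x m - w m| ≤ |y|) :
    |iterPartial (List.replicate 2 k) (gsmooth c' s' (pd k (gsmooth c s χ))) x| ≤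
      c ^ 2 * c' ^ 2 / (s * s') * H * (A + B * ∑ m, doubleShiftMoment (r m) (w m) y) := by
  have h1 := iterPartial_gsmooth hQ ((hχ.gsmooth hQ hc hs).pd k) hc' hs' (List.replicate 2 k)
  have e3 : iterPartial (List.replicate 2 k) (pd k (gsmooth c s χ)) =
      pd k (iterPartial (List.replicate 2 k) (gsmooth c s χ)) := rfl
  have h2 := iterPartial_gsmooth hQ hχ hc hs (List.replicate 2 k)
  -- The outer integration by parts is in `z`, the inner one (`h4`) in `z'`; only one derivative of
  -- `χ` is left.
  have h3 := fun u => integral_coord_mul_shift hQ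
    ((hχ.gsmooth hQ hc hs).iterPartial (List.replicate 2 k)) hc' hs' k u
  have h4 := fun u => integral_coord_mul_shift hQ (hχ.pd k) hc hs k u
  have e4 : iterPartial (List.replicate 2 k) χ = pd k (pd k χ) := rfl
  have key := abs_integral_integral_le hA hB hr hH hf hc hs hc' hs' k h
  -- The formula divides by `c ^ 2`, so `c = 0` is set apart; in that case the derivative to be
  -- bounded is zero, since it carries the factor `c ^ 2`.
  have e5 : ∫ z, z k * ∫ z', z' k * pd k χ (c • (c' • x + s' • z) + s • z')
      ∂stdNormal d ∂stdNormal d = s / c ^ 2 * (c ^ 2 * ∫ z, z k *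
        gsmooth c s (pd k (pd k χ)) (c' • x + s' • z) ∂stdNormal d) ∨ c = 0 := by
    by_cases hc0 : c = 0
    · exact Or.inr hc0
    left
    rw [← mul_assoc, div_mul_cancel₀ _ (pow_ne_zero 2 hc0), ← integral_const_mul]
    refine integral_congr_ae (Filter.Eventually.of_forall fun z => ?_)
    simp only [h4]
    ring
  have h5 := h3 x
  rw [h2, e4] at h5
  simp only [List.length_replicate] at h5
  have e6 : ∫ z, z k * (c ^ 2 * gsmooth c s (pd k (pd k χ)) (c' • x + s' • z)) ∂stdNormal d =
      c ^ 2 * ∫ z, z k * gsmooth c s (pd k (pd k χ)) (c' • x + s' • z) ∂stdNormal d := by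
    rw [← integral_const_mul]
    refine integral_congr_ae (Filter.Eventually.of_forall fun z => ?_)
    ring
  rw [h1, e3, h2, e4]
  simp only [List.length_replicate]
  set I := ∫ z, z k * gsmooth c s (pd k (pd k χ)) (c' • x + s' • z) ∂stdNormal d
  set D := gsmooth c' s' (pd k fun w => c ^ 2 * gsmooth c s (pd k (pd k χ)) w) x
  rw [e6] at h5
  set P := A + B * ∑ m, doubleShiftMoment (r m) (w m) y
  have hD : D = c ^ 2 * I / s' := by
    rw [h5]
    field_simp
  rcases e5 with e5 | e5
  · have hI : |s * I| ≤ H * P ∨ c = 0 := by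
      by_cases hc0 : c = 0
      · exact Or.inr hc0
      left
      rw [e5, ← mul_assoc, div_mul_cancel₀ _ (pow_ne_zero 2 hc0)] at key
      exact key
    rcases hI with hI | hI
    · have : c' ^ 2 * D = c ^ 2 * c' ^ 2 / (s * s') * (s * I) := by
        rw [hD]
        field_simp
      rw [this, abs_mul, mul_assoc _ H, abs_of_nonneg (by positivity)]
      exact mul_le_mul_of_nonneg_left hI (by positivity)
    · rw [hD, hI]
      simp
  · rw [hD, e5]
    simp

end

lemma one_div_sqrt_pow (n k : ℕ) : (1 / Real.sqrt n) ^ k = 1 / (n : ℝ) ^ ((k : ℝ) / 2) := by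
  rw [div_pow, one_pow, Real.sqrt_eq_rpow, ← Real.rpow_natCast, ← Real.rpow_mul (Nat.cast_nonneg _)]
  ring_nf

/-! ### The double interpolation for even functions -/

section
variable {Ω : Type*} {d p : ℕ} {r : Fin d → ℝ} {n : Fin d → ℕ}
  {X : (j : Fin d) → Fin (n j) → Ω → ℝ} [MeasurableSpace Ω] {μ : Measure Ω}
  [IsProbabilityMeasure μ] {Q A B H : ℝ} {F χ : (Fin d → ℝ) → ℝ}

lemma abs_coord_add_single_sub_le (w : Fin d → ℝ) (j : Fin d) {t y : ℝ}
    (ht : t ∈ Set.Icc (0 : ℝ) 1) (m : Fin d) :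
    |(w + (t * y) • (Pi.single j (1 : ℝ) : Fin d → ℝ)) m - w m| ≤ |y| := by
  rw [Pi.add_apply, add_sub_cancel_left, Pi.smul_apply, smul_eq_mul, abs_mul, abs_mul,
    abs_of_nonneg ht.1]
  have h1 : |(Pi.single j (1 : ℝ) : Fin d → ℝ) m| ≤ 1 := by
    by_cases h : m = j
    · subst h; simp
    · simp [h]
  have h2 : t * |y| ≤ |y| := mul_le_of_le_one_left (abs_nonneg _) ht.2
  exact (mul_le_of_le_one_right (mul_nonneg ht.1 (abs_nonneg _)) h1).trans h2

/-- The factor `2` is that of `pow_mul_doubleShiftMoment_le`; it turns the coefficient `3 / 2` of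
`abs_steinDefect_le_third` into `3`. -/
lemma MatchingArray.remainderBound_third (hX : MatchingArray μ p r n X) (hp : 2 ≤ p)
    (hr : ∀ m, 0 ≤ r m) (hA : 0 ≤ A) (hB : 0 ≤ B) (hH : 0 ≤ H) (hQ : 0 ≤ Q)
    (hpQ : (p : ℝ) + 2 ≤ Q + 1) (hrQ : ∀ m, r m + (p + 2) ≤ Q + 1)
    (hXR : ∀ j i, Integrable (fun ω => |X j i ω| ^ (Q + 1)) μ) (hχ : Tame Q χ) (k : Fin d)
    (hf : ∀ w, |pd k χ w| ≤ H * polyDom A B r w) {c s c' s' : ℝ} (hc : |c| ≤ 1) (hs : |s| ≤ 1)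
    (hc' : |c'| ≤ 1) (hs' : |s'| ≤ 1) (hs0 : 0 < s) (hs0' : 0 < s') (l : Fin (n k)) :
    RemainderBound μ X k l (gsmooth c' s' (pd k (gsmooth c s χ))) 2
      (fun ω => c ^ 2 * c' ^ 2 / (s * s') * H * (A + B * ∑ m,
        doubleShiftMoment (r m) (sumOff X k l ω m) (scaled X k l ω)))
      (c ^ 2 * c' ^ 2 / (s * s') * H * (2 * bracketTwo μ A B r X k l)) where
  bound ω t ht := abs_iterPartial_gsmooth_gsmooth_le hQ hχ hA hB hr hH k hf hc hs hc' hs' hs0 hs0'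
    fun m => abs_coord_add_single_sub_le _ k ht m
  moment q hq _ := by
    have hp' : (2 : ℝ) ≤ p := by exact_mod_cast hp
    have hq3 : (q : ℝ) ≤ 3 := by exact_mod_cast hq
    obtain ⟨h1, h2⟩ := hX.pow_mul_dom_le hp (q := 3) (by norm_num) (by linarith) hXR k l hq3 hA hB
      (c := c ^ 2 * c' ^ 2 / (s * s') * H) (by positivity)
      fun m => hX.pow_mul_doubleShiftMoment_le hp (q := 3) (by norm_num) (hr m)
        (by linarith [hrQ m]) hXR k l m hq3
    refine ⟨h1, h2.trans (mul_le_mul_of_nonneg_left ?_ (by positivity))⟩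
    rw [bracketTwo, ← Finset.mul_sum]
    have : 0 ≤ A * absMoment μ (X k l) 3 := mul_nonneg hA (absMoment_nonneg _)
    linarith

/-- No integration by parts is needed: `p + 1` further derivatives of `pd j F` have the top order `p
+ 2` of `F`, and each contributes a factor `c`. -/
lemma MatchingArray.remainderBound_top (hX : MatchingArray μ p r n X) (hp : 2 ≤ p)
    (hr : ∀ m, 0 ≤ r m) (hA : 0 ≤ A) (hB : 0 ≤ B) (hH : 0 ≤ H) (hQ : 0 ≤ Q)
    (hpQ : (p : ℝ) + 2 ≤ Q + 1) (hrQ : ∀ m, r m + (p + 2) ≤ Q + 1)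
    (hXR : ∀ j i, Integrable (fun ω => |X j i ω| ^ (Q + 1)) μ) (hF : Tame Q F)
    (hf : ∀ l : List (Fin d), l.length = p + 2 → ∀ w, |iterPartial l F w| ≤ H * polyDom A B r w)
    {c s : ℝ} (hcs : c ^ 2 + s ^ 2 = 1) (hc0 : 0 ≤ c) (j : Fin d) (i : Fin (n j)) :
    RemainderBound μ X j i (gsmooth c s (pd j F)) (p + 1)
      (fun ω => c ^ (p + 1) * H * (A + B * ∑ m,
        shiftMoment (r m) c (sumOff X j i ω m) (scaled X j i ω)))
      (c ^ (p + 1) * H * bracketOne μ p A B r X j i) where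
  bound ω t ht := by
    have hc : |c| ≤ 1 := by rw [← sq_le_one_iff_abs_le_one]; nlinarith [sq_nonneg s]
    have hs : |s| ≤ 1 := by rw [← sq_le_one_iff_abs_le_one]; nlinarith [sq_nonneg c]
    rw [iterPartial_gsmooth hQ (hF.pd j) hc hs, List.length_replicate, abs_mul,
      abs_of_nonneg (by positivity : 0 ≤ c ^ (p + 1)), mul_assoc]
    refine mul_le_mul_of_nonneg_left ?_ (by positivity)
    refine abs_gsmooth_le_shiftMoment hB hr hH (fun w => ?_) hcs
      fun m => abs_coord_add_single_sub_le _ j ht m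
    have := hf (List.replicate (p + 1) j ++ [j]) (by simp) w
    rwa [iterPartial_append] at this
  moment q hq _ := by
    have hp' : (2 : ℝ) ≤ p := by exact_mod_cast hp
    have hq3 : (q : ℝ) ≤ p + 2 := by exact_mod_cast hq
    obtain ⟨h1, h2⟩ := hX.pow_mul_dom_le hp (q := p + 2) (by linarith) (by linarith) hXR j i hq3
      hA hB (c := c ^ (p + 1) * H) (by positivity)
      fun m => hX.pow_mul_shiftMoment_le hp (q := p + 2) (by linarith) (hr m)
        (by linarith [hrQ m]) hXR j i m hq3 c
    refine ⟨h1, h2.trans (le_of_eq ?_)⟩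
    simp only [bracketOne, add_assoc]

/-- The factor of the second half of the bound. -/
def thirdSum {Ω : Type*} [MeasurableSpace Ω] (μ : Measure Ω) {d : ℕ} (A B : ℝ) (r : Fin d → ℝ)
    {n : Fin d → ℕ} (X : (j : Fin d) → Fin (n j) → Ω → ℝ) : ℝ :=
  ∑ k, ∑ l, 1 / (n k : ℝ) ^ ((3 : ℝ) / 2) * bracketTwo μ A B r X k l

lemma bracketTwo_nonneg (hA : 0 ≤ A) (hB : 0 ≤ B) (k : Fin d) (l : Fin (n k)) :
    0 ≤ bracketTwo μ A B r X k l := by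
  have h1 : ∀ Y : Ω → ℝ, ∀ s, 0 ≤ absMoment μ Y s := fun Y s => absMoment_nonneg s
  have h2 := normalAbsMoment_nonneg
  unfold bracketTwo
  have h3 := h1 (X k l) 3
  refine add_nonneg (mul_nonneg hA h3) (mul_nonneg hB (Finset.sum_nonneg fun m _ => ?_))
  have h4 := h1 (X k l) (r m + 3)
  have h5 := h1 (fun ω => sumVec X ω m) (r m)
  have h6 := h2 (r m + 1)
  positivity

lemma bracketOne_nonneg (hA : 0 ≤ A) (hB : 0 ≤ B) (k : Fin d) (l : Fin (n k)) :
    0 ≤ bracketOne μ p A B r X k l := by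
  have h1 : ∀ Y : Ω → ℝ, ∀ s, 0 ≤ absMoment μ Y s := fun Y s => absMoment_nonneg s
  have h2 := normalAbsMoment_nonneg
  unfold bracketOne
  have h3 := h1 (X k l) (p + 2)
  refine add_nonneg (mul_nonneg hA h3) (mul_nonneg hB (Finset.sum_nonneg fun m _ => ?_))
  have h4 := h1 (X k l) (r m + p + 2)
  have h5 := h1 (fun ω => sumVec X ω m) (r m)
  have h6 := h2 (r m)
  positivity

lemma thirdSum_nonneg (hA : 0 ≤ A) (hB : 0 ≤ B) : 0 ≤ thirdSum μ A B r X :=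
  Finset.sum_nonneg fun k _ => Finset.sum_nonneg fun l _ =>
    mul_nonneg (by positivity) (bracketTwo_nonneg hA hB k l)

/-- Odd functions: the mean is of the order of the third moments. -/
lemma MatchingArray.abs_integral_gsmooth_odd_le (hX : MatchingArray μ p r n X) (hp : 2 ≤ p)
    (hr : ∀ m, 0 ≤ r m) (hA : 0 ≤ A) (hB : 0 ≤ B) (hH : 0 ≤ H) (hQ : 0 ≤ Q)
    (hpQ : (p : ℝ) + 2 ≤ Q + 1) (hrQ : ∀ m, r m + (p + 2) ≤ Q + 1)
    (hXR : ∀ j i, Integrable (fun ω => |X j i ω| ^ (Q + 1)) μ) (hχ : Tame Q χ)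
    (hodd : ∀ w, χ (-w) = -χ w)
    (hf : ∀ k w, |pd k χ w| ≤ H * polyDom A B r w) {c s : ℝ} (hc : |c| ≤ 1) (hs : |s| ≤ 1)
    (hs0 : 0 < s) :
    |∫ ω, gsmooth c s χ (sumVec X ω) ∂μ| ≤
      Real.pi / 4 * (3 * (c ^ 2 / s * H) * thirdSum μ A B r X) := by
  have h0 : ∫ z, gsmooth c s χ z ∂stdNormal d = 0 := stdNormal_integral_odd (gsmooth_odd hodd)
  have h := abs_integral_sub_stdNormal_le hQ (hχ.gsmooth hQ hc hs) hX.measurable_sumVec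
    (hX.integrable_sumVec (by linarith) hXR)
    (b := fun a => Real.cos a ^ 2 * (3 * (c ^ 2 / s * H) * thirdSum μ A B r X)) (by fun_prop)
    fun a ha => ?_
  · rw [h0, sub_zero, intervalIntegral.integral_mul_const, integral_cos_sq] at h
    refine h.trans (le_of_eq ?_)
    rw [Real.cos_pi_div_two, Real.sin_zero]
    ring
  -- The prefactor `sin a` cancels the `1 / sin a` left by the inner integration by parts. What
  -- depends on `a` is then `cos a ^ 2`, whose integral is `π / 4`.
  · have hsa : 0 < Real.sin a := Real.sin_pos_of_pos_of_lt_pi ha.1 (by linarith [ha.2, Real.pi_pos])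
    have hb := fun k => hX.abs_steinDefect_le_third hp hQ hpQ hXR
      (((hχ.gsmooth hQ hc hs).pd k).gsmooth hQ (Real.abs_cos_le_one a) (Real.abs_sin_le_one a)) k
      fun l => hX.remainderBound_third hp hr hA hB hH hQ hpQ hrQ hXR hχ k (hf k) hc hs
        (Real.abs_cos_le_one a) (Real.abs_sin_le_one a) hs0 hsa l
    rw [abs_mul, abs_of_pos hsa]
    refine (mul_le_mul_of_nonneg_left ((Finset.abs_sum_le_sum_abs _ _).trans
      (Finset.sum_le_sum fun k _ => hb k)) hsa.le).trans (le_of_eq ?_)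
    simp only [thirdSum, Finset.mul_sum]
    refine Finset.sum_congr rfl fun k _ => Finset.sum_congr rfl fun l _ => ?_
    rw [one_div_sqrt_pow]
    push_cast
    generalize 1 / (n k : ℝ) ^ ((3 : ℝ) / 2) = σ
    field_simp

lemma integral_sin_mul_cos_pow (m : ℕ) :
    ∫ a in (0 : ℝ)..(Real.pi / 2), Real.sin a * Real.cos a ^ m = 1 / ((m : ℝ) + 1) := by
  have h := intervalIntegral.integral_eq_sub_of_hasDerivAt
    (f := fun a => -(Real.cos a ^ (m + 1) / ((m : ℝ) + 1)))
    (f' := fun a => Real.sin a * Real.cos a ^ m) (a := 0) (b := Real.pi / 2) (fun a _ => ?_)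
    (Continuous.intervalIntegrable (by fun_prop) _ _)
  · rw [h]
    simp
  · have := (((Real.hasDerivAt_cos a).pow (m + 1)).div_const ((m : ℝ) + 1)).neg
    have hm : (m : ℝ) + 1 ≠ 0 := by positivity
    convert! this using 1
    push_cast
    field_simp

/-- As `0 ≤ cos ≤ 1` on the interval, the integral decreases in `m`. It is used at `m = p + 2 ≥ 4`.
-/
lemma integral_cos_pow_le {m : ℕ} (hm : 4 ≤ m) :
    ∫ a in (0 : ℝ)..(Real.pi / 2), Real.cos a ^ m ≤ 3 * Real.pi / 16 := by
  have h4 : ∫ a in (0 : ℝ)..(Real.pi / 2), Real.cos a ^ 4 = 3 * Real.pi / 16 := by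
    rw [show 4 = 2 + 2 from rfl, integral_cos_pow, integral_cos_sq]
    simp
    ring
  rw [← h4]
  refine intervalIntegral.integral_mono_on (by positivity)
    (Continuous.intervalIntegrable (by fun_prop) _ _)
    (Continuous.intervalIntegrable (by fun_prop) _ _) fun a ha => ?_
  exact pow_le_pow_of_le_one (Real.cos_nonneg_of_mem_Icc ⟨by linarith [ha.1, Real.pi_pos], ha.2⟩)
    (Real.cos_le_one a) hm

/-- The remainder of the outer interpolation integrates `sin a * cos a ^ (p + 1)` and yields `1 / (p
+ 2)`. In the surviving term, `∂_j^{p+1} F` is odd, so the inner interpolation bounds its smoothed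
mean with a factor `1 / sin a`, which the outer `sin a` cancels. -/
theorem MatchingArray.abs_integral_sub_le_of_tame (hX : MatchingArray μ p r n X) (hp : 2 ≤ p)
    (hpe : Even p)
    (hr : ∀ m, 0 ≤ r m) (hA : 0 ≤ A) (hB : 0 ≤ B) (hH : 0 ≤ H) (hQ : 0 ≤ Q)
    (hpQ : (p : ℝ) + 2 ≤ Q + 1) (hrQ : ∀ m, r m + (p + 2) ≤ Q + 1)
    (hXR : ∀ j i, Integrable (fun ω => |X j i ω| ^ (Q + 1)) μ) (hF : Tame Q F)
    (heven : ∀ w, F (-w) = F w)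
    (hf : ∀ l : List (Fin d), l.length = p + 2 → ∀ w, |iterPartial l F w| ≤ H * polyDom A B r w) :
    |∫ ω, F (sumVec X ω) ∂μ - ∫ z, F z ∂stdNormal d| ≤ evenBound μ p A B r X H := by
  set V := thirdSum μ A B r X with hV
  have hV0 : 0 ≤ V := thirdSum_nonneg hA hB
  set E : (j : Fin d) → Fin (n j) → ℝ := fun j i => |∫ ω, X j i ω ^ (p + 1) ∂μ| with hE
  set C1 : ℝ := ∑ j, ∑ i, (1 / Real.sqrt (n j)) ^ (p + 1) * E j i with hC1
  set C2 : ℝ := ∑ j, ∑ i, (1 / Real.sqrt (n j)) ^ (p + 2) *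
    (((p : ℝ) + 2) / ((p : ℝ) + 1) + E j i) * bracketOne μ p A B r X j i with hC2
  have h := abs_integral_sub_stdNormal_le hQ hF hX.measurable_sumVec
    (hX.integrable_sumVec (by linarith) hXR)
    (b := fun a => Real.cos a ^ (p + 2) * (1 / (p.factorial : ℝ) * (C1 * (3 * Real.pi / 4 * H * V))) +
      Real.sin a * Real.cos a ^ (p + 1) * (1 / (p.factorial : ℝ) * (H * C2))) (by fun_prop)
    fun a ha => ?_
  · have hcont1 : Continuous fun a => Real.cos a ^ (p + 2) *
      (1 / (p.factorial : ℝ) * (C1 * (3 * Real.pi / 4 * H * V))) := by fun_prop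
    have hcont2 : Continuous fun a => Real.sin a * Real.cos a ^ (p + 1) *
      (1 / (p.factorial : ℝ) * (H * C2)) := by fun_prop
    rw [intervalIntegral.integral_add (hcont1.intervalIntegrable _ _)
      (hcont2.intervalIntegrable _ _), intervalIntegral.integral_mul_const,
      intervalIntegral.integral_mul_const, integral_sin_mul_cos_pow] at h
    refine h.trans ?_
    have hC10 : 0 ≤ C1 := Finset.sum_nonneg fun j _ => Finset.sum_nonneg fun i _ => by positivity
    have h1 := mul_le_mul_of_nonneg_right (integral_cos_pow_le (m := p + 2) (by omega))
      (by positivity : 0 ≤ 1 / (p.factorial : ℝ) * (C1 * (3 * Real.pi / 4 * H * V)))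
    -- This is the source of `3 / 2` in the bound: `3π / 16` bounds the outer cosine integral and `3
    -- * π / 4` comes from the inner interpolation.
    have h2 : 3 * Real.pi / 16 * (3 * Real.pi / 4) ≤ 3 / 2 := by
      have := Real.pi_lt_d2
      have := Real.pi_pos
      nlinarith
    have h3 := mul_le_mul_of_nonneg_right h2
      (by positivity : 0 ≤ 1 / (p.factorial : ℝ) * (C1 * (H * V)))
    have e : evenBound μ p A B r X H = 1 / (p.factorial : ℝ) * H *
        (1 / ((p : ℝ) + 2) * C2 + 3 / 2 * (C1 * V)) := by
      rw [evenBound, hC1, hC2, hV, thirdSum]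
      simp only [one_div_sqrt_pow, Finset.sum_mul]
      push_cast
      have e1 : ((p : ℝ) + 2) / 2 = (p : ℝ) / 2 + 1 := by ring
      simp only [e1, hE]
      congr 3
      refine Finset.sum_congr rfl fun j _ => Finset.sum_congr rfl fun i _ => ?_
      ring
    rw [e]
    push_cast
    have e2 : (p : ℝ) + 1 + 1 = p + 2 := by ring
    rw [e2]
    linarith
  · have hsa : 0 < Real.sin a := Real.sin_pos_of_pos_of_lt_pi ha.1 (by linarith [ha.2, Real.pi_pos])
    have hca : 0 ≤ Real.cos a :=
      Real.cos_nonneg_of_mem_Icc ⟨by linarith [ha.1, Real.pi_pos], ha.2.le⟩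
    set c := Real.cos a with hc
    set s := Real.sin a with hs
    have hc1 : |c| ≤ 1 := Real.abs_cos_le_one a
    have hs1 : |s| ≤ 1 := Real.abs_sin_le_one a
    have hcs : c ^ 2 + s ^ 2 = 1 := Real.cos_sq_add_sin_sq a
    have hb := fun j => hX.abs_steinDefect_le hp hpe hQ hpQ hXR ((hF.pd j).gsmooth hQ hc1 hs1) j
      fun i => hX.remainderBound_top hp hr hA hB hH hQ hpQ hrQ hXR hF hf hcs hca j i
    have hmain : ∀ j, |∫ ω, iterPartial (List.replicate p j) (gsmooth c s (pd j F))
        (sumVec X ω) ∂μ| ≤ c ^ p * (Real.pi / 4 * (3 * (c ^ 2 / s * H) * V)) := by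
      intro j
      rw [iterPartial_gsmooth hQ (hF.pd j) hc1 hs1, integral_const_mul, abs_mul,
        List.length_replicate, abs_of_nonneg (by positivity : 0 ≤ c ^ p)]
      refine mul_le_mul_of_nonneg_left ?_ (by positivity)
      have e : iterPartial (List.replicate p j) (pd j F) =
        iterPartial (List.replicate p j ++ [j]) F := by rw [iterPartial_append]; rfl
      rw [e]
      refine hX.abs_integral_gsmooth_odd_le hp hr hA hB hH hQ hpQ hrQ hXR (hF.iterPartial _)
        (fun w => ?_) (fun k w => ?_) hc1 hs1 hsa
      · rw [iterPartial_neg heven]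
        simp [hpe.neg_one_pow, pow_succ]
      · exact hf (k :: (List.replicate p j ++ [j])) (by simp) w
    rw [abs_mul, abs_of_pos hsa]
    calc s * |∑ j, steinDefect μ (sumVec X) j (gsmooth c s (pd j F))|
        ≤ s * ∑ j, 1 / (p.factorial : ℝ) * ∑ i,
          ((1 / Real.sqrt (n j)) ^ (p + 1) * E j i *
            (c ^ p * (Real.pi / 4 * (3 * (c ^ 2 / s * H) * V))) +
          (1 / Real.sqrt (n j)) ^ (p + 2) * (((p : ℝ) + 2) / ((p : ℝ) + 1) + E j i) *
            (c ^ (p + 1) * H * bracketOne μ p A B r X j i)) := by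
          refine mul_le_mul_of_nonneg_left ((Finset.abs_sum_le_sum_abs _ _).trans
            (Finset.sum_le_sum fun j _ => (hb j).trans ?_)) hsa.le
          gcongr with i
          exact hmain j
      _ = _ := by
          rw [hC1, hC2]
          simp only [Finset.mul_sum, Finset.sum_mul, ← Finset.sum_add_distrib]
          refine Finset.sum_congr rfl fun j _ => Finset.sum_congr rfl fun i _ => ?_
          have := hsa.ne'
          field_simp
          ring

end

/-! ### Mollification -/

section
variable {E : Type*} [NormedAddCommGroup E] [NormedSpace ℝ E] [FiniteDimensional ℝ E]
  [MeasureSpace E] [BorelSpace E] [(volume : Measure E).IsAddHaarMeasure] {ε K : ℝ} {φ f g : E → ℝ}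

/-- Smooth even probability densities supported in the ball of radius `ε`. -/
structure IsMollifier (ε : ℝ) (φ : E → ℝ) : Prop where
  contDiff : ContDiff ℝ (⊤ : ℕ∞) φ
  compact : HasCompactSupport φ
  nonneg : ∀ t, 0 ≤ φ t
  even : ∀ t, φ (-t) = φ t
  integral_eq_one : ∫ t, φ t = 1
  norm_le : ∀ t, φ t ≠ 0 → ‖t‖ ≤ ε

lemma exists_isMollifier (hε : 0 < ε) : ∃ φ : E → ℝ, IsMollifier ε φ := by
  let b : ContDiffBump (0 : E) := ⟨ε / 2, ε, by positivity, by linarith⟩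
  refine ⟨b.normed volume, b.contDiff_normed, b.hasCompactSupport_normed, b.nonneg_normed,
    b.normed_neg, b.integral_normed, fun t ht => ?_⟩
  have : t ∈ Function.support (b.normed volume) := ht
  rw [b.support_normed_eq, mem_ball_zero_iff] at this
  exact this.le

/-- The convolution of `φ` and `f`. -/
def mollify (φ f : E → ℝ) (w : E) : ℝ := ∫ t, φ t * f (w - t)

lemma IsMollifier.integrable (hφ : IsMollifier ε φ) : Integrable φ :=
  hφ.contDiff.continuous.integrable_of_hasCompactSupport hφ.compact

lemma IsMollifier.abs_mul_le (hφ : IsMollifier ε φ) (h : ∀ t, ‖t‖ ≤ ε → |g t| ≤ K) (t : E) :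
    ‖φ t * g t‖ ≤ φ t * K := by
  rw [norm_mul, Real.norm_of_nonneg (hφ.nonneg t)]
  by_cases ht : φ t = 0
  · rw [ht, zero_mul, zero_mul]
  · exact mul_le_mul_of_nonneg_left (h t (hφ.norm_le t ht)) (hφ.nonneg t)

lemma IsMollifier.integrable_mul (hφ : IsMollifier ε φ) (hg : Measurable g)
    (h : ∀ t, ‖t‖ ≤ ε → |g t| ≤ K) : Integrable fun t => φ t * g t :=
  (hφ.integrable.mul_const K).mono' (hφ.contDiff.continuous.measurable.mul hg).aestronglyMeasurable
    (Filter.Eventually.of_forall (hφ.abs_mul_le h))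

lemma IsMollifier.abs_integral_mul_le (hφ : IsMollifier ε φ) (h : ∀ t, ‖t‖ ≤ ε → |g t| ≤ K) :
    |∫ t, φ t * g t| ≤ K := by
  have := norm_integral_le_of_norm_le (hφ.integrable.mul_const K)
    (Filter.Eventually.of_forall (hφ.abs_mul_le h))
  rwa [integral_mul_const, hφ.integral_eq_one, one_mul] at this

lemma IsMollifier.abs_mollify_sub_le (hφ : IsMollifier ε φ) (hf : Continuous f) {w : E}
    (h : ∀ t, ‖t‖ ≤ ε → |f (w - t) - f w| ≤ K) : |mollify φ f w - f w| ≤ K := by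
  have h1 : Integrable fun t => φ t * (f (w - t) - f w) :=
    hφ.integrable_mul (g := fun t => f (w - t) - f w) (by fun_prop) h
  have e : mollify φ f w = ∫ t, (φ t * (f (w - t) - f w) + φ t * f w) := by
    rw [mollify]
    congr 1
    ext t
    ring
  rw [e, integral_add h1 (hφ.integrable.mul_const _), integral_mul_const, hφ.integral_eq_one,
    one_mul, add_sub_cancel_right]
  exact hφ.abs_integral_mul_le (g := fun t => f (w - t) - f w) h

lemma IsMollifier.mollify_even (hφ : IsMollifier ε φ) (hf : ∀ w, f (-w) = f w) (w : E) :
    mollify φ f (-w) = mollify φ f w := by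
  rw [mollify, ← integral_neg_eq_self, mollify]
  congr 1
  ext t
  rw [hφ.even, ← hf]
  congr 2
  abel

lemma mollify_eq_convolution (φ f : E → ℝ) :
    mollify φ f = convolution f φ (ContinuousLinearMap.lsmul ℝ ℝ) volume := by
  ext w
  rw [convolution_lsmul_swap, mollify]
  simp only [smul_eq_mul, mul_comm]
end

/-! ### Partial derivatives of convolutions -/

section
variable {d : ℕ} {Q : ℝ} {ψ f : (Fin d → ℝ) → ℝ} {ε : ℝ}

lemma hasFDerivAt_mollify (hψ : ContDiff ℝ (⊤ : ℕ∞) ψ) (hc : HasCompactSupport ψ)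
    (hf : Continuous f) (w : Fin d → ℝ) :
    DifferentiableAt ℝ (mollify ψ f) w ∧ ∀ i, pd i (mollify ψ f) w = mollify (pd i ψ) f w := by
  have hψ1 : ContDiff ℝ 1 ψ := hψ.of_le (by exact_mod_cast le_top)
  have h := hc.hasFDerivAt_convolution_right (ContinuousLinearMap.lsmul ℝ ℝ)
    hf.locallyIntegrable (μ := volume) hψ1 w
  rw [← mollify_eq_convolution] at h
  refine ⟨h.differentiableAt, fun i => ?_⟩
  rw [pd, (h.hasLineDerivAt _).lineDeriv, mollify_eq_convolution,
    convolution_precompR_apply _ hf.locallyIntegrable (hc.fderiv ℝ)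
      (hψ1.continuous_fderiv one_ne_zero)]
  congr 1
  ext a
  rw [fderiv_apply_single (hψ1.differentiable one_ne_zero)]

lemma contDiff_iterPartial (hψ : ContDiff ℝ (⊤ : ℕ∞) ψ) (hc : HasCompactSupport ψ)
    (l : List (Fin d)) :
    ContDiff ℝ (⊤ : ℕ∞) (iterPartial l ψ) ∧ HasCompactSupport (iterPartial l ψ) := by
  induction l with
  | nil => exact ⟨hψ, hc⟩
  | cons i l ih =>
    have e : iterPartial (i :: l) ψ = fun w => fderiv ℝ (iterPartial l ψ) w (Pi.single i 1) := by
      ext w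
      rw [fderiv_apply_single (ih.1.differentiable (by simp)), iterPartial_cons]
    rw [e]
    exact ⟨(ih.1.fderiv_right (m := (⊤ : ℕ∞)) (by simp)).clm_apply contDiff_const,
      ih.2.fderiv_apply ℝ _⟩

lemma iterPartial_mollify (hψ : ContDiff ℝ (⊤ : ℕ∞) ψ) (hc : HasCompactSupport ψ)
    (hf : Continuous f) (l : List (Fin d)) :
    iterPartial l (mollify ψ f) = mollify (iterPartial l ψ) f := by
  induction l with
  | nil => rfl
  | cons i l ih =>
    obtain ⟨h1, h2⟩ := contDiff_iterPartial hψ hc l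
    rw [iterPartial_cons, ih, iterPartial_cons]
    ext w
    exact (hasFDerivAt_mollify h1 h2 hf w).2 i

lemma abs_mollify_le_of_growth (hψ : Continuous ψ) (hc : HasCompactSupport ψ)
    (hQ : 0 ≤ Q) {C : ℝ} (hC : 0 ≤ C) (hfb : ∀ w, |f w| ≤ C * (1 + ‖w‖) ^ Q) (w : Fin d → ℝ) :
    |mollify ψ f w| ≤ (C * ∫ t, |ψ t| * (1 + ‖t‖) ^ Q) * (1 + ‖w‖) ^ Q := by
  have hi : Integrable fun t => |ψ t| * (1 + ‖t‖) ^ Q := by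
    refine Continuous.integrable_of_hasCompactSupport ?_ (hc.norm.mul_right)
    refine hψ.norm.mul ((by fun_prop : Continuous fun t : Fin d → ℝ => 1 + ‖t‖).rpow_const
      fun t => Or.inr hQ)
  have h := norm_integral_le_of_norm_le (f := fun t => ψ t * f (w - t))
    (hi.const_mul (C * (1 + ‖w‖) ^ Q)) (Filter.Eventually.of_forall fun t => ?_)
  · rw [integral_const_mul] at h
    refine h.trans (le_of_eq ?_)
    ring
  · rw [norm_mul]
    have h1 := one_add_norm_rpow_le hQ (c := 1) (s := -1) (by simp) (by simp) w t
    rw [one_smul, neg_one_smul, ← sub_eq_add_neg] at h1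
    calc ‖ψ t‖ * ‖f (w - t)‖ ≤ |ψ t| * (C * ((1 + ‖w‖) ^ Q * (1 + ‖t‖) ^ Q)) :=
          mul_le_mul_of_nonneg_left ((hfb _).trans (mul_le_mul_of_nonneg_left h1 hC))
            (abs_nonneg _)
      _ = _ := by ring

/-- All derivatives fall on the mollifier, so every order exists and the growth exponent stays `Q`;
only the constants depend on the mollifier. -/
lemma tame_mollify (hψ : ContDiff ℝ (⊤ : ℕ∞) ψ) (hc : HasCompactSupport ψ) (hf : Continuous f)
    (hQ : 0 ≤ Q) {C : ℝ} (hC : 0 ≤ C) (hfb : ∀ w, |f w| ≤ C * (1 + ‖w‖) ^ Q) :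
    Tame Q (mollify ψ f) where
  diff l := by
    obtain ⟨h1, h2⟩ := contDiff_iterPartial hψ hc l
    rw [iterPartial_mollify hψ hc hf]
    exact fun w => (hasFDerivAt_mollify h1 h2 hf w).1
  growth l := by
    obtain ⟨h1, h2⟩ := contDiff_iterPartial hψ hc l
    rw [iterPartial_mollify hψ hc hf]
    exact ⟨_, mul_nonneg hC (integral_nonneg fun t => by positivity),
      abs_mollify_le_of_growth h1.continuous h2 hQ hC hfb⟩

/-! ### Functions with finitely many partial derivatives -/

lemma hasDerivAt_line_of_lineDifferentiable {i : Fin d}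
    (h : ∀ w, LineDifferentiableAt ℝ f w (Pi.single i 1)) (w : Fin d → ℝ) (s : ℝ) :
    HasDerivAt (fun s : ℝ => f (w + s • Pi.single i (1 : ℝ)))
      (pd i f (w + s • Pi.single i (1 : ℝ))) s := by
  have h1 := (h (w + s • Pi.single i (1 : ℝ))).hasLineDerivAt
  unfold HasLineDerivAt at h1
  have h2 := HasDerivAt.comp_sub_const s s (by rw [sub_self]; exact h1)
  have e : ∀ t : ℝ, w + s • (Pi.single i (1 : ℝ) : Fin d → ℝ) + (t - s) • Pi.single i (1 : ℝ) =
    w + t • Pi.single i (1 : ℝ) := fun t => by rw [sub_smul]; abel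
  simp only [e] at h2
  exact h2

/-- Partial derivatives alone do not give Fréchet differentiability, so the coordinates are changed
one at a time with a mean value inequality on each axis-parallel segment. All these segments stay in
the maximum-norm ball of radius `R`. -/
lemma abs_sub_piecewise_le {C : ℝ} (hC : 0 ≤ C) (hQ : 0 ≤ Q)
    (hd : ∀ i w, LineDifferentiableAt ℝ f w (Pi.single i 1))
    (hb : ∀ i w, |pd i f w| ≤ C * (1 + ‖w‖) ^ Q) {R : ℝ} {x y : Fin d → ℝ} (hx : ‖x‖ ≤ R)
    (hy : ‖y‖ ≤ R) (S : Finset (Fin d)) :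
    |f (S.piecewise x y) - f y| ≤ S.card * (C * (1 + R) ^ Q) * ‖x - y‖ := by
  classical
  have hR : 0 ≤ R := (norm_nonneg x).trans hx
  induction S using Finset.induction_on with
  | empty => simp
  | insert i S hi ih =>
    set u := S.piecewise x y with hu
    have huv : (insert i S).piecewise x y = u + (x i - y i) • Pi.single i (1 : ℝ) := by
      rw [Finset.piecewise_insert]
      ext m
      by_cases hm : m = i
      · subst hm
        simp [hu, hi]
      · simp [hu, hm]
    have hub : ∀ m, |u m| ≤ R := fun m => by
      rw [hu, Finset.piecewise]
      split_ifs
      · exact (norm_le_pi_norm x m).trans hx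
      · exact (norm_le_pi_norm y m).trans hy
    have hseg : ∀ t ∈ Set.Icc (0 : ℝ) 1, ‖u + (t * (x i - y i)) • Pi.single i (1 : ℝ)‖ ≤ R := by
      intro t ht
      rw [pi_norm_le_iff_of_nonneg hR]
      intro m
      by_cases hm : m = i
      · subst hm
        have e : (u + (t * (x m - y m)) • (Pi.single m (1 : ℝ) : Fin d → ℝ)) m =
            t * x m + (1 - t) * y m := by
          simp [hu, hi]
          ring
        rw [e]
        refine (norm_add_le _ _).trans ?_
        rw [norm_mul, norm_mul, Real.norm_of_nonneg ht.1,
          Real.norm_of_nonneg (by linarith [ht.2] : 0 ≤ 1 - t)]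
        have h1 := mul_le_mul_of_nonneg_left ((norm_le_pi_norm x m).trans hx) ht.1
        have h2 := mul_le_mul_of_nonneg_left ((norm_le_pi_norm y m).trans hy)
          (by linarith [ht.2] : 0 ≤ 1 - t)
        linarith
      · simpa [hm] using hub m
    have hder : ∀ t : ℝ, HasDerivAt (fun t : ℝ => f (u + (t * (x i - y i)) • Pi.single i (1 : ℝ)))
        (pd i f (u + (t * (x i - y i)) • Pi.single i (1 : ℝ)) * (x i - y i)) t := fun t => by
      have h1 := hasDerivAt_line_of_lineDifferentiable (hd i) u (t * (x i - y i))
      have h2 := h1.comp t ((hasDerivAt_id t).mul_const (x i - y i))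
      simpa [Function.comp_def] using h2
    have hmv := (convex_Icc (0 : ℝ) 1).norm_image_sub_le_of_norm_hasDerivWithin_le
      (fun t _ => (hder t).hasDerivWithinAt) (C := C * (1 + R) ^ Q * ‖x - y‖) (fun t ht => by
        rw [norm_mul]
        refine mul_le_mul ((hb i _).trans ?_) (norm_le_pi_norm (x - y) i) (norm_nonneg _)
          (by positivity)
        have := hseg t ht
        gcongr) (x := 0) (y := 1) (by simp) (by simp)
    simp only [zero_mul, zero_smul, add_zero, one_mul, sub_zero, norm_one, mul_one] at hmv
    rw [huv, Finset.card_insert_of_notMem hi]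
    push_cast
    calc _ ≤ |f (u + (x i - y i) • Pi.single i (1 : ℝ)) - f u| + |f u - f y| :=
          abs_sub_le _ _ _
      _ ≤ C * (1 + R) ^ Q * ‖x - y‖ + S.card * (C * (1 + R) ^ Q) * ‖x - y‖ := add_le_add hmv ih
      _ = _ := by ring

/-- Partial derivatives of polynomial growth give a local Lipschitz bound. -/
lemma abs_sub_le_of_pd_growth {C : ℝ} (hC : 0 ≤ C) (hQ : 0 ≤ Q)
    (hd : ∀ i w, LineDifferentiableAt ℝ f w (Pi.single i 1))
    (hb : ∀ i w, |pd i f w| ≤ C * (1 + ‖w‖) ^ Q) {R : ℝ} {x y : Fin d → ℝ} (hx : ‖x‖ ≤ R)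
    (hy : ‖y‖ ≤ R) : |f x - f y| ≤ d * (C * (1 + R) ^ Q) * ‖x - y‖ := by
  have := abs_sub_piecewise_le hC hQ hd hb hx hy Finset.univ
  simpa using this

lemma continuous_of_pd_growth {C : ℝ} (hC : 0 ≤ C) (hQ : 0 ≤ Q)
    (hd : ∀ i w, LineDifferentiableAt ℝ f w (Pi.single i 1))
    (hb : ∀ i w, |pd i f w| ≤ C * (1 + ‖w‖) ^ Q) : Continuous f := by
  rw [continuous_iff_continuousAt]
  intro w
  rw [ContinuousAt, tendsto_iff_norm_sub_tendsto_zero]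
  have h1 : Filter.Tendsto (fun x : Fin d → ℝ => d * (C * (1 + (‖w‖ + 1)) ^ Q) * ‖x - w‖) (nhds w)
      (nhds 0) := by
    have : Filter.Tendsto (fun x : Fin d → ℝ => d * (C * (1 + (‖w‖ + 1)) ^ Q) * ‖x - w‖) (nhds w)
      (nhds (d * (C * (1 + (‖w‖ + 1)) ^ Q) * ‖w - w‖)) := Continuous.tendsto (by fun_prop) w
    simpa using this
  refine squeeze_zero' (Filter.Eventually.of_forall fun _ => norm_nonneg _) ?_ h1
  filter_upwards [Metric.ball_mem_nhds w one_pos] with x hx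
  refine abs_sub_le_of_pd_growth hC hQ hd hb ?_ (by linarith)
  rw [mem_ball_iff_norm] at hx
  linarith [norm_le_norm_add_norm_sub' x w]

/-- All partial derivatives up to order `N` exist and grow at most like `(1 + ‖w‖) ^ Q`. -/
structure TameUpTo (N : ℕ) (Q : ℝ) (f : (Fin d → ℝ) → ℝ) : Prop where
  diff : ∀ l : List (Fin d), l.length < N → ∀ i w,
    LineDifferentiableAt ℝ (iterPartial l f) w (Pi.single i 1)
  growth : ∀ l : List (Fin d), l.length ≤ N → ∃ C, 0 ≤ C ∧
    ∀ w, |iterPartial l f w| ≤ C * (1 + ‖w‖) ^ Q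

variable {N : ℕ}

lemma TameUpTo.exists_pd_bound (hf : TameUpTo N Q f) {l : List (Fin d)} (hl : l.length < N) :
    ∃ C, 0 ≤ C ∧ ∀ i w, |pd i (_root_.iterPartial l f) w| ≤ C * (1 + ‖w‖) ^ Q := by
  choose C hC h using fun i => hf.growth (i :: l) (by simpa using hl)
  refine ⟨∑ i, C i, Finset.sum_nonneg fun i _ => hC i, fun i w => (h i w).trans ?_⟩
  gcongr
  exact Finset.single_le_sum (fun i _ => hC i) (Finset.mem_univ i)

lemma TameUpTo.continuous_iterPartial (hQ : 0 ≤ Q) (hf : TameUpTo N Q f) {l : List (Fin d)}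
    (hl : l.length < N) : Continuous (iterPartial l f) := by
  obtain ⟨C, hC, h⟩ := hf.exists_pd_bound hl
  exact continuous_of_pd_growth hC hQ (hf.diff l hl) h

lemma one_add_norm_sub_rpow_le (hQ : 0 ≤ Q) (hε : ε ≤ 1) (w : Fin d → ℝ) {t : Fin d → ℝ}
    (ht : ‖t‖ ≤ ε) : (1 + ‖w - t‖) ^ Q ≤ (2 + ‖w‖) ^ Q := by
  have := norm_sub_le w t
  exact Real.rpow_le_rpow (by positivity) (by linarith) hQ

/-- Here the derivative falls on `f`, which preserves its pointwise bound. That derivative may be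
discontinuous; it suffices that a line derivative of a continuous function is measurable. -/
lemma pd_mollify_right {φ : (Fin d → ℝ) → ℝ} (hφ : IsMollifier ε φ) (hε : ε ≤ 1) (hQ : 0 ≤ Q)
    (hf : Continuous f) {i : Fin d} (hd : ∀ w, LineDifferentiableAt ℝ f w (Pi.single i 1))
    {C : ℝ} (hC : 0 ≤ C) (hb : ∀ w, |pd i f w| ≤ C * (1 + ‖w‖) ^ Q) :
    pd i (mollify φ f) = mollify φ (pd i f) := by
  ext w
  have hfc : ∀ v : Fin d → ℝ, Integrable fun t => φ t * f (v - t) := fun v =>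
    (hφ.contDiff.continuous.mul (by fun_prop)).integrable_of_hasCompactSupport hφ.compact.mul_right
  have hm : Measurable (pd i f) := measurable_lineDeriv hf
  have key := hasDerivAt_integral_of_dominated_loc_of_deriv_le (μ := (volume : Measure (Fin d → ℝ)))
    (F := fun (s : ℝ) t => φ t * f (w + s • Pi.single i (1 : ℝ) - t))
    (F' := fun (s : ℝ) t => φ t * pd i f (w + s • Pi.single i (1 : ℝ) - t)) (x₀ := 0)
    (bound := fun t => φ t * (C * (2 + (‖w‖ + 1)) ^ Q)) (Metric.ball_mem_nhds 0 one_pos)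
    (Filter.Eventually.of_forall fun s => (hfc _).aestronglyMeasurable) (hfc _)
    ((hφ.contDiff.continuous.measurable.mul (by fun_prop)).aestronglyMeasurable)
    (Filter.Eventually.of_forall fun t s hs => ?_) (hφ.integrable.mul_const _)
    (Filter.Eventually.of_forall fun t s _ => ?_)
  · have h2 := key.2
    simp only [zero_smul, add_zero] at h2
    exact HasLineDerivAt.lineDeriv h2
  · refine hφ.abs_mul_le (g := fun t => pd i f (w + s • Pi.single i (1 : ℝ) - t))
      (fun t ht => (hb _).trans (mul_le_mul_of_nonneg_left ?_ hC)) t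
    refine (one_add_norm_sub_rpow_le hQ hε _ ht).trans (Real.rpow_le_rpow (by positivity) ?_ hQ)
    have h1 := norm_add_le w (s • (Pi.single i (1 : ℝ) : Fin d → ℝ))
    rw [norm_smul, Pi.norm_single, norm_one, mul_one] at h1
    rw [mem_ball_zero_iff] at hs
    linarith
  · have h1 := hasDerivAt_line_of_lineDifferentiable hd (w - t) s
    have e : ∀ s : ℝ, w - t + s • (Pi.single i (1 : ℝ) : Fin d → ℝ) =
      w + s • Pi.single i (1 : ℝ) - t := fun s => by abel
    simp only [e] at h1
    exact h1.const_mul _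

lemma TameUpTo.iterPartial_mollify (hf : TameUpTo N Q f) {φ : (Fin d → ℝ) → ℝ}
    (hφ : IsMollifier ε φ) (hε : ε ≤ 1) (hQ : 0 ≤ Q) {l : List (Fin d)} (hl : l.length ≤ N) :
    _root_.iterPartial l (mollify φ f) = mollify φ (_root_.iterPartial l f) := by
  induction l with
  | nil => rfl
  | cons i l ih =>
    have hl' : l.length < N := by simpa using hl
    obtain ⟨C, hC, h⟩ := hf.exists_pd_bound hl'
    rw [iterPartial_cons, ih hl'.le, pd_mollify_right hφ hε hQ (hf.continuous_iterPartial hQ hl')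
      (hf.diff l hl' i) hC (h i), iterPartial_cons]

end

/-! ### The bound for functions with finitely many partial derivatives -/

/-- The additive error in `(t + ε)^r ≤ (1 + √ε)^r t^r + error`. -/
def rpowShift (r ε : ℝ) : ℝ := if r = 0 then 0 else (ε + Real.sqrt ε) ^ r

lemma add_rpow_le_rpowShift {r ε t : ℝ} (hr : 0 ≤ r) (hε : 0 < ε) (ht : 0 ≤ t) :
    (t + ε) ^ r ≤ (1 + Real.sqrt ε) ^ r * t ^ r + rpowShift r ε := by
  have hs : 0 < Real.sqrt ε := Real.sqrt_pos.2 hε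
  have hsq : Real.sqrt ε * Real.sqrt ε = ε := Real.mul_self_sqrt hε.le
  unfold rpowShift
  split_ifs with h0
  · simp [h0]
  -- If `√ε ≤ t` then `ε = √ε * √ε ≤ √ε * t`; otherwise the whole power goes into the error. The
  -- exponent `0` was set apart since `0 ^ 0 = 1` would not tend to zero.
  rcases le_total (Real.sqrt ε) t with h | h
  · have h1 : t + ε ≤ (1 + Real.sqrt ε) * t := by nlinarith
    have h2 := Real.rpow_le_rpow (by positivity) h1 hr
    rw [Real.mul_rpow (by positivity) ht] at h2
    have : 0 ≤ (ε + Real.sqrt ε) ^ r := by positivity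
    linarith
  · have h2 := Real.rpow_le_rpow (by positivity) (by linarith : t + ε ≤ ε + Real.sqrt ε) hr
    have : 0 ≤ (1 + Real.sqrt ε) ^ r * t ^ r := by positivity
    linarith

lemma rpowShift_nonneg {r ε : ℝ} (hε : 0 ≤ ε) : 0 ≤ rpowShift r ε := by
  unfold rpowShift
  split_ifs <;> positivity

lemma rpowShift_zero (r : ℝ) : rpowShift r 0 = 0 := by
  unfold rpowShift
  split_ifs with h
  · rfl
  · simp [Real.zero_rpow h]

lemma continuous_rpowShift {r : ℝ} (hr : 0 ≤ r) : Continuous (rpowShift r) := by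
  unfold rpowShift
  split_ifs
  · exact continuous_const
  · exact (by fun_prop : Continuous fun ε : ℝ => ε + Real.sqrt ε).rpow_const fun _ => Or.inr hr

section
variable {d : ℕ} {Q A B ε : ℝ} {r : Fin d → ℝ} {f φ : (Fin d → ℝ) → ℝ} {N : ℕ}

/-- A small shift leaves the dominating function in the same family with slightly larger `A` and
`B`, so the bound for smooth functions applies unchanged. -/
lemma polyDom_sub_le (hB : 0 ≤ B) (hr : ∀ m, 0 ≤ r m) (hrQ : ∀ m, r m ≤ Q) (hε : 0 < ε)
    (w : Fin d → ℝ) {t : Fin d → ℝ} (ht : ‖t‖ ≤ ε) :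
    polyDom A B r (w - t) ≤
      polyDom (A + B * ∑ m, rpowShift (r m) ε) (B * (1 + Real.sqrt ε) ^ Q) r w := by
  have h : ∀ m, |(w - t) m| ^ r m ≤ (1 + Real.sqrt ε) ^ Q * |w m| ^ r m + rpowShift (r m) ε := by
    intro m
    have h1 : |(w - t) m| ≤ |w m| + ε := by
      have := (norm_le_pi_norm t m).trans ht
      rw [Real.norm_eq_abs] at this
      exact (abs_sub _ _).trans (by linarith)
    refine (Real.rpow_le_rpow (abs_nonneg _) h1 (hr m)).trans
      ((add_rpow_le_rpowShift (hr m) hε (abs_nonneg _)).trans ?_)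
    gcongr
    · linarith [Real.sqrt_nonneg ε]
    · exact hrQ m
  have h2 := Finset.sum_le_sum fun m (_ : m ∈ Finset.univ) => h m
  rw [Finset.sum_add_distrib, ← Finset.mul_sum] at h2
  unfold polyDom
  have := mul_le_mul_of_nonneg_left h2 hB
  linarith

lemma TameUpTo.abs_mollify_sub_le (hf : TameUpTo N Q f) (hN : 0 < N) (hQ : 0 ≤ Q) :
    ∃ K, 0 ≤ K ∧ ∀ ε φ, 0 < ε → ε ≤ 1 → IsMollifier ε φ → ∀ w,
      |mollify φ f w - f w| ≤ ε * K * (1 + ‖w‖) ^ Q := by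
  obtain ⟨C, hC, h⟩ := hf.exists_pd_bound (l := []) hN
  refine ⟨d * (C * 2 ^ Q), by positivity, fun ε φ hε hε1 hφ w => ?_⟩
  refine hφ.abs_mollify_sub_le (hf.continuous_iterPartial hQ (l := []) hN) fun t ht => ?_
  have h1 := abs_sub_le_of_pd_growth (R := ‖w‖ + 1) (x := w - t) (y := w) hC hQ
    (hf.diff [] hN) h (by linarith [norm_sub_le w t]) (by linarith)
  have h2 : (1 + (‖w‖ + 1)) ^ Q ≤ 2 ^ Q * (1 + ‖w‖) ^ Q := by
    rw [← Real.mul_rpow (by norm_num) (by positivity)]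
    exact Real.rpow_le_rpow (by positivity) (by linarith [norm_nonneg w]) hQ
  have h3 : ‖w - t - w‖ ≤ ε := by
    rw [sub_sub_cancel_left, norm_neg]
    exact ht
  calc _ ≤ d * (C * (1 + (‖w‖ + 1)) ^ Q) * ‖w - t - w‖ := h1
    _ ≤ d * (C * (2 ^ Q * (1 + ‖w‖) ^ Q)) * ε := by gcongr
    _ = _ := by ring

end

/-! ### Removing the mollifier by letting its radius tend to zero -/

section
variable {Ω : Type*} {d p : ℕ} {r : Fin d → ℝ} {n : Fin d → ℕ}
  {X : (j : Fin d) → Fin (n j) → Ω → ℝ} [MeasurableSpace Ω] {μ : Measure Ω}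
  [IsProbabilityMeasure μ] {Q A B H : ℝ} {f : (Fin d → ℝ) → ℝ}

lemma continuous_evenBound {a b : ℝ → ℝ} (ha : Continuous a) (hb : Continuous b) :
    Continuous fun ε => evenBound μ p (a ε) (b ε) r X H := by
  unfold evenBound bracketOne bracketTwo
  fun_prop

lemma abs_integral_sub_le_of_abs_sub_le {α : Type*} [MeasurableSpace α] {ν : Measure α}
    {F G b : α → ℝ} (hF : Integrable F ν) (hG : Integrable G ν) (hb : Integrable b ν)
    (h : ∀ x, |F x - G x| ≤ b x) : |∫ x, F x ∂ν - ∫ x, G x ∂ν| ≤ ∫ x, b x ∂ν := by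
  rw [← integral_sub hF hG]
  exact norm_integral_le_of_norm_le (f := fun x => F x - G x) hb (Filter.Eventually.of_forall h)

lemma MatchingArray.abs_integral_mollify_sub_le (hX : MatchingArray μ p r n X) (hp : 2 ≤ p)
    (hpe : Even p)
    (hr : ∀ m, 0 ≤ r m) (hA : 0 ≤ A) (hB : 0 ≤ B) (hH : 0 ≤ H) (hQ : 0 ≤ Q)
    (hpQ : (p : ℝ) + 2 ≤ Q + 1) (hrQ : ∀ m, r m + (p + 2) ≤ Q + 1)
    (hXR : ∀ j i, Integrable (fun ω => |X j i ω| ^ (Q + 1)) μ) (hf : TameUpTo (p + 2) Q f)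
    (heven : ∀ w, f (-w) = f w)
    (htop : ∀ l : List (Fin d), l.length = p + 2 → ∀ w, |iterPartial l f w| ≤ H * polyDom A B r w)
    {ε : ℝ} {φ : (Fin d → ℝ) → ℝ} (hε : 0 < ε) (hε1 : ε ≤ 1) (hφ : IsMollifier ε φ) :
    Tame Q (mollify φ f) ∧
    |∫ ω, mollify φ f (sumVec X ω) ∂μ - ∫ z, mollify φ f z ∂stdNormal d| ≤
      evenBound μ p (A + B * ∑ m, rpowShift (r m) ε) (B * (1 + Real.sqrt ε) ^ Q) r X H := by
  have hcont : Continuous f := hf.continuous_iterPartial hQ (l := []) (by simp)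
  obtain ⟨C, hC, hgr⟩ := hf.growth [] (by simp)
  have hF : Tame Q (mollify φ f) := tame_mollify hφ.contDiff hφ.compact hcont hQ hC hgr
  refine ⟨hF, ?_⟩
  have hp' : (2 : ℝ) ≤ p := by exact_mod_cast hp
  have hA' : 0 ≤ A + B * ∑ m, rpowShift (r m) ε :=
    add_nonneg hA (mul_nonneg hB (Finset.sum_nonneg fun m _ => rpowShift_nonneg hε.le))
  refine hX.abs_integral_sub_le_of_tame hp hpe hr hA' (by positivity) hH hQ hpQ hrQ hXR hF
    (hφ.mollify_even heven) fun l hl w => ?_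
  rw [hf.iterPartial_mollify hφ hε1 hQ hl.le]
  refine hφ.abs_integral_mul_le (g := fun t => iterPartial l f (w - t)) fun t ht =>
    (htop l hl _).trans (mul_le_mul_of_nonneg_left ?_ hH)
  exact polyDom_sub_le hB hr (fun m => by linarith [hrQ m]) hε w ht

/-- Mollification changes both expectations by a multiple of `ε`, and the explicit bound is
continuous in its coefficients, so the bound for the mollified function passes to the limit. -/
theorem MatchingArray.abs_integral_sub_le_of_tameUpTo (hX : MatchingArray μ p r n X) (hp : 2 ≤ p)
    (hpe : Even p)
    (hr : ∀ m, 0 ≤ r m) (hA : 0 ≤ A) (hB : 0 ≤ B) (hH : 0 ≤ H) (hQ : 0 ≤ Q)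
    (hpQ : (p : ℝ) + 2 ≤ Q + 1) (hrQ : ∀ m, r m + (p + 2) ≤ Q + 1)
    (hXR : ∀ j i, Integrable (fun ω => |X j i ω| ^ (Q + 1)) μ) (hf : TameUpTo (p + 2) Q f)
    (heven : ∀ w, f (-w) = f w)
    (htop : ∀ l : List (Fin d), l.length = p + 2 → ∀ w, |iterPartial l f w| ≤ H * polyDom A B r w) :
    Integrable (fun ω => f (sumVec X ω)) μ ∧ Integrable f (stdNormal d) ∧
    |∫ ω, f (sumVec X ω) ∂μ - ∫ z, f z ∂stdNormal d| ≤ evenBound μ p A B r X H := by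
  have hcont : Continuous f := hf.continuous_iterPartial hQ (l := []) (by simp)
  obtain ⟨C, hC, hgr⟩ := hf.growth [] (by simp)
  obtain ⟨K, hK, hKb⟩ := hf.abs_mollify_sub_le (by omega) hQ
  have hWQ' := hX.integrable_sumVec (by linarith) hXR
  have hWQ := integrable_one_add_norm_of_le hX.measurable_sumVec (by linarith : Q ≤ Q + 1) hWQ'
  have hZQ := integrable_one_add_norm_rpow (d := d) hQ
  have hi1 := integrable_comp_of_growth hX.measurable_sumVec hWQ hcont.measurable hgr
  have hi2 : Integrable f (stdNormal d) := integrable_comp_of_growth (W := fun z : Fin d → ℝ => z)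
    measurable_id hZQ hcont.measurable hgr
  refine ⟨hi1, hi2, ?_⟩
  set M1 := ∫ ω, (1 + ‖sumVec X ω‖) ^ Q ∂μ with hM1
  set M2 := ∫ z, (1 + ‖z‖) ^ Q ∂stdNormal d with hM2
  have hb1 : Continuous fun ε => evenBound μ p (A + B * ∑ m, rpowShift (r m) ε)
      (B * (1 + Real.sqrt ε) ^ Q) r X H := by
    refine continuous_evenBound ?_ ?_
    · exact continuous_const.add (continuous_const.mul
        (continuous_finsetSum _ fun m _ => continuous_rpowShift (hr m)))
    · exact continuous_const.mul
        ((by fun_prop : Continuous fun ε : ℝ => 1 + Real.sqrt ε).rpow_const fun _ => Or.inr hQ)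
  have hb : Continuous fun ε => ε * K * M1 + ε * K * M2 +
      evenBound μ p (A + B * ∑ m, rpowShift (r m) ε) (B * (1 + Real.sqrt ε) ^ Q) r X H :=
    (by fun_prop : Continuous fun ε => ε * K * M1 + ε * K * M2).add hb1
  have hlim := (hb.tendsto 0).mono_left (nhdsWithin_le_nhds (s := Set.Ioi 0))
  simp only [rpowShift_zero, Real.sqrt_zero, Finset.sum_const_zero, mul_zero, zero_mul, add_zero,
    Real.one_rpow, mul_one, zero_add] at hlim
  refine ge_of_tendsto hlim ?_
  filter_upwards [Ioc_mem_nhdsGT (zero_lt_one (α := ℝ))] with ε hε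
  obtain ⟨φ, hφ⟩ := exists_isMollifier (E := Fin d → ℝ) hε.1
  obtain ⟨hF, hmain⟩ := hX.abs_integral_mollify_sub_le hp hpe hr hA hB hH hQ hpQ hrQ hXR hf heven
    htop hε.1 hε.2 hφ
  have hd1 := abs_integral_sub_le_of_abs_sub_le (hF.integrable_comp hX.measurable_sumVec hWQ') hi1
    (hWQ.const_mul (ε * K)) fun ω => hKb ε φ hε.1 hε.2 hφ (sumVec X ω)
  have hd2 := abs_integral_sub_le_of_abs_sub_le (hF.integrable_comp (W := fun z : Fin d → ℝ => z)
    measurable_id (integrable_one_add_norm_rpow (d := d) (by linarith : 0 ≤ Q + 1))) hi2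
    (hZQ.const_mul (ε * K)) fun z => hKb ε φ hε.1 hε.2 hφ z
  rw [integral_const_mul] at hd1 hd2
  rw [abs_sub_comm] at hd1
  refine (abs_sub_le _ (∫ ω, mollify φ f (sumVec X ω) ∂μ) _).trans ?_
  have h3 := abs_sub_le (∫ ω, mollify φ f (sumVec X ω) ∂μ) (∫ z, mollify φ f z ∂stdNormal d)
    (∫ z, f z ∂stdNormal d)
  linarith

end

/-! ### Faà di Bruno's formula for iterated partial derivatives -/

section
variable {α : Type*}

/-- The families of blocks obtained by adding `i` to one block of `π`. -/
def addToBlock (i : α) : List (List α) → List (List (List α))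
  | [] => []
  | b :: π => ((i :: b) :: π) :: (addToBlock i π).map (b :: ·)

/-- The partitions of the positions of a list into blocks. -/
def blockPartitions : List α → List (List (List α))
  | [] => [[]]
  | i :: l => (blockPartitions l).flatMap fun π => ([i] :: π) :: addToBlock i π

lemma length_addToBlock (i : α) (π : List (List α)) : (addToBlock i π).length = π.length := by
  induction π with
  | nil => rfl
  | cons b π ih => simp [addToBlock, ih]

lemma mem_addToBlock {i : α} {π π' : List (List α)} (h : π' ∈ addToBlock i π) :
    π'.length = π.length ∧ (π'.map List.length).sum = (π.map List.length).sum + 1 ∧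
      ((∀ b ∈ π, b ≠ []) → ∀ b ∈ π', b ≠ []) := by
  induction π generalizing π' with
  | nil => simp [addToBlock] at h
  | cons b π ih =>
    simp only [addToBlock, List.mem_cons, List.mem_map] at h
    rcases h with rfl | ⟨π'', h, rfl⟩
    · refine ⟨by simp, by simp; omega, fun hb c hc => ?_⟩
      rcases List.mem_cons.1 hc with rfl | hc
      · simp
      · exact hb c (List.mem_cons_of_mem _ hc)
    · obtain ⟨h1, h2, h3⟩ := ih h
      refine ⟨by simp [h1], by simp [h2]; omega, fun hb c hc => ?_⟩
      rcases List.mem_cons.1 hc with rfl | hc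
      · exact hb _ (by simp)
      · exact h3 (fun b hb' => hb b (List.mem_cons_of_mem _ hb')) c hc

lemma mem_blockPartitions {l : List α} {π : List (List α)} (h : π ∈ blockPartitions l) :
    (π.map List.length).sum = l.length ∧ ∀ b ∈ π, b ≠ [] := by
  induction l generalizing π with
  | nil => simp [blockPartitions] at h; simp [h]
  | cons i l ih =>
    simp only [blockPartitions, List.mem_flatMap, List.mem_cons] at h
    obtain ⟨π', h', rfl | h⟩ := h
    · obtain ⟨h1, h2⟩ := ih h'
      refine ⟨by simp [h1]; omega, fun b hb => ?_⟩
      rcases List.mem_cons.1 hb with rfl | hb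
      · simp
      · exact h2 b hb
    · obtain ⟨h1, h2⟩ := ih h'
      obtain ⟨_, h3, h4⟩ := mem_addToBlock h
      exact ⟨by simp [h3, h1], h4 h2⟩

lemma List.sum_map_flatMap {β γ : Type*} (l : List β) (f : β → List γ) (g : γ → ℝ) :
    ((l.flatMap f).map g).sum = (l.map fun x => ((f x).map g).sum).sum := by
  induction l with
  | nil => simp
  | cons a l ih => simp [ih]

/-- A partition into `k` blocks extends by one element in one way with a new block and in `k` ways
within an old one: this is the recursion of the Stirling numbers. -/
lemma sum_blockPartitions (l : List α) (a : ℕ → ℝ) :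
    ((blockPartitions l).map fun π => a π.length).sum =
      ∑ k ∈ Finset.range (l.length + 1), (Nat.stirlingSecond l.length k : ℝ) * a k := by
  induction l generalizing a with
  | nil => simp [blockPartitions]
  | cons i l ih =>
    rw [blockPartitions, List.sum_map_flatMap]
    have e : ∀ π : List (List α), ((([i] :: π) :: addToBlock i π).map fun π => a π.length).sum =
        a (π.length + 1) + π.length * a π.length := by
      intro π
      rw [List.map_cons, List.sum_cons, List.length_cons]
      have : (addToBlock i π).map (fun π => a π.length) =
          (addToBlock i π).map fun _ => a π.length :=
        List.map_congr_left fun π' h => by rw [(mem_addToBlock h).1]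
      rw [this]
      simp [length_addToBlock]
    simp only [e]
    rw [ih fun k => a (k + 1) + k * a k, List.length_cons]
    simp only [mul_add, Finset.sum_add_distrib]
    rw [Finset.sum_range_succ' _ (l.length + 1)]
    simp only [Nat.stirlingSecond_succ_succ, Nat.stirlingSecond_succ_zero]
    push_cast
    simp only [fun k : ℕ => add_mul (((k : ℝ) + 1) * (Nat.stirlingSecond l.length (k + 1) : ℝ))
      (Nat.stirlingSecond l.length k : ℝ) (a (k + 1)), Finset.sum_add_distrib, zero_mul, add_zero]
    rw [add_comm]
    congr 1
    rw [Finset.sum_range_succ' (fun k => (Nat.stirlingSecond l.length k : ℝ) * (k * a k)),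
      Finset.sum_range_succ (fun k => ((k : ℝ) + 1) * (Nat.stirlingSecond l.length (k + 1) : ℝ) *
        a (k + 1)) l.length, Nat.stirlingSecond_eq_zero_of_lt (Nat.lt_succ_self _)]
    simp only [Nat.cast_zero, zero_mul, mul_zero, add_zero]
    refine Finset.sum_congr rfl fun k _ => ?_
    push_cast
    ring
end

section
variable {d N : ℕ} {Q : ℝ} {g : (Fin d → ℝ) → ℝ} {h : ℝ → ℝ}

/-- The right-hand side of Faà di Bruno's formula. -/
def compPartial (h : ℝ → ℝ) (g : (Fin d → ℝ) → ℝ) (l : List (Fin d)) (w : Fin d → ℝ) : ℝ :=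
  ((blockPartitions l).map fun π => iteratedDeriv π.length h (g w) *
    (π.map fun b => iterPartial b g w).prod).sum

lemma hasDerivAt_list_sum {β : Type*} {F : β → ℝ → ℝ} {F' : β → ℝ} {t : ℝ} (L : List β)
    (hF : ∀ x ∈ L, HasDerivAt (F x) (F' x) t) :
    HasDerivAt (fun t => (L.map fun x => F x t).sum) (L.map F').sum t := by
  induction L with
  | nil => simpa using hasDerivAt_const t (0 : ℝ)
  | cons x L ih =>
    simp only [List.map_cons, List.sum_cons]
    exact (hF x (by simp)).add (ih fun y hy => hF y (List.mem_cons_of_mem _ hy))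

/-- The product rule: the factor that is differentiated receives the index `i` in its block. -/
lemma hasLineDerivAt_prod (i : Fin d) (w : Fin d → ℝ) (π : List (List (Fin d)))
    (hg : ∀ b ∈ π, LineDifferentiableAt ℝ (iterPartial b g) w (Pi.single i 1)) :
    HasLineDerivAt ℝ (fun w => (π.map fun b => iterPartial b g w).prod)
      ((addToBlock i π).map fun π' => (π'.map fun b => iterPartial b g w).prod).sum w
      (Pi.single i 1) := by
  induction π with
  | nil =>
    unfold HasLineDerivAt
    simpa [addToBlock] using hasDerivAt_const (0 : ℝ) (1 : ℝ)
  | cons b π ih =>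
    have h1 := (hg b (by simp)).hasLineDerivAt
    have h2 := ih fun c hc => hg c (List.mem_cons_of_mem _ hc)
    unfold HasLineDerivAt at h1 h2 ⊢
    have h3 := h1.mul h2
    simp only [zero_smul, add_zero] at h3
    simp only [addToBlock, List.map_cons, List.prod_cons, List.sum_cons, List.map_map,
      Function.comp_def, List.sum_map_mul_left]
    exact h3

/-- Differentiating the outer derivative opens the new block `[i]`; differentiating the product
enlarges an old block. -/
lemma hasLineDerivAt_compPartial (hh : ContDiff ℝ (⊤ : ℕ∞) h)
    (hg : ∀ l : List (Fin d), l.length < N → ∀ i w,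
      LineDifferentiableAt ℝ (iterPartial l g) w (Pi.single i 1)) {l : List (Fin d)}
    (hl : l.length < N) (i : Fin d) (w : Fin d → ℝ) :
    HasLineDerivAt ℝ (compPartial h g l) (compPartial h g (i :: l) w) w (Pi.single i 1) := by
  have hN : 0 < N := by omega
  have key : ∀ π ∈ blockPartitions l, HasDerivAt (fun t : ℝ =>
      iteratedDeriv π.length h (g (w + t • Pi.single i (1 : ℝ))) *
        (π.map fun b => iterPartial b g (w + t • Pi.single i (1 : ℝ))).prod)
      (((([i] :: π) :: addToBlock i π).map fun π' => iteratedDeriv π'.length h (g w) *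
        (π'.map fun b => iterPartial b g w).prod).sum) 0 := by
    intro π hπ
    have hlen : ∀ b ∈ π, b.length < N := fun b hb => by
      have h1 := (mem_blockPartitions hπ).1
      have h2 := List.single_le_sum (l := π.map List.length) (by simp) b.length
        (List.mem_map_of_mem hb)
      omega
    have h1 := hasLineDerivAt_prod i w π fun b hb => hg b (hlen b hb) i w
    have h2 : HasDerivAt (fun t : ℝ => g (w + t • Pi.single i (1 : ℝ))) (pd i g w) 0 :=
      (hg [] (by simpa using hN) i w).hasLineDerivAt
    unfold HasLineDerivAt at h1
    have h3 : HasDerivAt (iteratedDeriv π.length h) (iteratedDeriv (π.length + 1) h (g w)) (g w) := by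
      rw [iteratedDeriv_succ]
      exact ((hh.differentiable_iteratedDeriv π.length (by
        exact_mod_cast WithTop.coe_lt_top _)) _).hasDerivAt
    have h4 : HasDerivAt (fun t : ℝ => iteratedDeriv π.length h (g (w + t • Pi.single i (1 : ℝ))))
        (iteratedDeriv (π.length + 1) h (g w) * pd i g w) 0 := by
      refine HasDerivAt.comp (0 : ℝ) (h₂ := iteratedDeriv π.length h)
        (h := fun t : ℝ => g (w + t • Pi.single i (1 : ℝ))) ?_ h2
      simpa using h3
    have h5 := h4.mul h1
    simp only [zero_smul, add_zero] at h5
    have e : (addToBlock i π).map (fun π' => iteratedDeriv π'.length h (g w) *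
        (π'.map fun b => iterPartial b g w).prod) = (addToBlock i π).map fun π' =>
        iteratedDeriv π.length h (g w) * (π'.map fun b => iterPartial b g w).prod :=
      List.map_congr_left fun π' h => by rw [(mem_addToBlock h).1]
    rw [List.map_cons, List.sum_cons, e, List.sum_map_mul_left]
    simp only [List.map_cons, List.prod_cons, List.length_cons]
    rw [← mul_assoc]
    exact h5
  unfold HasLineDerivAt compPartial
  rw [blockPartitions, List.sum_map_flatMap]
  exact hasDerivAt_list_sum _ key

theorem iterPartial_comp_eq (hh : ContDiff ℝ (⊤ : ℕ∞) h)
    (hg : ∀ l : List (Fin d), l.length < N → ∀ i w,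
      LineDifferentiableAt ℝ (iterPartial l g) w (Pi.single i 1)) {l : List (Fin d)}
    (hl : l.length ≤ N) : iterPartial l (fun w => h (g w)) = compPartial h g l := by
  induction l with
  | nil => ext w; simp [compPartial, blockPartitions, iterPartial]
  | cons i l ih =>
    have hl' : l.length < N := by simpa using hl
    rw [iterPartial_cons, ih hl'.le]
    ext w
    exact (hasLineDerivAt_compPartial hh hg hl' i w).lineDeriv

/-- The exponents are proportional to block lengths, so they add up. Hence every partition of the
same list gets the same power of `P`, which is the purpose of the exponent `n / k` in `ClassCP`. -/
lemma abs_prod_iterPartial_le {P : ℝ} (hP : 0 ≤ P) {m : ℝ} (hm : 0 < m) (w : Fin d → ℝ)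
    (π : List (List (Fin d))) (hπ : ∀ b ∈ π, |iterPartial b g w| ≤ P ^ ((b.length : ℝ) / m)) :
    |(π.map fun b => iterPartial b g w).prod| ≤ P ^ (((π.map List.length).sum : ℝ) / m) := by
  induction π with
  | nil => simp
  | cons b π ih =>
    simp only [List.map_cons, List.prod_cons, List.sum_cons, abs_mul]
    rw [Nat.cast_add, add_div, Real.rpow_add_of_nonneg hP (by positivity) (by positivity)]
    exact mul_le_mul (hπ b (by simp)) (ih fun c hc => hπ c (List.mem_cons_of_mem _ hc))
      (abs_nonneg _) (by positivity)

lemma ClassCP.abs_iterPartial_le {P : (Fin d → ℝ) → ℝ} (hg : ClassCP N P g) {l : List (Fin d)}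
    (hl : 1 ≤ l.length) (hlN : l.length ≤ N) (w : Fin d → ℝ) :
    |iterPartial l g w| ≤ P w ^ ((l.length : ℝ) / N) := by
  have h := hg.bound l hl hlN w
  have h1 : (0 : ℝ) < l.length := by exact_mod_cast hl
  have h2 : (0 : ℝ) < N := by exact_mod_cast (by omega : 0 < N)
  have h3 := Real.rpow_le_rpow (by positivity) h (by positivity : 0 ≤ (l.length : ℝ) / N)
  rwa [← Real.rpow_mul (abs_nonneg _), div_mul_div_cancel₀ h1.ne', div_self h2.ne',
    Real.rpow_one] at h3

lemma List.abs_sum_le {β : Type*} (L : List β) (F b : β → ℝ) (h : ∀ x ∈ L, |F x| ≤ b x) :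
    |(L.map F).sum| ≤ (L.map b).sum := by
  induction L with
  | nil => simp
  | cons x L ih =>
    simp only [List.map_cons, List.sum_cons]
    exact (abs_add_le _ _).trans (add_le_add (h x (by simp))
      (ih fun y hy => h y (List.mem_cons_of_mem _ hy)))

theorem ClassCP.abs_iterPartial_comp_le {P : (Fin d → ℝ) → ℝ} (hg : ClassCP N P g)
    (hh : ContDiff ℝ (⊤ : ℕ∞) h) {c : ℕ → ℝ}
    (hc : ∀ k, 1 ≤ k → k ≤ N → ∀ x, |iteratedDeriv k h x| ≤ c k) {l : List (Fin d)}
    (hl : 1 ≤ l.length) (hlN : l.length ≤ N) (w : Fin d → ℝ) :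
    |iterPartial l (fun w => h (g w)) w| ≤
      (∑ k ∈ Finset.Icc 1 l.length, (Nat.stirlingSecond l.length k : ℝ) * c k) *
        P w ^ ((l.length : ℝ) / N) := by
  rw [iterPartial_comp_eq hh hg.exists_partial hlN, compPartial]
  have hN : (0 : ℝ) < N := by exact_mod_cast (by omega : 0 < N)
  have hP := hg.dom_nonneg w
  have h1 := List.abs_sum_le (blockPartitions l) (fun π => iteratedDeriv π.length h (g w) *
    (π.map fun b => iterPartial b g w).prod)
    (fun π => (fun k => c k * P w ^ ((l.length : ℝ) / N)) π.length) fun π hπ => by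
      obtain ⟨h2, h3⟩ := mem_blockPartitions hπ
      have hb : ∀ b ∈ π, 1 ≤ b.length ∧ b.length ≤ l.length := fun b hb =>
        ⟨List.length_pos_iff.2 (h3 b hb), by
          have := List.single_le_sum (l := π.map List.length) (by simp) b.length
            (List.mem_map_of_mem hb)
          omega⟩
      have hpos : 1 ≤ π.length := by
        rcases π with _ | ⟨b, π⟩
        · simp at h2; omega
        · simp
      have hle : π.length ≤ l.length := by
        rw [← h2]
        have := List.length_le_sum_of_one_le (π.map List.length) (by
          intro x hx
          obtain ⟨b, hb', rfl⟩ := List.mem_map.1 hx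
          exact (hb b hb').1)
        simpa using this
      have h4 := abs_prod_iterPartial_le (g := g) hP hN w π fun b hb' =>
        hg.abs_iterPartial_le (hb b hb').1 ((hb b hb').2.trans hlN) w
      rw [h2] at h4
      rw [abs_mul]
      have h5 := hc _ hpos (hle.trans hlN) (g w)
      exact mul_le_mul h5 h4 (abs_nonneg _) ((abs_nonneg _).trans h5)
  refine h1.trans (le_of_eq ?_)
  rw [sum_blockPartitions l fun k => c k * P w ^ ((l.length : ℝ) / N), Finset.sum_mul, Finset.range_eq_Ico,
    Finset.sum_eq_sum_Ico_succ_bot (by omega)]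
  obtain ⟨m, hm⟩ : ∃ m, l.length = m + 1 := ⟨l.length - 1, by omega⟩
  -- The list is nonempty, so it has no partition into zero blocks, and no bound on `h` itself is
  -- needed.
  have h0 : Nat.stirlingSecond l.length 0 = 0 := by rw [hm, Nat.stirlingSecond_succ_zero]
  rw [h0, Nat.cast_zero, zero_mul, zero_add, zero_add]
  have : Finset.Ico 1 (l.length + 1) = Finset.Icc 1 l.length := by ext; simp
  rw [this]
  refine Finset.sum_congr rfl fun k _ => ?_
  ring
end

/-! ### Mollifying the test function -/

section
variable {n : ℕ} {h φ : ℝ → ℝ} {ε : ℝ}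

lemma ClassCb.abs_iteratedDeriv_le (hh : ClassCb n h) {k : ℕ} (hk : 1 ≤ k) (hkn : k ≤ n) (x : ℝ) :
    |iteratedDeriv k h x| ≤ supNorm (iteratedDeriv k h) :=
  le_ciSup (f := fun x => |iteratedDeriv k h x|) (hh.bdd k hk hkn) x

lemma supNorm_nonneg (f : ℝ → ℝ) : 0 ≤ supNorm f := Real.iSup_nonneg fun _ => abs_nonneg _

lemma hConst_nonneg (n : ℕ) (h : ℝ → ℝ) : 0 ≤ hConst n h :=
  Finset.sum_nonneg fun _ _ => mul_nonneg (Nat.cast_nonneg _) (supNorm_nonneg _)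

lemma ClassCb.hasDerivAt (hh : ClassCb n h) {k : ℕ} (hk : k + 1 < n) (x : ℝ) :
    HasDerivAt (iteratedDeriv k h) (iteratedDeriv (k + 1) h x) x := by
  rw [iteratedDeriv_succ]
  exact ((hh.contDiff.differentiable_iteratedDeriv k (by
    exact_mod_cast (by omega : k < n - 1))) x).hasDerivAt

/-- At the top order the derivative may be missing on a null set. Absolute continuity still gives
the increment as the integral of `deriv`, which is zero at the missing points and hence obeys the
same bound. -/
lemma ClassCb.abs_sub_le (hh : ClassCb n h) {k : ℕ} (hk : k < n) (x y : ℝ) :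
    |iteratedDeriv k h x - iteratedDeriv k h y| ≤
      supNorm (iteratedDeriv (k + 1) h) * |x - y| := by
  rcases Nat.lt_or_ge (k + 1) n with hk' | hk'
  · exact convex_univ.norm_image_sub_le_of_norm_hasDerivWithin_le
      (fun t _ => (hh.hasDerivAt hk' t).hasDerivWithinAt)
      (fun t _ => hh.abs_iteratedDeriv_le (by omega) hk t) (Set.mem_univ y) (Set.mem_univ x)
  · obtain rfl : n = k + 1 := by omega
    have h1 := (hh.absCont y x).integral_deriv_eq_sub
    rw [Nat.add_sub_cancel] at h1
    rw [← h1]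
    refine intervalIntegral.norm_integral_le_of_norm_le_const (f := deriv (iteratedDeriv k h))
      fun t _ => ?_
    rw [← iteratedDeriv_succ]
    exact hh.abs_iteratedDeriv_le (by omega) le_rfl t

lemma ClassCb.continuous_iteratedDeriv (hh : ClassCb n h) {k : ℕ} (hk : k < n) :
    Continuous (iteratedDeriv k h) :=
  hh.contDiff.continuous_iteratedDeriv k (by exact_mod_cast (by omega : k ≤ n - 1))

lemma contDiff_mollify (hφ : IsMollifier ε φ) (hf : Continuous h) :
    ContDiff ℝ (⊤ : ℕ∞) (mollify φ h) := by
  rw [mollify_eq_convolution]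
  exact hφ.compact.contDiff_convolution_right _ hf.locallyIntegrable hφ.contDiff

lemma integrable_mul_shift (hφ : IsMollifier ε φ) (hf : Continuous h) (x : ℝ) :
    Integrable fun t => φ t * h (x - t) :=
  (hφ.contDiff.continuous.mul (by fun_prop)).integrable_of_hasCompactSupport hφ.compact.mul_right

lemma abs_mollify_sub_mollify_le (hφ : IsMollifier ε φ) (hf : Continuous h) {c : ℝ}
    (hc : ∀ x y, |h x - h y| ≤ c * |x - y|) (x y : ℝ) :
    |mollify φ h x - mollify φ h y| ≤ c * |x - y| := by
  rw [mollify, mollify, ← integral_sub (integrable_mul_shift hφ hf x)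
    (integrable_mul_shift hφ hf y)]
  simp only [← mul_sub]
  refine hφ.abs_integral_mul_le (g := fun t => h (x - t) - h (y - t)) fun t _ => ?_
  simpa using hc (x - t) (y - t)

lemma ClassCb.iteratedDeriv_mollify (hh : ClassCb n h) (hφ : IsMollifier ε φ) {k : ℕ}
    (hk : k < n) : iteratedDeriv k (mollify φ h) = mollify φ (iteratedDeriv k h) := by
  induction k with
  | zero => simp
  | succ k ih =>
    rw [iteratedDeriv_succ, ih (by omega)]
    ext x
    have hc := hh.continuous_iteratedDeriv (k := k) (by omega)
    have hc' := hh.continuous_iteratedDeriv hk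
    have key := hasDerivAt_integral_of_dominated_loc_of_deriv_le (μ := (volume : Measure ℝ))
      (F := fun x t => φ t * iteratedDeriv k h (x - t))
      (F' := fun x t => φ t * iteratedDeriv (k + 1) h (x - t)) (x₀ := x)
      (bound := fun t => φ t * supNorm (iteratedDeriv (k + 1) h)) (Metric.ball_mem_nhds x one_pos)
      (Filter.Eventually.of_forall fun x => (integrable_mul_shift hφ hc x).aestronglyMeasurable)
      (integrable_mul_shift hφ hc x) (integrable_mul_shift hφ hc' x).aestronglyMeasurable
      (Filter.Eventually.of_forall fun t s _ => hφ.abs_mul_le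
        (g := fun t => iteratedDeriv (k + 1) h (s - t))
        (fun t _ => hh.abs_iteratedDeriv_le (by omega) hk.le _) t) (hφ.integrable.mul_const _)
      (Filter.Eventually.of_forall fun t s _ =>
        ((hh.hasDerivAt hk (s - t)).comp_sub_const s t).const_mul _)
    exact key.2.deriv

/-- Convolution with a probability density preserves Lipschitz constants. Thus the bound reaches
order `n` without differentiating the `(n - 1)`-st derivative of `h` under the integral. -/
lemma ClassCb.abs_iteratedDeriv_mollify_le (hh : ClassCb n h) (hφ : IsMollifier ε φ) {k : ℕ}
    (hk : 1 ≤ k) (hkn : k ≤ n) (x : ℝ) :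
    |iteratedDeriv k (mollify φ h) x| ≤ supNorm (iteratedDeriv k h) := by
  obtain ⟨k, rfl⟩ : ∃ m, k = m + 1 := ⟨k - 1, by omega⟩
  rw [iteratedDeriv_succ, hh.iteratedDeriv_mollify hφ (by omega)]
  have h1 : LipschitzWith (Real.toNNReal (supNorm (iteratedDeriv (k + 1) h)))
      (mollify φ (iteratedDeriv k h)) := LipschitzWith.of_dist_le_mul fun x y => by
    rw [Real.dist_eq, Real.dist_eq, Real.coe_toNNReal _ (supNorm_nonneg _)]
    exact abs_mollify_sub_mollify_le hφ (hh.continuous_iteratedDeriv (by omega))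
      (hh.abs_sub_le (by omega)) x y
  have h2 := norm_deriv_le_of_lipschitz h1 (x₀ := x)
  rwa [Real.coe_toNNReal _ (supNorm_nonneg _)] at h2

lemma ClassCb.abs_mollify_sub_le (hh : ClassCb n h) (hn : 0 < n) (hφ : IsMollifier ε φ) (x : ℝ) :
    |mollify φ h x - h x| ≤ supNorm (iteratedDeriv 1 h) * ε := by
  have hc : Continuous h := by simpa using hh.continuous_iteratedDeriv hn
  refine hφ.abs_mollify_sub_le hc fun t ht => ?_
  have := hh.abs_sub_le hn (x - t) x
  simp only [iteratedDeriv_zero, zero_add, sub_sub_cancel_left, abs_neg] at this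
  exact this.trans (mul_le_mul_of_nonneg_left ht (supNorm_nonneg _))

end

/-! ### Growth of the composite function -/

section
variable {d N : ℕ} {A B ρ Q : ℝ} {r : Fin d → ℝ} {g : (Fin d → ℝ) → ℝ} {h : ℝ → ℝ}

lemma polyDom_le (hA : 0 ≤ A) (hB : 0 ≤ B) (hr : ∀ m, 0 ≤ r m) (hrρ : ∀ m, r m ≤ ρ) (hρ : 0 ≤ ρ)
    (w : Fin d → ℝ) : polyDom A B r w ≤ (A + B * d) * (1 + ‖w‖) ^ ρ := by
  have h1 : ∀ m, |w m| ^ r m ≤ (1 + ‖w‖) ^ ρ := fun m => by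
    have := norm_le_pi_norm w m
    rw [Real.norm_eq_abs] at this
    exact (Real.rpow_le_rpow (abs_nonneg _) (by linarith) (hr m)).trans
      (Real.rpow_le_rpow_of_exponent_le (by linarith [norm_nonneg w]) (hrρ m))
  have h2 := Finset.sum_le_sum fun m (_ : m ∈ Finset.univ) => h1 m
  rw [Finset.sum_const, Finset.card_univ, Fintype.card_fin, nsmul_eq_mul] at h2
  have h3 : A ≤ A * (1 + ‖w‖) ^ ρ :=
    le_mul_of_one_le_right hA (Real.one_le_rpow (by linarith [norm_nonneg w]) hρ)
  have h4 := mul_le_mul_of_nonneg_left h2 hB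
  unfold polyDom
  linarith

lemma polyDom_rpow_le (hA : 0 ≤ A) (hB : 0 ≤ B) (hr : ∀ m, 0 ≤ r m) (hrρ : ∀ m, r m ≤ ρ)
    (hρ : 0 ≤ ρ) {θ : ℝ} (hθ : 0 ≤ θ) (hθ1 : θ ≤ 1) (w : Fin d → ℝ) :
    polyDom A B r w ^ θ ≤ (1 + (A + B * d)) * (1 + ‖w‖) ^ ρ := by
  have h0 : 0 ≤ polyDom A B r w := by unfold polyDom; positivity
  have h1 := polyDom_le hA hB hr hrρ hρ w
  have h2 : polyDom A B r w ^ θ ≤ 1 + polyDom A B r w := by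
    calc _ ≤ (1 + polyDom A B r w) ^ θ := Real.rpow_le_rpow h0 (by linarith) hθ
      _ ≤ (1 + polyDom A B r w) ^ (1 : ℝ) :=
        Real.rpow_le_rpow_of_exponent_le (by linarith) hθ1
      _ = _ := Real.rpow_one _
  have h3 : 1 ≤ (1 + ‖w‖) ^ ρ := Real.one_le_rpow (by linarith [norm_nonneg w]) hρ
  linarith

lemma one_add_norm_rpow_le_rpow {E : Type*} [NormedAddCommGroup E] {a b : ℝ} (h : a ≤ b) (w : E) :
    (1 + ‖w‖) ^ a ≤ (1 + ‖w‖) ^ b :=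
  Real.rpow_le_rpow_of_exponent_le (by linarith [norm_nonneg w]) h

lemma growth_of_pd_growth {f : (Fin d → ℝ) → ℝ} {C : ℝ} (hC : 0 ≤ C) (hρ : 0 ≤ ρ)
    (hQ : ρ + 1 ≤ Q) (hd : ∀ i w, LineDifferentiableAt ℝ f w (Pi.single i 1))
    (hb : ∀ i w, |pd i f w| ≤ C * (1 + ‖w‖) ^ ρ) (w : Fin d → ℝ) :
    |f w| ≤ (|f 0| + d * C) * (1 + ‖w‖) ^ Q := by
  have h1 := abs_sub_le_of_pd_growth hC hρ hd hb (x := w) (y := 0) le_rfl (by simp)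
  rw [sub_zero] at h1
  have h2 : (1 + ‖w‖) ^ ρ * ‖w‖ ≤ (1 + ‖w‖) ^ Q := by
    refine le_trans ?_ (one_add_norm_rpow_le_rpow hQ w)
    rw [Real.rpow_add_one (by positivity)]
    gcongr
    linarith
  have h3 : 1 ≤ (1 + ‖w‖) ^ Q := Real.one_le_rpow (by linarith [norm_nonneg w]) (by linarith)
  have h4 := abs_sub_abs_le_abs_sub (f w) (f 0)
  have h5 := mul_le_mul_of_nonneg_left h2 (by positivity : 0 ≤ d * C)
  have h6 := mul_le_mul_of_nonneg_left h3 (abs_nonneg (f 0))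
  linarith

lemma ClassCP.continuous (hg : ClassCP N (polyDom A B r) g) (hN : 0 < N) (hA : 0 ≤ A) (hB : 0 ≤ B)
    (hr : ∀ m, 0 ≤ r m) (hrρ : ∀ m, r m ≤ ρ) (hρ : 0 ≤ ρ) : Continuous g := by
  refine continuous_of_pd_growth (C := 1 + (A + B * d)) (Q := ρ) (by positivity) hρ
    (hg.exists_partial [] hN) fun i w => ?_
  refine (hg.abs_iterPartial_le (l := [i]) (by simp) (by simp; omega) w).trans
    (polyDom_rpow_le hA hB hr hrρ hρ (by positivity) ?_ w)
  have : (1 : ℝ) ≤ N := by exact_mod_cast hN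
  simpa using inv_le_one_of_one_le₀ this

lemma ClassCP.tameUpTo_comp (hg : ClassCP N (polyDom A B r) g) (hN : 0 < N) (hA : 0 ≤ A)
    (hB : 0 ≤ B) (hr : ∀ m, 0 ≤ r m) (hrρ : ∀ m, r m ≤ ρ) (hρ : 0 ≤ ρ) (hQ : ρ + 1 ≤ Q)
    (hh : ContDiff ℝ (⊤ : ℕ∞) h) {c : ℕ → ℝ}
    (hc : ∀ k, 1 ≤ k → k ≤ N → ∀ x, |iteratedDeriv k h x| ≤ c k) :
    TameUpTo N Q fun w => h (g w) := by
  have hN' : (1 : ℝ) ≤ N := by exact_mod_cast hN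
  have hdiff : ∀ l : List (Fin d), l.length < N → ∀ i w,
      LineDifferentiableAt ℝ (iterPartial l fun w => h (g w)) w (Pi.single i 1) := by
    intro l hl i w
    rw [iterPartial_comp_eq hh hg.exists_partial hl.le]
    exact (hasLineDerivAt_compPartial hh hg.exists_partial hl i w).lineDifferentiableAt
  have hgr : ∀ l : List (Fin d), 1 ≤ l.length → l.length ≤ N → ∃ C, 0 ≤ C ∧
      ∀ w, |iterPartial l (fun w => h (g w)) w| ≤ C * (1 + ‖w‖) ^ ρ := by
    intro l hl hlN
    set K := ∑ k ∈ Finset.Icc 1 l.length, (Nat.stirlingSecond l.length k : ℝ) * c k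
    have hK : 0 ≤ K := Finset.sum_nonneg fun k hk => by
      rw [Finset.mem_Icc] at hk
      exact mul_nonneg (Nat.cast_nonneg _)
        ((abs_nonneg _).trans (hc k hk.1 (hk.2.trans hlN) 0))
    refine ⟨K * (1 + (A + B * d)), by positivity, fun w => ?_⟩
    rw [mul_assoc]
    refine (hg.abs_iterPartial_comp_le hh hc hl hlN w).trans (mul_le_mul_of_nonneg_left ?_ hK)
    refine polyDom_rpow_le hA hB hr hrρ hρ (by positivity) ?_ w
    rw [div_le_one (by linarith)]
    exact_mod_cast hlN
  refine ⟨hdiff, fun l hlN => ?_⟩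
  -- The composite itself has no assumed bound; integrating its first derivatives costs one power of
  -- `1 + ‖w‖`, which is why `ρ + 1 ≤ Q` is required.
  rcases l with _ | ⟨i, l⟩
  · choose C hC hb using fun i : Fin d => hgr [i] (by simp) (by simp; omega)
    have hC' : 0 ≤ ∑ i, C i := Finset.sum_nonneg fun i _ => hC i
    refine ⟨_, by positivity, growth_of_pd_growth hC' hρ hQ (hdiff [] hN) fun i w => (hb i w).trans ?_⟩
    gcongr
    exact Finset.single_le_sum (fun i _ => hC i) (Finset.mem_univ i)
  · obtain ⟨C, hC, hb⟩ := hgr (i :: l) (by simp) hlN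
    exact ⟨C, hC, fun w => (hb w).trans (mul_le_mul_of_nonneg_left
      (one_add_norm_rpow_le_rpow (by linarith) w) hC)⟩

/-- When `d = 0` no exponent attains the maximum, but there is no summand either; so attainment is
claimed only in the presence of an index. -/
lemma exists_max_exponent (hr : ∀ m, 0 ≤ r m) :
    ∃ ρ, 0 ≤ ρ ∧ (∀ m, r m ≤ ρ) ∧ ∀ _ : Fin d, ∃ l, ρ = r l := by
  rcases isEmpty_or_nonempty (Fin d) with he | hne
  · exact ⟨0, le_rfl, fun m => he.elim m, fun j => he.elim j⟩
  · obtain ⟨l, hl⟩ := Finite.exists_max r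
    exact ⟨r l, hr l, hl, fun _ => ⟨l, rfl⟩⟩
end

/-! ### The bound for composites with a test function of class `C_b` -/

section
variable {Ω : Type*} {d p : ℕ} {r : Fin d → ℝ} {n : Fin d → ℕ}
  {X : (j : Fin d) → Fin (n j) → Ω → ℝ} [MeasurableSpace Ω] {μ : Measure Ω}
  [IsProbabilityMeasure μ] {A B : ℝ} {g : (Fin d → ℝ) → ℝ} {h : ℝ → ℝ}

lemma MatchingArray.abs_integral_mollify_comp_sub_le (hX : MatchingArray μ p r n X) (hp : 2 ≤ p)
    (hpe : Even p) (hr : ∀ m, 0 ≤ r m) (hA : 0 ≤ A) (hB : 0 ≤ B)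
    (hg : ClassCP (p + 2) (polyDom A B r) g) (heven : ∀ w, g (-w) = g w)
    (hh : ClassCb (p + 2) h) {ε : ℝ} {φ : ℝ → ℝ} (hφ : IsMollifier ε φ) :
    Integrable (fun ω => mollify φ h (g (sumVec X ω))) μ ∧
    Integrable (fun z => mollify φ h (g z)) (stdNormal d) ∧
    |∫ ω, mollify φ h (g (sumVec X ω)) ∂μ - ∫ z, mollify φ h (g z) ∂stdNormal d| ≤
      evenBound μ p A B r X (hConst (p + 2) h) := by
  obtain ⟨ρ, hρ, hrρ, hmax⟩ := exists_max_exponent hr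
  have hp' : (2 : ℝ) ≤ p := by exact_mod_cast hp
  have hc : Continuous h := by simpa using hh.continuous_iteratedDeriv (k := 0) (by omega)
  have hsm := contDiff_mollify hφ hc
  have hb : ∀ k, 1 ≤ k → k ≤ p + 2 → ∀ x, |iteratedDeriv k (mollify φ h) x| ≤
    supNorm (iteratedDeriv k h) := fun k h1 h2 => hh.abs_iteratedDeriv_mollify_le hφ h1 h2
  -- The choice `Q = ρ + p + 1` makes `Q + 1` the largest exponent for which moments are assumed
  -- finite.
  refine hX.abs_integral_sub_le_of_tameUpTo (Q := ρ + p + 1) (f := fun w => mollify φ h (g w)) hp hpe hr hA hB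
    (hConst_nonneg _ _) (by positivity) (by linarith) (fun m => by linarith [hrρ m]) (fun j i => ?_)
    (hg.tameUpTo_comp (by omega) hA hB hr hrρ hρ (by linarith) hsm hb)
    (fun w => by rw [heven]) fun l hl w => ?_
  · obtain ⟨l, hl⟩ := hmax j
    have := hX.integrable j i l
    rw [← hl] at this
    rwa [show ρ + p + 2 = ρ + p + 1 + 1 by ring] at this
  · have := hg.abs_iterPartial_comp_le hsm hb (by omega) hl.le w
    rwa [hl, div_self (by positivity), Real.rpow_one] at this

theorem MatchingArray.abs_integral_comp_sub_le (hX : MatchingArray μ p r n X) (hp : 2 ≤ p)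
    (hpe : Even p) (hr : ∀ m, 0 ≤ r m) (hA : 0 ≤ A) (hB : 0 ≤ B)
    (hg : ClassCP (p + 2) (polyDom A B r) g) (heven : ∀ w, g (-w) = g w)
    (hh : ClassCb (p + 2) h) :
    Integrable (fun ω => h (g (sumVec X ω))) μ ∧ Integrable (fun z => h (g z)) (stdNormal d) ∧
    |∫ ω, h (g (sumVec X ω)) ∂μ - ∫ z, h (g z) ∂stdNormal d| ≤
      evenBound μ p A B r X (hConst (p + 2) h) := by
  obtain ⟨ρ, hρ, hrρ, -⟩ := exists_max_exponent hr
  have hgc : Continuous g := hg.continuous (by omega) hA hB hr hrρ hρ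
  have hc : Continuous h := by simpa using hh.continuous_iteratedDeriv (k := 0) (by omega)
  set c := supNorm (iteratedDeriv 1 h) with hcdef
  have hd : ∀ {ε : ℝ} {φ : ℝ → ℝ}, IsMollifier ε φ → ∀ x, |mollify φ h x - h x| ≤ c * ε :=
    fun hφ => hh.abs_mollify_sub_le (by omega) hφ
  -- Any fixed radius gives integrability, since `h` stays within a constant of its mollification.
  obtain ⟨φ, hφ⟩ := exists_isMollifier (E := ℝ) one_pos
  have hmg : Measurable fun ω => h (g (sumVec X ω)) :=
    (hc.measurable.comp hgc.measurable).comp hX.measurable_sumVec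
  have hdom : ∀ x, ‖h x‖ ≤ ‖mollify φ h x‖ + c * 1 := fun x => by
    have h1 := hd hφ x
    have h2 := abs_sub_abs_le_abs_sub (h x) (mollify φ h x)
    rw [abs_sub_comm] at h2
    rw [Real.norm_eq_abs, Real.norm_eq_abs]
    linarith
  obtain ⟨i1, i2, -⟩ := hX.abs_integral_mollify_comp_sub_le hp hpe hr hA hB hg heven hh hφ
  have j1 : Integrable (fun ω => h (g (sumVec X ω))) μ :=
    (i1.norm.add (integrable_const (c * 1))).mono' hmg.aestronglyMeasurable
      (Filter.Eventually.of_forall fun ω => hdom _)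
  have j2 : Integrable (fun z => h (g z)) (stdNormal d) :=
    (i2.norm.add (integrable_const (c * 1))).mono' (hc.comp hgc).aestronglyMeasurable
      (Filter.Eventually.of_forall fun ω => hdom _)
  refine ⟨j1, j2, ?_⟩
  -- Mollifying `h` does not increase `hConst`, so the bound itself is independent of `ε`; only the
  -- uniform approximation errors have to vanish.
  have hlim : Filter.Tendsto (fun ε : ℝ => c * ε + c * ε +
      evenBound μ p A B r X (hConst (p + 2) h)) (nhdsWithin 0 (Set.Ioi 0))
      (nhds (evenBound μ p A B r X (hConst (p + 2) h))) := by
    have : Continuous fun ε : ℝ => c * ε + c * ε + evenBound μ p A B r X (hConst (p + 2) h) := by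
      fun_prop
    have := (this.tendsto 0).mono_left (nhdsWithin_le_nhds (s := Set.Ioi 0))
    simpa using this
  refine ge_of_tendsto hlim ?_
  filter_upwards [self_mem_nhdsWithin] with ε hε
  obtain ⟨φ, hφ⟩ := exists_isMollifier (E := ℝ) (Set.mem_Ioi.1 hε)
  obtain ⟨i1, i2, hmain⟩ := hX.abs_integral_mollify_comp_sub_le hp hpe hr hA hB hg heven hh hφ
  have hd1 := abs_integral_sub_le_of_abs_sub_le i1 j1 (integrable_const (c * ε))
    fun ω => hd hφ _
  have hd2 := abs_integral_sub_le_of_abs_sub_le i2 j2 (integrable_const (c * ε))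
    fun z => hd hφ _
  simp only [integral_const, probReal_univ, one_smul] at hd1 hd2
  rw [abs_sub_comm] at hd1
  refine (abs_sub_le _ (∫ ω, mollify φ h (g (sumVec X ω)) ∂μ) _).trans ?_
  have h3 := abs_sub_le (∫ ω, mollify φ h (g (sumVec X ω)) ∂μ)
    (∫ z, mollify φ h (g z) ∂stdNormal d) (∫ z, h (g z) ∂stdNormal d)
  linarith

end

/-! ### Moments of sums and the order of the bound -/

/-- The larger of `|s|` and `|x|` takes over the intermediate powers. -/
lemma abs_pow_mul_abs_pow_le (s x : ℝ) {a b m : ℕ} (h : a + b = m) :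
    |s| ^ a * |x| ^ (b + 2) ≤ |s| ^ m * |x| ^ 2 + |x| ^ (m + 2) := by
  subst h
  rcases le_total |s| |x| with h | h
  · have h1 : |s| ^ a * |x| ^ (b + 2) ≤ |x| ^ a * |x| ^ (b + 2) := by gcongr
    have h2 : 0 ≤ |s| ^ (a + b) * |x| ^ 2 := by positivity
    calc _ ≤ |x| ^ a * |x| ^ (b + 2) := h1
      _ = |x| ^ (a + b + 2) := by ring
      _ ≤ _ := by linarith
  · have h1 : |s| ^ a * (|x| ^ b * |x| ^ 2) ≤ |s| ^ a * (|s| ^ b * |x| ^ 2) := by gcongr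
    have h2 : 0 ≤ |x| ^ (a + b + 2) := by positivity
    calc _ = |s| ^ a * (|x| ^ b * |x| ^ 2) := by ring
      _ ≤ |s| ^ a * (|s| ^ b * |x| ^ 2) := h1
      _ = |s| ^ (a + b) * |x| ^ 2 := by ring
      _ ≤ _ := by linarith

/-- The linear term is kept exactly, since it has mean zero when a centred independent summand is
added; the remaining binomial coefficients sum to at most `2 ^ (m + 2)`. -/
lemma add_pow_le_second_order (s x : ℝ) (m : ℕ) :
    (s + x) ^ (m + 2) ≤ s ^ (m + 2) + (m + 2) * (s ^ (m + 1) * x) +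
      2 ^ (m + 2) * (|s| ^ m * |x| ^ 2 + |x| ^ (m + 2)) := by
  rw [add_comm s x, add_pow, Finset.sum_range_succ', Finset.sum_range_succ']
  have h1 : ∑ k ∈ Finset.range (m + 1), x ^ (k + 1 + 1) * s ^ (m + 2 - (k + 1 + 1)) *
      ((m + 2).choose (k + 1 + 1) : ℝ) ≤
      ∑ k ∈ Finset.range (m + 1), ((m + 2).choose (k + 1 + 1) : ℝ) *
        (|s| ^ m * |x| ^ 2 + |x| ^ (m + 2)) := by
    refine Finset.sum_le_sum fun k hk => ?_
    rw [Finset.mem_range] at hk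
    rw [mul_comm]
    refine mul_le_mul_of_nonneg_left ((le_abs_self _).trans ?_) (Nat.cast_nonneg _)
    rw [abs_mul, abs_pow, abs_pow, mul_comm]
    exact abs_pow_mul_abs_pow_le s x (by omega)
  have h2 : ∑ k ∈ Finset.range (m + 1), ((m + 2).choose (k + 1 + 1) : ℝ) ≤ 2 ^ (m + 2) := by
    have h3 := Nat.sum_range_choose (m + 2)
    rw [Finset.sum_range_succ', Finset.sum_range_succ'] at h3
    have h4 : ∑ k ∈ Finset.range (m + 1), (m + 2).choose (k + 1 + 1) ≤ 2 ^ (m + 2) := by omega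
    exact_mod_cast h4
  rw [← Finset.sum_mul] at h1
  have h3 := mul_le_mul_of_nonneg_right h2
    (by positivity : 0 ≤ |s| ^ m * |x| ^ 2 + |x| ^ (m + 2))
  simp only [zero_add, pow_one, Nat.choose_one_right, pow_zero, Nat.choose_zero_right,
    Nat.cast_one, mul_one, one_mul, Nat.sub_zero]
  have e : m + 2 - 1 = m + 1 := by omega
  have e2 : ∀ k, m + 2 - (k + 1 + 1) = m - k := fun k => by omega
  simp only [e2] at h1 ⊢
  rw [e]
  push_cast
  linarith

/-- The constant in the bound for the moments of a sum of independent variables. -/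
def sumMomentConst (M : ℝ) : ℕ → ℝ
  | 0 => 1
  | q + 1 => 4 ^ (q + 1) * (sumMomentConst M q + M)

lemma sumMomentConst_nonneg {M : ℝ} (hM : 0 ≤ M) (q : ℕ) : 0 ≤ sumMomentConst M q := by
  induction q with
  | zero => simp [sumMomentConst]
  | succ q ih => rw [sumMomentConst]; positivity

section
variable {Ω : Type*} {d p : ℕ} {r : Fin d → ℝ} {n : Fin d → ℕ}
  {X : (j : Fin d) → Fin (n j) → Ω → ℝ} [MeasurableSpace Ω] {μ : Measure Ω}
  [IsProbabilityMeasure μ] {A B R M : ℝ}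

lemma MatchingArray.integrable_sum_pow (hX : MatchingArray μ p r n X) (hR : 0 < R)
    (hXR : ∀ j i, Integrable (fun ω => |X j i ω| ^ R) μ) (m : Fin d) (s : Finset (Fin (n m)))
    {k : ℕ} (hk : (k : ℝ) ≤ R) : Integrable (fun ω => (∑ i ∈ s, X m i ω) ^ k) μ := by
  have hm : Measurable fun ω => ∑ i ∈ s, X m i ω := Finset.measurable_sum _ fun i _ => hX.meas m i
  refine integrable_pow_of_le (X := fun ω => ∑ i ∈ s, X m i ω) hm hk ?_
  have h := hX.integrable_one_add_of_norm_le hR hXR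
    (V := fun ω (_ : Fin d) => ∑ i ∈ s, X m i ω) (measurable_pi_lambda _ fun _ => hm) fun ω => by
      rw [pi_norm_le_iff_of_nonneg (by positivity)]
      intro _
      calc ‖∑ i ∈ s, X m i ω‖ ≤ ∑ i ∈ s, |X m i ω| := norm_sum_le _ _
        _ ≤ ∑ i, |X m i ω| := Finset.sum_le_sum_of_subset_of_nonneg (Finset.subset_univ s)
            fun _ _ _ => abs_nonneg _
        _ ≤ _ := Finset.single_le_sum (f := fun m => ∑ i, |X m i ω|) (fun m _ => by positivity)
            (Finset.mem_univ m)
  have : Nonempty (Fin d) := ⟨m⟩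
  simpa [pi_norm_const] using h

/-- Induction on `q` and, inside, on the number of summands. A new summand increases the moment of
order `2q + 2` by at most a constant times the moment of order `2q` plus `M`, an increment of order
`card ^ q`. -/
lemma MatchingArray.sum_even_moment_le (hX : MatchingArray μ p r n X) (hp : 2 ≤ p) (hR : 0 < R)
    (hXR : ∀ j i, Integrable (fun ω => |X j i ω| ^ R) μ) (hM0 : 0 ≤ M) (m : Fin d)
    (hM : ∀ i, ∀ k : ℕ, (k : ℝ) ≤ R → ∫ ω, |X m i ω| ^ k ∂μ ≤ M) {q : ℕ}
    (hq : ((2 * q : ℕ) : ℝ) ≤ R) (s : Finset (Fin (n m))) :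
    ∫ ω, (∑ i ∈ s, X m i ω) ^ (2 * q) ∂μ ≤ sumMomentConst M q * (s.card : ℝ) ^ q := by
  classical
  induction q generalizing s with
  | zero => simp [sumMomentConst]
  | succ q ihq =>
    have hq2 : ((2 * q : ℕ) : ℝ) ≤ R := le_trans (by push_cast; linarith) hq
    have hC := sumMomentConst_nonneg hM0 q
    induction s using Finset.induction_on with
    | empty => simp
    | insert i s hi ih =>
      set S : Ω → ℝ := fun ω => ∑ i ∈ s, X m i ω with hS
      have hSm : Measurable S := Finset.measurable_sum _ fun i _ => hX.meas m i
      have hind : IndepFun S (X m i) μ := by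
        have h1 : iIndepFun (fun i => X m i) μ :=
          hX.indep.precomp (g := fun i : Fin (n m) => (⟨m, i⟩ : Σ m : Fin d, Fin (n m)))
            fun a b h => by simpa using h
        have h2 := h1.indepFun_finsetSum_of_notMem (fun i => hX.meas m i) hi
        convert! h2 using 1
        ext ω
        simp [hS]
      have hSi : ∀ k : ℕ, (k : ℝ) ≤ R → Integrable (fun ω => S ω ^ k) μ := fun k hk =>
        hX.integrable_sum_pow hR hXR m s hk
      have hXi : ∀ k : ℕ, (k : ℝ) ≤ R → Integrable (fun ω => X m i ω ^ k) μ := fun k hk => by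
        simpa using hX.integrable_sum_pow hR hXR m {i} hk
      have hind2 : ∀ a b : ℕ, IndepFun (fun ω => S ω ^ a) (fun ω => X m i ω ^ b) μ := fun a b =>
        hind.comp (measurable_id.pow_const a) (measurable_id.pow_const b)
      have hle : ∀ k : ℕ, k ≤ 2 * (q + 1) → (k : ℝ) ≤ R := fun k hk =>
        le_trans (by exact_mod_cast hk) hq
      have i1 : Integrable (fun ω => S ω ^ (2 * q + 1) * X m i ω ^ 1) μ := (hind2 (2 * q + 1) 1).integrable_mul (hSi _ (hle _ (by omega)))
        (hXi _ (hle _ (by omega)))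
      have i2 : Integrable (fun ω => S ω ^ (2 * q) * X m i ω ^ 2) μ := (hind2 (2 * q) 2).integrable_mul (hSi _ (hle _ (by omega)))
        (hXi _ (hle _ (by omega)))
      have e1 : ∫ ω, S ω ^ (2 * q + 1) * X m i ω ^ 1 ∂μ = 0 := by
        rw [(hind2 (2 * q + 1) 1).integral_fun_mul_eq_mul_integral
          (hSm.pow_const _).aestronglyMeasurable ((hX.meas m i).pow_const _).aestronglyMeasurable]
        simp [hX.moment_one hp]
      have e2 : ∫ ω, S ω ^ (2 * q) * X m i ω ^ 2 ∂μ = ∫ ω, S ω ^ (2 * q) ∂μ := by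
        rw [(hind2 (2 * q) 2).integral_fun_mul_eq_mul_integral
          (hSm.pow_const _).aestronglyMeasurable ((hX.meas m i).pow_const _).aestronglyMeasurable,
          hX.moment_two hp, mul_one]
      have hpt : ∀ ω, (∑ i' ∈ insert i s, X m i' ω) ^ (2 * (q + 1)) ≤
          S ω ^ (2 * (q + 1)) + (2 * q + 2) * (S ω ^ (2 * q + 1) * X m i ω ^ 1) +
            4 ^ (q + 1) * (S ω ^ (2 * q) * X m i ω ^ 2 + X m i ω ^ (2 * (q + 1))) := by
        intro ω
        have h := add_pow_le_second_order (S ω) (X m i ω) (2 * q)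
        rw [Finset.sum_insert hi, add_comm, show 2 * (q + 1) = 2 * q + 2 by ring]
        have ea : |S ω| ^ (2 * q) = S ω ^ (2 * q) := (even_two_mul q).pow_abs _
        have eb : |X m i ω| ^ (2 * q + 2) = X m i ω ^ (2 * q + 2) :=
          (show Even (2 * q + 2) from (even_two_mul q).add even_two).pow_abs _
        have ec : (2 : ℝ) ^ (2 * q + 2) = 4 ^ (q + 1) := by
          rw [show 2 * q + 2 = 2 * (q + 1) by ring, pow_mul]; norm_num
        rw [ea, eb, sq_abs, ec] at h
        push_cast at h
        simpa using h
      have j1 : Integrable (fun ω => S ω ^ (2 * (q + 1)) +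
          (2 * q + 2) * (S ω ^ (2 * q + 1) * X m i ω ^ 1)) μ :=
        (hSi _ (hle _ le_rfl)).add (i1.const_mul _)
      have j2 : Integrable (fun ω => S ω ^ (2 * q) * X m i ω ^ 2 + X m i ω ^ (2 * (q + 1))) μ :=
        i2.add (hXi _ (hle _ le_rfl))
      have hint := integral_mono (hX.integrable_sum_pow hR hXR m (insert i s) (hle _ le_rfl))
        (j1.add (j2.const_mul _)) hpt
      simp only [Pi.add_apply] at hint
      rw [integral_add j1 (j2.const_mul _), integral_add (hSi _ (hle _ le_rfl)) (i1.const_mul _),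
        integral_const_mul, integral_const_mul, e1, mul_zero, add_zero,
        integral_add i2 (hXi _ (hle _ le_rfl)), e2] at hint
      have hMq : ∫ ω, X m i ω ^ (2 * (q + 1)) ∂μ ≤ M := by
        have := hM i (2 * (q + 1)) (hle _ le_rfl)
        simpa only [(even_two_mul (q + 1)).pow_abs] using this
      have hS2 := ihq hq2 s
      refine hint.trans ?_
      rw [Finset.card_insert_of_notMem hi]
      set c : ℝ := (s.card : ℝ) with hc
      have hc0 : 0 ≤ c := Nat.cast_nonneg _
      push_cast
      have k1 : c ^ q ≤ (c + 1) ^ q := pow_le_pow_left₀ hc0 (by linarith) q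
      have k2 : 1 ≤ (c + 1) ^ q := one_le_pow₀ (by linarith)
      have k3 : sumMomentConst M (q + 1) = 4 ^ (q + 1) * (sumMomentConst M q + M) := rfl
      have k4 : sumMomentConst M q * c ^ q + M ≤ (sumMomentConst M q + M) * (c + 1) ^ q := by
        have := mul_le_mul_of_nonneg_left k1 hC
        have := mul_le_mul_of_nonneg_left k2 hM0
        linarith
      have k5 : ∫ ω, S ω ^ (2 * q) ∂μ + ∫ ω, X m i ω ^ (2 * (q + 1)) ∂μ ≤
          (sumMomentConst M q + M) * (c + 1) ^ q := by linarith
      have k6 := mul_le_mul_of_nonneg_left k5 (by positivity : (0 : ℝ) ≤ 4 ^ (q + 1))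
      rw [← mul_assoc, ← k3] at k6
      have hCq := sumMomentConst_nonneg hM0 (q + 1)
      -- The growth of `card ^ (q + 1)` under one insertion pays for the increment; `sumMomentConst`
      -- is defined so that its coefficient is exactly the constant of the next level.
      have k7 : c ^ (q + 1) + (c + 1) ^ q ≤ (c + 1) ^ (q + 1) := by
        have := mul_le_mul_of_nonneg_left k1 hc0
        rw [pow_succ, pow_succ]
        linarith
      have k8 := mul_le_mul_of_nonneg_left k7 hCq
      linarith

lemma abs_rpow_le_one_add_pow {x s : ℝ} (hs : 0 ≤ s) {q : ℕ} (hq : s ≤ ((2 * q : ℕ) : ℝ)) :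
    |x| ^ s ≤ 1 + x ^ (2 * q) := by
  have hx : 0 ≤ x ^ (2 * q) := (even_two_mul q).pow_nonneg x
  rcases le_total |x| 1 with h | h
  · have := Real.rpow_le_one (abs_nonneg x) h hs
    linarith
  · have := Real.rpow_le_rpow_of_exponent_le h hq
    rw [Real.rpow_natCast, (even_two_mul q).pow_abs] at this
    linarith

lemma MatchingArray.absMoment_sumVec_le (hX : MatchingArray μ p r n X) (hp : 2 ≤ p) (hR : 0 < R)
    (hXR : ∀ j i, Integrable (fun ω => |X j i ω| ^ R) μ) (hM0 : 0 ≤ M) (m : Fin d)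
    (hM : ∀ i, ∀ k : ℕ, (k : ℝ) ≤ R → ∫ ω, |X m i ω| ^ k ∂μ ≤ M) {q : ℕ}
    (hq : ((2 * q : ℕ) : ℝ) ≤ R) {s : ℝ} (hs : 0 ≤ s) (hsq : s ≤ ((2 * q : ℕ) : ℝ)) :
    absMoment μ (fun ω => sumVec X ω m) s ≤ 1 + sumMomentConst M q := by
  have hi : Integrable (fun ω => sumVec X ω m ^ (2 * q)) μ := by
    simp only [sumVec, mul_pow]
    exact (hX.integrable_sum_pow hR hXR m Finset.univ hq).const_mul _
  have h1 : absMoment μ (fun ω => sumVec X ω m) s ≤ ∫ ω, (1 + sumVec X ω m ^ (2 * q)) ∂μ :=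
    integral_mono_of_nonneg (Filter.Eventually.of_forall fun ω => by positivity)
      ((integrable_const 1).add hi)
      (Filter.Eventually.of_forall fun ω => abs_rpow_le_one_add_pow hs hsq)
  refine h1.trans ?_
  rw [integral_add (integrable_const 1) hi]
  simp only [sumVec, mul_pow]
  rw [integral_const_mul]
  have h2 := hX.sum_even_moment_le hp hR hXR hM0 m hM hq Finset.univ
  rw [Finset.card_univ, Fintype.card_fin] at h2
  have hn : (0 : ℝ) < n m := by exact_mod_cast hX.pos m
  have e : (1 / Real.sqrt (n m)) ^ (2 * q) = 1 / (n m : ℝ) ^ q := by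
    rw [pow_mul, div_pow, Real.sq_sqrt hn.le, one_pow, div_pow, one_pow]
  rw [e]
  have h3 := mul_le_mul_of_nonneg_left h2 (by positivity : 0 ≤ 1 / (n m : ℝ) ^ q)
  have e2 : 1 / (n m : ℝ) ^ q * (sumMomentConst M q * (n m : ℝ) ^ q) = sumMomentConst M q := by
    field_simp
  rw [e2] at h3
  simpa using h3

lemma card_mul_one_div_rpow_le {N k : ℕ} (hN : 0 < N) (hk : N ≤ k) {a : ℝ} (ha : 0 ≤ a) :
    (k : ℝ) * (1 / (k : ℝ) ^ (a + 1)) ≤ (N : ℝ) ^ (-a) := by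
  have hN' : (0 : ℝ) < N := by exact_mod_cast hN
  have hk' : (0 : ℝ) < k := by exact_mod_cast (by omega : 0 < k)
  have e : (k : ℝ) * (1 / (k : ℝ) ^ (a + 1)) = (k : ℝ) ^ (-a) := by
    rw [Real.rpow_add_one hk'.ne', Real.rpow_neg hk'.le]
    field_simp
  rw [e]
  exact Real.rpow_le_rpow_of_nonpos hN' (by exact_mod_cast hk) (by linarith)

lemma two_rpow_div_le {k : ℕ} (hk : 0 < k) {s c : ℝ} (hs : 0 ≤ s) (hc : 0 ≤ c) :
    c / (k : ℝ) ^ (s / 2) ≤ c :=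
  div_le_self hc (Real.one_le_rpow (by exact_mod_cast hk) (by positivity))

lemma bracketOne_le {K : ℝ} (hA : 0 ≤ A) (hB : 0 ≤ B) (hr : ∀ m, 0 ≤ r m) (hM0 : 0 ≤ M)
    {j : Fin d} {i : Fin (n j)} (hn : 0 < n j)
    (h1 : absMoment μ (X j i) (p + 2) ≤ M) (h2 : ∀ m, absMoment μ (X j i) (r m + p + 2) ≤ M)
    (hK : ∀ m, absMoment μ (fun ω => sumVec X ω m) (r m) ≤ K) :
    bracketOne μ p A B r X j i ≤ A * M + B * ∑ m, (2 : ℝ) ^ r m *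
      ((2 : ℝ) ^ r m * M * K + (2 : ℝ) ^ r m * M + normalAbsMoment (r m) * M) := by
  unfold bracketOne
  gcongr with m
  · exact absMoment_nonneg _
  · exact hK m
  · exact absMoment_nonneg _
  · exact two_rpow_div_le hn (hr m) (by positivity)
  · exact h2 m
  · exact normalAbsMoment_nonneg _

lemma bracketTwo_le {K : ℝ} (hA : 0 ≤ A) (hB : 0 ≤ B) (hr : ∀ m, 0 ≤ r m) (hM0 : 0 ≤ M)
    {j : Fin d} {i : Fin (n j)} (hn : 0 < n j)
    (h1 : absMoment μ (X j i) 3 ≤ M) (h2 : ∀ m, absMoment μ (X j i) (r m + 3) ≤ M)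
    (hK : ∀ m, absMoment μ (fun ω => sumVec X ω m) (r m) ≤ K) :
    bracketTwo μ A B r X j i ≤ A * M + B * ∑ m, (3 : ℝ) ^ r m *
      ((2 : ℝ) ^ r m * M * K + (2 : ℝ) ^ r m * M + 2 * normalAbsMoment (r m + 1) * M) := by
  unfold bracketTwo
  have h0 := normalAbsMoment_nonneg
  gcongr with m
  · exact absMoment_nonneg _
  · exact hK m
  · exact absMoment_nonneg _
  · exact two_rpow_div_le hn (hr m) (by positivity)
  · exact h2 m
  · exact mul_nonneg zero_le_two (h0 _)

lemma evenBound_le_of_brackets {H b₁ b₂ : ℝ} (hp : 2 ≤ p) (hH : 0 ≤ H)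
    (hM0 : 0 ≤ M) (hb₁ : 0 ≤ b₁) (hb₂ : 0 ≤ b₂)
    (hE : ∀ j i, |∫ ω, X j i ω ^ (p + 1) ∂μ| ≤ M)
    (h0 : ∀ j i, 0 ≤ bracketOne μ p A B r X j i) (h0' : ∀ j i, 0 ≤ bracketTwo μ A B r X j i)
    (h1 : ∀ j i, bracketOne μ p A B r X j i ≤ b₁) (h2 : ∀ j i, bracketTwo μ A B r X j i ≤ b₂)
    {N : ℕ} (hN : 0 < N) (hNn : ∀ j, N ≤ n j) :
    evenBound μ p A B r X H ≤ (1 / (p.factorial : ℝ) * (1 / ((p : ℝ) + 2) *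
      (d * ((2 + M) * b₁)) + 3 / 2 * (d * M * (d * b₂)))) * H * (N : ℝ) ^ (-((p : ℝ) / 2)) := by
  have hp' : (2 : ℝ) ≤ p := by exact_mod_cast hp
  have hN' : (0 : ℝ) < N := by exact_mod_cast hN
  have hS1 : ∑ j, ∑ i, 1 / (n j : ℝ) ^ ((p : ℝ) / 2 + 1) *
      (((p : ℝ) + 2) / ((p : ℝ) + 1) + |∫ ω, X j i ω ^ (p + 1) ∂μ|) *
        bracketOne μ p A B r X j i ≤ d * ((2 + M) * b₁) * (N : ℝ) ^ (-((p : ℝ) / 2)) := by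
    calc _ ≤ ∑ j : Fin d, ∑ _i : Fin (n j), 1 / (n j : ℝ) ^ ((p : ℝ) / 2 + 1) * (2 + M) * b₁ := by
          refine Finset.sum_le_sum fun j _ => Finset.sum_le_sum fun i _ => ?_
          have h3 : ((p : ℝ) + 2) / ((p : ℝ) + 1) ≤ 2 := by
            rw [div_le_iff₀ (by positivity)]
            linarith
          exact mul_le_mul (mul_le_mul_of_nonneg_left (add_le_add h3 (hE j i)) (by positivity))
            (h1 j i) (h0 j i) (by positivity)
      _ ≤ ∑ _j : Fin d, (N : ℝ) ^ (-((p : ℝ) / 2)) * ((2 + M) * b₁) := by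
          refine Finset.sum_le_sum fun j _ => ?_
          rw [Finset.sum_const, Finset.card_univ, Fintype.card_fin, nsmul_eq_mul, mul_assoc,
            ← mul_assoc (n j : ℝ)]
          exact mul_le_mul_of_nonneg_right
            (card_mul_one_div_rpow_le hN (hNn j) (by positivity)) (by positivity)
      _ = _ := by
          rw [Finset.sum_const, Finset.card_univ, Fintype.card_fin, nsmul_eq_mul]
          ring
  have hS2 : ∑ k, ∑ l, 1 / (n k : ℝ) ^ ((3 : ℝ) / 2) * bracketTwo μ A B r X k l ≤
      d * b₂ * (N : ℝ) ^ (-((1 : ℝ) / 2)) := by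
    calc _ ≤ ∑ k : Fin d, ∑ _l : Fin (n k), 1 / (n k : ℝ) ^ ((3 : ℝ) / 2) * b₂ := by
          refine Finset.sum_le_sum fun j _ => Finset.sum_le_sum fun i _ => ?_
          exact mul_le_mul_of_nonneg_left (h2 j i) (by positivity)
      _ ≤ ∑ _k : Fin d, (N : ℝ) ^ (-((1 : ℝ) / 2)) * b₂ := by
          refine Finset.sum_le_sum fun j _ => ?_
          rw [Finset.sum_const, Finset.card_univ, Fintype.card_fin, nsmul_eq_mul, ← mul_assoc]
          refine mul_le_mul_of_nonneg_right ?_ hb₂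
          have := card_mul_one_div_rpow_le hN (hNn j) (by norm_num : (0 : ℝ) ≤ 1 / 2)
          rwa [show (1 : ℝ) / 2 + 1 = 3 / 2 by norm_num] at this
      _ = _ := by
          rw [Finset.sum_const, Finset.card_univ, Fintype.card_fin, nsmul_eq_mul]
          ring
  have hS3 : ∑ j, ∑ i, |∫ ω, X j i ω ^ (p + 1) ∂μ| / (n j : ℝ) ^ (((p : ℝ) + 1) / 2) *
      ∑ k, ∑ l, 1 / (n k : ℝ) ^ ((3 : ℝ) / 2) * bracketTwo μ A B r X k l ≤
      d * M * (d * b₂) * (N : ℝ) ^ (-((p : ℝ) / 2)) := by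
    have hV0 : 0 ≤ ∑ k, ∑ l, 1 / (n k : ℝ) ^ ((3 : ℝ) / 2) * bracketTwo μ A B r X k l :=
      Finset.sum_nonneg fun k _ => Finset.sum_nonneg fun l _ =>
        mul_nonneg (by positivity) (h0' k l)
    set V := ∑ k, ∑ l, 1 / (n k : ℝ) ^ ((3 : ℝ) / 2) * bracketTwo μ A B r X k l
    -- The `n j` summands with weight `n_j^{-(p+1)/2}` give the first factor, and the inner sum with
    -- weights `n_k^{-3/2}` gives the `N^{-1/2}` due to evenness.
    have ep : (N : ℝ) ^ (-(((p : ℝ) - 1) / 2)) * (N : ℝ) ^ (-((1 : ℝ) / 2)) =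
        (N : ℝ) ^ (-((p : ℝ) / 2)) := by
      rw [← Real.rpow_add hN']
      ring_nf
    calc _ ≤ ∑ j : Fin d, ∑ _i : Fin (n j),
          1 / (n j : ℝ) ^ (((p : ℝ) - 1) / 2 + 1) * (M * V) := by
          refine Finset.sum_le_sum fun j _ => Finset.sum_le_sum fun i _ => ?_
          rw [show ((p : ℝ) - 1) / 2 + 1 = ((p : ℝ) + 1) / 2 by ring, ← mul_assoc]
          refine mul_le_mul_of_nonneg_right ?_ hV0
          rw [div_eq_mul_one_div, mul_comm]
          exact mul_le_mul_of_nonneg_left (hE j i) (by positivity)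
      _ ≤ ∑ _j : Fin d, (N : ℝ) ^ (-(((p : ℝ) - 1) / 2)) *
          (M * (d * b₂ * (N : ℝ) ^ (-((1 : ℝ) / 2)))) := by
          refine Finset.sum_le_sum fun j _ => ?_
          rw [Finset.sum_const, Finset.card_univ, Fintype.card_fin, nsmul_eq_mul, ← mul_assoc]
          exact mul_le_mul (card_mul_one_div_rpow_le hN (hNn j) (by linarith))
            (mul_le_mul_of_nonneg_left hS2 hM0) (by positivity) (by positivity)
      _ = _ := by
          rw [Finset.sum_const, Finset.card_univ, Fintype.card_fin, nsmul_eq_mul, ← ep]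
          ring
  unfold evenBound
  calc _ ≤ 1 / (p.factorial : ℝ) * H * (1 / ((p : ℝ) + 2) *
        (d * ((2 + M) * b₁) * (N : ℝ) ^ (-((p : ℝ) / 2))) +
        3 / 2 * (d * M * (d * b₂) * (N : ℝ) ^ (-((p : ℝ) / 2)))) := by gcongr
    _ = _ := by ring

end

/-- The bound is of the order `N ^ (-p/2)`. -/
theorem exists_evenBound_le (d p : ℕ) (hp : 2 ≤ p) (A B : ℝ) (hA : 0 ≤ A) (hB : 0 ≤ B)
    (r : Fin d → ℝ) (hr : ∀ k, 0 ≤ r k) (M : ℝ) : ∃ C : ℝ,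
      ∀ (Ω : Type u) [MeasurableSpace Ω] (μ : Measure Ω) [IsProbabilityMeasure μ]
        (n : Fin d → ℕ) (X : (j : Fin d) → Fin (n j) → Ω → ℝ),
        MatchingArray μ p r n X →
        (∀ j i l, absMoment μ (X j i) (r l + p + 2) ≤ M) →
        ∀ N : ℕ, 0 < N → (∀ j, N ≤ n j) → ∀ H : ℝ, 0 ≤ H →
          evenBound μ p A B r X H ≤ C * H * (N : ℝ) ^ (-((p : ℝ) / 2)) := by
  obtain ⟨ρ, hρ, hrρ, hmax⟩ := exists_max_exponent hr
  -- `M` may be negative; the maximum keeps all constants nonnegative.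
  set M' := max M 1 with hM'
  have hM0 : 0 ≤ M' := le_trans zero_le_one (le_max_right _ _)
  -- This `2 * q` is an even integer lying between `ρ` and `ρ + 2`, so it dominates every `r m` and
  -- stays within the available moments.
  set q := ⌊ρ / 2⌋₊ + 1 with hq
  have hp' : (2 : ℝ) ≤ p := by exact_mod_cast hp
  have hqρ : ρ ≤ ((2 * q : ℕ) : ℝ) := by
    have := Nat.lt_floor_add_one (ρ / 2)
    rw [hq]
    push_cast
    linarith
  have hqR : ((2 * q : ℕ) : ℝ) ≤ ρ + p + 2 := by
    have := Nat.floor_le (by positivity : 0 ≤ ρ / 2)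
    rw [hq]
    push_cast
    linarith
  set K := 1 + sumMomentConst M' q
  have hK : 0 ≤ K := by
    have := sumMomentConst_nonneg hM0 q
    positivity
  have hZ := normalAbsMoment_nonneg
  set b₁ := A * M' + B * ∑ m, (2 : ℝ) ^ r m *
      ((2 : ℝ) ^ r m * M' * K + (2 : ℝ) ^ r m * M' + normalAbsMoment (r m) * M')
  set b₂ := A * M' + B * ∑ m, (3 : ℝ) ^ r m *
      ((2 : ℝ) ^ r m * M' * K + (2 : ℝ) ^ r m * M' + 2 * normalAbsMoment (r m + 1) * M')
  have hb₁ : 0 ≤ b₁ := add_nonneg (mul_nonneg hA hM0) (mul_nonneg hB (Finset.sum_nonneg fun m _ => by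
    have := hZ (r m)
    positivity))
  have hb₂ : 0 ≤ b₂ := add_nonneg (mul_nonneg hA hM0) (mul_nonneg hB (Finset.sum_nonneg fun m _ => by
    have := hZ (r m + 1)
    positivity))
  refine ⟨1 / (p.factorial : ℝ) * (1 / ((p : ℝ) + 2) * (d * ((2 + M') * b₁)) +
    3 / 2 * (d * M' * (d * b₂))), fun Ω _ μ _ n X hX hXM N hN hNn H hH => ?_⟩
  have hXR : ∀ j i, Integrable (fun ω => |X j i ω| ^ (ρ + p + 2)) μ := fun j i => by
    obtain ⟨l, hl⟩ := hmax j
    rw [hl]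
    exact hX.integrable j i l
  have hR2 : (2 : ℝ) ≤ ρ + p + 2 := by linarith
  have htop : ∀ j i, absMoment μ (X j i) (ρ + p + 2) ≤ M' := fun j i => by
    obtain ⟨l, hl⟩ := hmax j
    rw [hl]
    exact (hXM j i l).trans (le_max_left _ _)
  have hmom : ∀ j i, ∀ s, 0 ≤ s → s ≤ ρ + p + 2 → absMoment μ (X j i) s ≤ M' := fun j i s h0 h1 =>
    (hX.abs_moment_le hp hR2 le_rfl hXR j i h0 h1).2.trans (htop j i)
  have hpow : ∀ j i, ∀ k : ℕ, (k : ℝ) ≤ ρ + p + 2 → ∫ ω, |X j i ω| ^ k ∂μ ≤ M' := fun j i k hk =>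
    (hX.pow_moment_le hp hR2 le_rfl hXR j i hk).2.trans (htop j i)
  have hW : ∀ m, absMoment μ (fun ω => sumVec X ω m) (r m) ≤ K := fun m =>
    hX.absMoment_sumVec_le hp (by linarith) hXR hM0 m (hpow m) hqR (hr m) ((hrρ m).trans hqρ)
  refine evenBound_le_of_brackets hp hH hM0 hb₁ hb₂ (fun j i => ?_)
    (fun j i => bracketOne_nonneg hA hB j i) (fun j i => bracketTwo_nonneg hA hB j i)
    (fun j i => bracketOne_le hA hB hr hM0 (hX.pos j) (hmom j i _ (by linarith) (by linarith))
      (fun m => hmom j i _ (by linarith [hr m]) (by linarith [hrρ m])) hW)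
    (fun j i => bracketTwo_le hA hB hr hM0 (hX.pos j) (hmom j i _ (by linarith) (by linarith))
      (fun m => hmom j i _ (by linarith [hr m]) (by linarith [hrρ m])) hW) hN hNn
  rw [← Real.norm_eq_abs]
  refine (norm_integral_le_integral_norm _).trans ?_
  simp only [norm_pow, Real.norm_eq_abs]
  exact hpow j i (p + 1) (by push_cast; linarith)

end

theorem theorem3p3 (d p : ℕ) (hp : 2 ≤ p) (hpe : Even p) (A B : ℝ) (hA : 0 ≤ A) (hB : 0 ≤ B)
    (r : Fin d → ℝ) (hr : ∀ k, 0 ≤ r k) :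
    (∀ (Ω : Type u) [MeasurableSpace Ω] (μ : Measure Ω) [IsProbabilityMeasure μ]
        (n : Fin d → ℕ) (X : (j : Fin d) → Fin (n j) → Ω → ℝ),
        MatchingArray μ p r n X →
        ∀ g : (Fin d → ℝ) → ℝ, ClassCP (p + 2) (polyDom A B r) g → (∀ w, g (-w) = g w) →
        ∀ h : ℝ → ℝ, ClassCb (p + 2) h →
          Integrable (fun ω => h (g (sumVec X ω))) μ ∧
          Integrable (fun z => h (g z)) (stdNormal d) ∧
          |∫ ω, h (g (sumVec X ω)) ∂μ - ∫ z, h (g z) ∂(stdNormal d)|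
            ≤ evenBound μ p A B r X (hConst (p + 2) h)) ∧
    (∀ M : ℝ, ∃ C : ℝ,
      ∀ (Ω : Type u) [MeasurableSpace Ω] (μ : Measure Ω) [IsProbabilityMeasure μ]
        (n : Fin d → ℕ) (X : (j : Fin d) → Fin (n j) → Ω → ℝ),
        MatchingArray μ p r n X →
        (∀ j i l, absMoment μ (X j i) (r l + p + 2) ≤ M) →
        ∀ N : ℕ, 0 < N → (∀ j, N ≤ n j) →
        ∀ h : ℝ → ℝ, ClassCb (p + 2) h →
          evenBound μ p A B r X (hConst (p + 2) h)
            ≤ C * hConst (p + 2) h * (N : ℝ) ^ (-((p : ℝ) / 2))) := by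
  refine ⟨fun Ω _ μ _ n X hX g hg heven h hh =>
    hX.abs_integral_comp_sub_le hp hpe hr hA hB hg heven hh, fun M => ?_⟩
  obtain ⟨C, hC⟩ := exists_evenBound_le d p hp A B hA hB r hr M
  exact ⟨C, fun Ω _ μ _ n X hX hM N hN hNn h _ =>
    hC Ω μ n X hX hM N hN hNn _ (hConst_nonneg _ _)⟩
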